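/- Let $M$ be a (Hausdorff) smooth Riemannian manifold of dimension $m+1$ ($m\ge 0$), $p\in M$ and $0<\varepsilon\le\infty$. Put $B_\varepsilon=\{v\in T_pM:\|v\|<\varepsilon\}$ and $U_\varepsilon=\exp_p(B_\varepsilon)$. Call $U_\varepsilon$ a *normal ball* if $\exp_p$ is defined on $B_\varepsilon$ and maps it diffeomorphically onto the open set $U_\varepsilon$. For $0<R<\varepsilon$ the *geodesic sphere* of radius $R$ with center $p$ is $\exp_p(\{v\in T_pM:\|v\|=R\})$. Let $1\le k\le\infty$ and let $J\subset\mathbb{R}$ be a nondegenerate interval. A *regular curve* on $J$ is a $C^k$ curve on $J$ with nowhere vanishing velocity. A regular curve $\alpha:J\to U_\varepsilon$ is *normal with center $p$* if, for every $s\in J$, the geodesic $\beta_s:[0,1]\to U_\varepsilon$ from $p$ to $\alpha(s)$ satisfies $\langle\alpha'(s),\beta_s'(1)\rangle=0$. 1. There is an $\varepsilon>0$ for which $U_\varepsilon$ is a normal ball and a neighborhood of $p$. For every $\varepsilon$ such that $U_\varepsilon$ is a normal ball, the following hold: (a) every $q\in U_\varepsilon$ is joined to $p$ by exactly one geodesic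 $[0,1]\to U_\varepsilon$; (b) a regular curve $\alpha:J\to U_\varepsilon$ of class $C^k$ is normal with center $p$ if and only if it lies on a geodesic sphere with center $p$ and radius $R$, for some $0<R<\varepsilon$; (c) a curve $\alpha$ on $J$ is a normal curve of class $C^k$ in $U_\varepsilon$ with center $p$ if and only if $\alpha=\exp_p\circ\gamma$ on $J$ for some regular curve $\gamma:J\to T_pM$ of class $C^k$ with $\|\gamma\|\equiv R$, for some $0<R<\varepsilon$. 2. Let $r>0$ and $M=\mathbb{S}^{m+1}(r)=\{q\in\mathbb{R}^{m+2}:\langle q,q\rangle=r^2\}$ with the metric induced by the Euclidean inner product. For every $p\in M$, $U_{\pi r}=\mathbb{S}^{m+1}(r)\setminus\{-p\}$ is a normal ball, and (a), (b), (c) hold with $\varepsilon=\pi r$. 3. Let $r>0$ and $M=\mathbb{H}^{m+1}(r)=\{q\in\mathbb{R}^{m+2}:\langle q,q\rangle_1=-r^2,\ q_1>0\}$, where $\langle x,y\rangle_1=-x_1y_1+\sum_{i=2}^{m+2}x_iy_i$, with the metric induced by $\langle\cdot,\cdot\rangle_1$. For every $p\in M$, $U_\infty=\mathbb{H}^{m+1}(r)$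 is a normal ball, and (a), (b), (c) hold with $\varepsilon=\infty$. -/

import Mathlib

open scoped Manifold ContDiff Topology
open Bundle Set

noncomputable section

namespace NormalCurves

/-! ### Geodesics, exponential map, normal balls and normal curves in a Riemannian manifold -/

section General

variable {n : ℕ} {M : Type*} [TopologicalSpace M] [ChartedSpace (EuclideanSpace ℝ (Fin n)) M]
  [RiemannianBundle (fun x : M => TangentSpace (𝓡 n) x)]

/-- The Riemannian metric in the coordinates of the chart at `x₀`: the number `g_y(u, v)` for a
point `y` and vectors `u`, `v` of the coordinate space. -/
def metricInChart (x₀ : M) (y u v : EuclideanSpace ℝ (Fin n)) : ℝ :=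
  inner ℝ
    (mfderiv 𝓘(ℝ, EuclideanSpace ℝ (Fin n)) (𝓡 n) (extChartAt (𝓡 n) x₀).symm y u)
    (mfderiv 𝓘(ℝ, EuclideanSpace ℝ (Fin n)) (𝓡 n) (extChartAt (𝓡 n) x₀).symm y v)

/-- Christoffel symbols of the first kind of the Levi-Civita connection in the chart at `x₀`:
`g(∇_u v, w) = (∂_u g(v, w) + ∂_v g(u, w) - ∂_w g(u, v)) / 2` for constant coordinate fields. -/
def christoffelInChart (x₀ : M) (y u v w : EuclideanSpace ℝ (Fin n)) : ℝ :=
  (1 / 2) * (fderiv ℝ (fun z => metricInChart x₀ z v w) y u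
    + fderiv ℝ (fun z => metricInChart x₀ z u w) y v
    - fderiv ℝ (fun z => metricInChart x₀ z u v) y w)

/-- The curve `β` is `C^2` near `t` and satisfies the geodesic equation `∇_{β'} β' = 0` at `t`,
written in every chart around `β t` and tested against every vector `w`:
`g(x'', w) + g(Γ(x', x'), w) = 0`, where `x` is the coordinate expression of `β`. -/
def IsGeodesicAt (β : ℝ → M) (t : ℝ) : Prop :=
  ContMDiffAt 𝓘(ℝ, ℝ) (𝓡 n) 2 β t ∧
  ∀ x₀ : M, β t ∈ (chartAt (EuclideanSpace ℝ (Fin n)) x₀).source →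
    ∀ w : EuclideanSpace ℝ (Fin n),
      let x : ℝ → EuclideanSpace ℝ (Fin n) := fun τ => extChartAt (𝓡 n) x₀ (β τ)
      metricInChart x₀ (x t) (deriv (deriv x) t) w
        + christoffelInChart x₀ (x t) (deriv x t) (deriv x t) w = 0

variable (n) in
/-- `β` restricted to `[0, 1]` is a geodesic segment. -/
def IsGeodesicSegment (β : ℝ → M) : Prop := ∀ t ∈ Icc (0 : ℝ) 1, IsGeodesicAt (n := n) β t

variable (n) in
/-- `β` restricted to `[0, 1]` is a geodesic segment that runs in `U` from `p` to `q`. -/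
structure IsGeodesicSegmentIn (U : Set M) (p q : M) (β : ℝ → M) : Prop where
  geodesic : IsGeodesicSegment n β
  mapsTo : MapsTo β (Icc 0 1) U
  source : β 0 = p
  target : β 1 = q

variable (n) in
/-- The velocity vector of the curve `β` at `t`, with its foot point `β t`. -/
def velocity {M : Type*} [TopologicalSpace M] [ChartedSpace (EuclideanSpace ℝ (Fin n)) M]
    (β : ℝ → M) (t : ℝ) : TangentBundle (𝓡 n) M :=
  ⟨β t, mfderiv 𝓘(ℝ, ℝ) (𝓡 n) β t (1 : ℝ)⟩

/-- The domain of `exp_p`: the initial velocities of geodesic segments on `[0, 1]` from `p`. -/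
def expDomain (p : M) : Set (TangentSpace (𝓡 n) p) :=
  {v | ∃ β : ℝ → M, IsGeodesicSegment n β ∧ velocity n β 0 = ⟨p, v⟩}

open Classical in
/-- The exponential map: `exp_p v = β 1` for the geodesic `β` with `β 0 = p` and `β' 0 = v`
(with the irrelevant value `p` outside its domain). -/
def expMap (p : M) (v : TangentSpace (𝓡 n) p) : M :=
  if h : v ∈ expDomain p then h.choose 1 else p

/-- The open ball of radius `ε` (possibly infinite) about the origin of `T_p M`. -/
def tangentBall (p : M) (ε : ENNReal) : Set (TangentSpace (𝓡 n) p) := {v | ‖v‖ₑ < ε}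

variable (n) in
/-- The image under `exp_p` of the open ball of radius `ε` of `T_p M`. -/
def geodesicBall (p : M) (ε : ENNReal) : Set M := expMap (n := n) p '' tangentBall p ε

variable (n) in
/-- The geodesic sphere of radius `R` with center `p`: the image under `exp_p` of the Euclidean
sphere of radius `R` about the origin of `T_p M`. -/
def geodesicSphere (p : M) (R : ℝ) : Set M :=
  expMap p '' {v : TangentSpace (𝓡 n) p | ‖v‖ = R}

variable (n) in
/-- The geodesic ball of radius `ε` with center `p` is a normal ball: `exp_p` is defined on the
ball of radius `ε` of `T_p M` and maps it diffeomorphically onto its (open) image. -/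
structure IsNormalBall (p : M) (ε : ENNReal) : Prop where
  pos : 0 < ε
  subset_expDomain : tangentBall p ε ⊆ expDomain (n := n) p
  injOn : InjOn (expMap (n := n) p) (tangentBall p ε)
  isLocalDiffeomorphOn :
    IsLocalDiffeomorphOn 𝓘(ℝ, TangentSpace (𝓡 n) p) (𝓡 n) ∞ (expMap (n := n) p) (tangentBall p ε)

variable (n) in
/-- A regular curve of class `C^k` on the set `J` of parameters. -/
structure IsRegularCurve {M : Type*} [TopologicalSpace M]
    [ChartedSpace (EuclideanSpace ℝ (Fin n)) M] (k : ℕ∞) (α : ℝ → M) (J : Set ℝ) : Prop where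
  contMDiffOn : ContMDiffOn 𝓘(ℝ, ℝ) (𝓡 n) k α J
  deriv_ne_zero : ∀ s ∈ J, mfderivWithin 𝓘(ℝ, ℝ) (𝓡 n) α J s (1 : ℝ) ≠ 0

variable (n) in
/-- A regular curve `α : J → U` of class `C^k` is a normal curve with center `p`, relative to the
neighborhood `U` of `p`, if for every `s ∈ J` the geodesic in `U` from `p` to `α s` meets `α`
orthogonally at `α s`. -/
structure IsNormalCurve (k : ℕ∞) (p : M) (U : Set M) (α : ℝ → M) (J : Set ℝ) : Prop where
  regular : IsRegularCurve n k α J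
  mapsTo : MapsTo α J U
  orthogonal : ∀ s ∈ J, ∃ β : ℝ → M, IsGeodesicSegmentIn n U p (α s) β ∧
    ∃ w : TangentSpace (𝓡 n) (α s), velocity n β 1 = ⟨α s, w⟩ ∧
      inner ℝ (mfderivWithin 𝓘(ℝ, ℝ) (𝓡 n) α J s (1 : ℝ) : TangentSpace (𝓡 n) (α s)) w = 0

/-- A regular curve of class `C^k` in the Euclidean space `T_p M` which lies on the sphere of
radius `R` about the origin. -/
structure IsEuclideanSphericalCurve (k : ℕ∞) (p : M) (R : ℝ) (γ : ℝ → TangentSpace (𝓡 n) p)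
    (J : Set ℝ) : Prop where
  contDiffOn : ContDiffOn ℝ k γ J
  deriv_ne_zero : ∀ s ∈ J, derivWithin γ J s ≠ 0
  norm_eq : ∀ s ∈ J, ‖γ s‖ = R

variable (n) in
/-- Normal curves and geodesic spherical curves with center `p` coincide in the geodesic ball `U`
of radius `ε` with center `p`. -/
structure NormalIffSpherical (p : M) (ε : ENNReal) : Prop where
  /-- Every point of `U` is joined to `p` by exactly one geodesic segment in `U`. -/
  existsUnique_geodesic : ∀ q ∈ geodesicBall n p ε,
    ∃ β : ℝ → M, IsGeodesicSegmentIn n (geodesicBall n p ε) p q β ∧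
      ∀ β' : ℝ → M, IsGeodesicSegmentIn n (geodesicBall n p ε) p q β' → EqOn β' β (Icc 0 1)
  /-- A regular curve in `U`, defined on a nondegenerate interval `J`, is normal with center `p`
  if and only if it lies on a geodesic sphere with center `p`. -/
  normal_iff_mem_geodesicSphere : ∀ (k : ℕ∞), 1 ≤ k →
    ∀ J : Set ℝ, J.OrdConnected → J.Nontrivial →
    ∀ α : ℝ → M, IsRegularCurve n k α J → MapsTo α J (geodesicBall n p ε) →
      (IsNormalCurve n k p (geodesicBall n p ε) α J ↔
        ∃ R : ℝ, 0 < R ∧ ENNReal.ofReal R < ε ∧ ∀ s ∈ J, α s ∈ geodesicSphere n p R)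
  /-- The normal curves in `U` with center `p` are exactly the images under `exp_p` of the regular
  Euclidean spherical curves of radius less than `ε` about the origin of `T_p M`. -/
  normal_iff_image : ∀ (k : ℕ∞), 1 ≤ k →
    ∀ J : Set ℝ, J.OrdConnected → J.Nontrivial →
    ∀ α : ℝ → M, (IsNormalCurve n k p (geodesicBall n p ε) α J ↔
        ∃ (R : ℝ) (γ : ℝ → TangentSpace (𝓡 n) p), 0 < R ∧ ENNReal.ofReal R < ε ∧
          IsEuclideanSphericalCurve k p R γ J ∧ ∀ s ∈ J, α s = expMap p (γ s))

end General

/-! ### The Riemannian metric induced by a map into a vector space with a bilinear form -/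

section Ind
variable {E : Type*} [NormedAddCommGroup E] [NormedSpace ℝ E]
  {M : Type*} [TopologicalSpace M] [ChartedSpace E M]
  {F : Type*} [NormedAddCommGroup F] [NormedSpace ℝ F]

/-- The pull-back of the bilinear form `B` of `F` under the differential of `ι : M → F`. -/
def inducedForm (B : F →L[ℝ] F →L[ℝ] ℝ) (ι : M → F) (x : M) :
    TangentSpace 𝓘(ℝ, E) x →L[ℝ] TangentSpace 𝓘(ℝ, E) x →L[ℝ] ℝ :=
  let D : E →L[ℝ] F := mfderiv 𝓘(ℝ, E) 𝓘(ℝ, F) ι x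
  (B.bilinearComp D D : E →L[ℝ] E →L[ℝ] ℝ)

theorem inducedForm_apply (B : F →L[ℝ] F →L[ℝ] ℝ) (ι : M → F) (x : M)
    (v w : TangentSpace 𝓘(ℝ, E) x) :
    inducedForm B ι x v w
      = B (mfderiv 𝓘(ℝ, E) 𝓘(ℝ, F) ι x v) (mfderiv 𝓘(ℝ, E) 𝓘(ℝ, F) ι x w) := rfl

theorem isVonNBounded_of_pos [FiniteDimensional ℝ E] (b : E →L[ℝ] E →L[ℝ] ℝ)
    (hb : ∀ v, v ≠ 0 → 0 < b v v) : Bornology.IsVonNBounded ℝ {v | b v v < 1} := by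
  rw [NormedSpace.isVonNBounded_iff, isBounded_iff_forall_norm_le]
  rcases (Metric.sphere (0 : E) 1).eq_empty_or_nonempty with he | hne
  · refine ⟨0, fun v _ => ?_⟩
    by_contra! hv
    have : (‖v‖⁻¹ • v) ∈ Metric.sphere (0 : E) 1 := by
      simp [norm_smul, hv.ne']
    simp [he] at this
  · obtain ⟨u, hu, hmin⟩ := (isCompact_sphere (0 : E) 1).exists_isMinOn hne
      (f := fun v => b v v) (b.continuous.clm_apply continuous_id).continuousOn
    have hu0 : u ≠ 0 := by
      rintro rfl
      simp at hu
    have hc := hb u hu0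
    refine ⟨Real.sqrt (1 / b u u), fun v hv => ?_⟩
    apply Real.le_sqrt_of_sq_le
    rw [le_div_iff₀ hc]
    rcases eq_or_ne v 0 with rfl | hv0
    · simp
    have hv' : 0 < ‖v‖ := norm_pos_iff.2 hv0
    have h1 : b u u ≤ b (‖v‖⁻¹ • v) (‖v‖⁻¹ • v) :=
      hmin (by simp [norm_smul, hv'.ne'])
    simp only [map_smul, smul_eq_mul, smul_apply] at h1
    have h2 : ‖v‖ ^ 2 * (‖v‖⁻¹ * (‖v‖⁻¹ * b v v)) = b v v := by field_simp
    have h3 := mul_le_mul_of_nonneg_left h1 (sq_nonneg ‖v‖)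
    rw [h2] at h3
    exact h3.trans (le_of_lt hv)

theorem contDiff_bilinearComp_diag [FiniteDimensional ℝ E] (B : F →L[ℝ] F →L[ℝ] ℝ) :
    ContDiff ℝ ∞ (fun L : E →L[ℝ] F => (B.bilinearComp L L : E →L[ℝ] E →L[ℝ] ℝ)) := by
  refine contDiff_clm_apply_iff.2 fun u => contDiff_clm_apply_iff.2 fun v => ?_
  simp only [ContinuousLinearMap.bilinearComp_apply]
  exact (contDiff_const.clm_apply (contDiff_id.clm_apply contDiff_const)).clm_apply
    (contDiff_id.clm_apply contDiff_const)

variable [IsManifold 𝓘(ℝ, E) ∞ M]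

theorem contMDiff_inducedForm [FiniteDimensional ℝ E] (B : F →L[ℝ] F →L[ℝ] ℝ) (ι : M → F)
    (hι : ContMDiff 𝓘(ℝ, E) 𝓘(ℝ, F) ∞ ι) :
    ContMDiff 𝓘(ℝ, E) (𝓘(ℝ, E).prod 𝓘(ℝ, E →L[ℝ] E →L[ℝ] ℝ)) ∞
      (fun x => TotalSpace.mk' (E →L[ℝ] E →L[ℝ] ℝ)
        (E := fun x : M => TangentSpace 𝓘(ℝ, E) x →L[ℝ] TangentSpace 𝓘(ℝ, E) x →L[ℝ] ℝ)
        x (inducedForm B ι x)) := by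
  intro x
  rw [contMDiffAt_section]
  have h := (hι x).mfderiv_const (m := ∞) (by simp)
  set D : M → E →L[ℝ] F :=
    inTangentCoordinates 𝓘(ℝ, E) 𝓘(ℝ, F) id ι (mfderiv 𝓘(ℝ, E) 𝓘(ℝ, F) ι) x with hD
  have hB : ContMDiffAt 𝓘(ℝ, E) 𝓘(ℝ, E →L[ℝ] E →L[ℝ] ℝ) ∞
      ((fun L : E →L[ℝ] F => (B.bilinearComp L L : E →L[ℝ] E →L[ℝ] ℝ)) ∘ D) x := by
    exact (contDiff_bilinearComp_diag B).contMDiff.contMDiffAt.comp x h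
  refine hB.congr_of_eventuallyEq ?_
  filter_upwards [(chartAt E x).open_source.mem_nhds (mem_chart_source _ x)] with y hy
  have hy' : y ∈ (trivializationAt E (TangentSpace 𝓘(ℝ, E) : M → Type _) x).baseSet := hy
  ext u v
  rw [hom_trivializationAt_apply]
  simp only [Function.comp_apply, hD, inTangentCoordinates, ContinuousLinearMap.bilinearComp_apply]
  rw [inCoordinates_apply_eq₂ hy' hy' (by simp)]
  simp only [ContinuousLinearMap.inCoordinates, ContinuousLinearMap.comp_apply, id]
  erw [TangentBundle.continuousLinearMapAt_model_space]
  simp only [Trivial.linearMapAt_trivialization, Trivial.fiberBundle_trivializationAt', LinearMap.id_apply]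
  rw [← Trivialization.symmL_apply (R := ℝ) _ hy' u, ← Trivialization.symmL_apply (R := ℝ) _ hy' v]
  rfl

/-- The Riemannian metric on `M` induced by a smooth map `ι : M → F` and a symmetric bilinear form
`B` on `F` whose pull-back under `ι` is positive definite. -/
def inducedMetric [FiniteDimensional ℝ E] (B : F →L[ℝ] F →L[ℝ] ℝ)
    (hB : ∀ v w, B v w = B w v) (ι : M → F)
    (hι : ContMDiff 𝓘(ℝ, E) 𝓘(ℝ, F) ∞ ι)
    (hpos : ∀ (x : M) (v : TangentSpace 𝓘(ℝ, E) x), v ≠ 0 → 0 < inducedForm B ι x v v) :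
    ContMDiffRiemannianMetric 𝓘(ℝ, E) ∞ E (fun x : M => TangentSpace 𝓘(ℝ, E) x) where
  inner := inducedForm B ι
  symm _ _ _ := hB _ _
  pos := hpos
  isVonNBounded x := isVonNBounded_of_pos (E := E) (inducedForm B ι x) (hpos x)
  contMDiff := contMDiff_inducedForm B ι hι

end Ind

/-! ### The sphere of radius `r` -/

section Sphere

/-- The sphere `S^{m+1}(r) = {q ∈ ℝ^{m+2} : ⟨q, q⟩ = r^2}`. -/
def RSphere (m : ℕ) (r : ℝ) : Type :=
  {q : EuclideanSpace ℝ (Fin (m + 2)) // inner ℝ q q = r ^ 2}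

variable {m : ℕ} {r : ℝ}

instance : TopologicalSpace (RSphere m r) :=
  inferInstanceAs (TopologicalSpace {q : EuclideanSpace ℝ (Fin (m + 2)) // inner ℝ q q = r ^ 2})

instance : T2Space (RSphere m r) :=
  inferInstanceAs (T2Space {q : EuclideanSpace ℝ (Fin (m + 2)) // inner ℝ q q = r ^ 2})

/-- The inclusion of `S^{m+1}(r)` in `ℝ^{m+2}`. -/
def RSphere.incl (q : RSphere m r) : EuclideanSpace ℝ (Fin (m + 2)) := q.1

theorem RSphere.continuous_incl : Continuous (RSphere.incl (m := m) (r := r)) :=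
  continuous_induced_dom

theorem RSphere.norm_incl [hr : Fact (0 < r)] (q : RSphere m r) : ‖q.incl‖ = r := by
  have h : ‖q.incl‖ ^ 2 = r ^ 2 := (real_inner_self_eq_norm_sq _).symm.trans q.2
  exact (sq_eq_sq₀ (norm_nonneg _) hr.out.le).1 h

/-- Rescaling to the unit sphere. -/
def RSphere.toUnit [hr : Fact (0 < r)] (q : RSphere m r) :
    Metric.sphere (0 : EuclideanSpace ℝ (Fin (m + 1 + 1))) 1 :=
  ⟨r⁻¹ • q.incl, by
    rw [mem_sphere_zero_iff_norm, norm_smul, q.norm_incl, norm_inv, Real.norm_of_nonneg hr.out.le,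
      inv_mul_cancel₀ hr.out.ne']⟩

/-- Rescaling from the unit sphere. -/
def RSphere.ofUnit [hr : Fact (0 < r)]
    (x : Metric.sphere (0 : EuclideanSpace ℝ (Fin (m + 1 + 1))) 1) : RSphere m r :=
  ⟨r • (x : EuclideanSpace ℝ (Fin (m + 1 + 1))), by
    rw [real_inner_self_eq_norm_sq, norm_smul, norm_eq_of_mem_sphere, Real.norm_of_nonneg hr.out.le,
      mul_one]⟩

theorem RSphere.continuous_toUnit [Fact (0 < r)] : Continuous (RSphere.toUnit (m := m) (r := r)) :=
  (RSphere.continuous_incl.const_smul r⁻¹).subtype_mk _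

theorem RSphere.continuous_ofUnit [Fact (0 < r)] : Continuous (RSphere.ofUnit (m := m) (r := r)) := by
  have h : Continuous fun x : Metric.sphere (0 : EuclideanSpace ℝ (Fin (m + 1 + 1))) 1 =>
    r • (x : EuclideanSpace ℝ (Fin (m + 1 + 1))) := continuous_subtype_val.const_smul r
  exact continuous_induced_rng.2 h

/-- Rescaling is a homeomorphism from `S^{m+1}(r)` to the unit sphere; the charts of `S^{m+1}(r)`
are those of the unit sphere, transported by it. -/
def RSphere.rescale [hr : Fact (0 < r)] :
    RSphere m r ≃ₜ Metric.sphere (0 : EuclideanSpace ℝ (Fin (m + 1 + 1))) 1 where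
  toFun := RSphere.toUnit
  invFun := RSphere.ofUnit
  left_inv _ := Subtype.ext (smul_inv_smul₀ hr.out.ne' _)
  right_inv _ := Subtype.ext (inv_smul_smul₀ hr.out.ne' _)
  continuous_toFun := RSphere.continuous_toUnit
  continuous_invFun := RSphere.continuous_ofUnit

instance RSphere.chartedSpace [Fact (0 < r)] : ChartedSpace (EuclideanSpace ℝ (Fin (m + 1))) (RSphere m r) where
  atlas := (fun e => RSphere.rescale.transOpenPartialHomeomorph e) ''
    atlas (EuclideanSpace ℝ (Fin (m + 1))) (Metric.sphere (0 : EuclideanSpace ℝ (Fin (m + 1 + 1))) 1)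
  chartAt q := RSphere.rescale.transOpenPartialHomeomorph
    (chartAt (EuclideanSpace ℝ (Fin (m + 1))) (RSphere.rescale q))
  mem_chart_source q := by
    simp
  chart_mem_atlas q := mem_image_of_mem _ (chart_mem_atlas _ _)

instance [Fact (0 < r)] : IsManifold (𝓡 (m + 1)) ∞ (RSphere m r) where
  compatible := by
    intro e₁ e₂ h₁ h₂
    obtain ⟨e, he, rfl⟩ := (mem_image _ _ _).1 h₁
    obtain ⟨e', he', rfl⟩ := (mem_image _ _ _).1 h₂
    have h : (RSphere.rescale (m := m) (r := r).transOpenPartialHomeomorph e).symm ≫ₕ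
        (RSphere.rescale (m := m) (r := r).transOpenPartialHomeomorph e') = e.symm ≫ₕ e' := by
      ext x
      · simp
      · simp
      · simp
    rw [h]
    exact (contDiffGroupoid ∞ (𝓡 (m + 1))).compatible he he'

theorem RSphere.chartAt_eq [Fact (0 < r)] (q : RSphere m r) :
    chartAt (EuclideanSpace ℝ (Fin (m + 1))) q = RSphere.rescale.transOpenPartialHomeomorph
      (chartAt (EuclideanSpace ℝ (Fin (m + 1))) (RSphere.rescale q)) := rfl

theorem RSphere.contMDiff_rescale [Fact (0 < r)] :
    ContMDiff (𝓡 (m + 1)) (𝓡 (m + 1)) ∞ (RSphere.rescale (m := m) (r := r)) := by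
  intro q
  rw [contMDiffAt_iff]
  refine ⟨RSphere.rescale.continuous.continuousAt, ?_⟩
  refine contDiffWithinAt_id.congr_of_eventuallyEq_of_mem ?_ (mem_range_self _)
  refine Filter.eventually_of_mem (nhdsWithin_le_nhds (extChartAt_target_mem_nhds (I := 𝓡 (m + 1)) q)) ?_
  intro y hy
  have hy' : y ∈ (chartAt (EuclideanSpace ℝ (Fin (m + 1))) (RSphere.rescale q)).target := by
    simpa [extChartAt, RSphere.chartAt_eq] using hy
  simp [extChartAt, RSphere.chartAt_eq, hy']

theorem RSphere.contMDiff_rescale_symm [Fact (0 < r)] :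
    ContMDiff (𝓡 (m + 1)) (𝓡 (m + 1)) ∞ (RSphere.rescale (m := m) (r := r)).symm := by
  intro q
  rw [contMDiffAt_iff]
  refine ⟨RSphere.rescale.symm.continuous.continuousAt, ?_⟩
  refine contDiffWithinAt_id.congr_of_eventuallyEq_of_mem ?_ (mem_range_self _)
  refine Filter.eventually_of_mem (nhdsWithin_le_nhds (extChartAt_target_mem_nhds (I := 𝓡 (m + 1)) q)) ?_
  intro y hy
  have hy' : y ∈ (chartAt (EuclideanSpace ℝ (Fin (m + 1))) q).target := by
    simpa [extChartAt] using hy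
  simp [extChartAt, RSphere.chartAt_eq, hy']

/-- Rescaling as a diffeomorphism. -/
def RSphere.rescaleDiffeo [Fact (0 < r)] : Diffeomorph (𝓡 (m + 1)) (𝓡 (m + 1)) (RSphere m r)
    (Metric.sphere (0 : EuclideanSpace ℝ (Fin (m + 1 + 1))) 1) ∞ where
  toEquiv := RSphere.rescale.toEquiv
  contMDiff_toFun := RSphere.contMDiff_rescale
  contMDiff_invFun := RSphere.contMDiff_rescale_symm

theorem RSphere.smul_rescale [hr : Fact (0 < r)] (q : RSphere m r) :
    r • (RSphere.rescale q : EuclideanSpace ℝ (Fin (m + 1 + 1))) = q.incl :=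
  smul_inv_smul₀ hr.out.ne' _

theorem RSphere.contMDiff_coe_rescale [Fact (0 < r)] :
    ContMDiff (𝓡 (m + 1)) 𝓘(ℝ, EuclideanSpace ℝ (Fin (m + 1 + 1))) ∞
      (fun q : RSphere m r => (RSphere.rescale q : EuclideanSpace ℝ (Fin (m + 1 + 1)))) := by
  have := Fact.mk (@finrank_euclideanSpace_fin ℝ _ (m + 1 + 1))
  exact (contMDiff_coe_sphere (n := m + 1)).comp RSphere.contMDiff_rescale

theorem RSphere.contMDiff_incl [Fact (0 < r)] :
    ContMDiff (𝓡 (m + 1)) 𝓘(ℝ, EuclideanSpace ℝ (Fin (m + 2))) ∞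
      (RSphere.incl (m := m) (r := r)) := by
  have h := ((r • ContinuousLinearMap.id ℝ
    (EuclideanSpace ℝ (Fin (m + 1 + 1)))).contMDiff (n := ∞)).comp
      (RSphere.contMDiff_coe_rescale (m := m) (r := r))
  exact h.congr fun q => (RSphere.smul_rescale q).symm

theorem RSphere.mfderiv_incl_injective [hr : Fact (0 < r)] (q : RSphere m r) :
    Function.Injective (mfderiv (𝓡 (m + 1)) 𝓘(ℝ, EuclideanSpace ℝ (Fin (m + 2)))
      (RSphere.incl (m := m) (r := r)) q) := by
  have := Fact.mk (@finrank_euclideanSpace_fin ℝ _ (m + 1 + 1))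
  let L := r • ContinuousLinearMap.id ℝ (EuclideanSpace ℝ (Fin (m + 1 + 1)))
  have h1 : RSphere.incl (m := m) (r := r) =
      L ∘ fun q : RSphere m r => (RSphere.rescale q : EuclideanSpace ℝ (Fin (m + 1 + 1))) :=
    funext fun q => (RSphere.smul_rescale q).symm
  have hL : Function.Injective L := fun v w h => by
    simpa [L, hr.out.ne'] using h
  have h2 : HasMFDerivAt (𝓡 (m + 1)) 𝓘(ℝ, EuclideanSpace ℝ (Fin (m + 1 + 1)))
      (RSphere.incl (m := m) (r := r)) q
      (L ∘L ((mfderiv (𝓡 (m + 1)) 𝓘(ℝ, EuclideanSpace ℝ (Fin (m + 1 + 1)))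
        (fun x : Metric.sphere (0 : EuclideanSpace ℝ (Fin (m + 1 + 1))) 1 =>
          (x : EuclideanSpace ℝ (Fin (m + 1 + 1)))) (RSphere.rescale q)) ∘L
        (mfderiv (𝓡 (m + 1)) (𝓡 (m + 1)) (RSphere.rescale (m := m) (r := r)) q))) := by
    rw [h1]
    refine HasMFDerivAt.comp q (L.hasMFDerivAt) ?_
    refine HasMFDerivAt.comp q (g := fun x : Metric.sphere (0 : EuclideanSpace ℝ (Fin (m + 1 + 1))) 1 =>
          (x : EuclideanSpace ℝ (Fin (m + 1 + 1)))) ?_ ?_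
    · exact ((contMDiff_coe_sphere (m := 1)).mdifferentiable one_ne_zero _).hasMFDerivAt
    · exact (RSphere.contMDiff_rescale.mdifferentiable (by simp) _).hasMFDerivAt
  rw [h2.mfderiv]
  have h3 := injective_mvfderiv_subtypeVal_sphere (n := m + 1) (RSphere.rescale q)
  have h4 : Function.Injective (mfderiv (𝓡 (m + 1)) (𝓡 (m + 1)) (RSphere.rescale (m := m) (r := r)) q) :=
    ((RSphere.rescaleDiffeo (m := m) (r := r)).mfderivToContinuousLinearEquiv (by simp) q).injective
  exact hL.comp (h3.comp h4)

/-- The Riemannian metric of `S^{m+1}(r)`, induced by the Euclidean inner product. -/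
instance RSphere.riemannianBundle [Fact (0 < r)] :
    RiemannianBundle (fun q : RSphere m r => TangentSpace (𝓡 (m + 1)) q) :=
  ⟨(inducedMetric (innerSL ℝ) (fun _ _ => real_inner_comm _ _) RSphere.incl
    RSphere.contMDiff_incl (fun q _ hv => real_inner_self_pos.2 fun h =>
      hv (RSphere.mfderiv_incl_injective q (h.trans (map_zero _).symm)))).toRiemannianMetric⟩

theorem RSphere.inner_eq [Fact (0 < r)] (q : RSphere m r) (v w : TangentSpace (𝓡 (m + 1)) q) :
    inner ℝ v w = innerSL ℝ
      (mfderiv (𝓡 (m + 1)) 𝓘(ℝ, EuclideanSpace ℝ (Fin (m + 2))) RSphere.incl q v)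
      (mfderiv (𝓡 (m + 1)) 𝓘(ℝ, EuclideanSpace ℝ (Fin (m + 2))) RSphere.incl q w) := rfl

end Sphere

/-! ### The hyperbolic space of radius `r` (hyperboloid model) -/

section Hyperbolic

/-- The Lorentz form `⟨v, w⟩₁ = -v₀ w₀ + ∑_{i ≥ 1} v_i w_i` of `ℝ^{m+2}`, see
`lorentzForm_apply`. -/
def lorentzForm (m : ℕ) :
    EuclideanSpace ℝ (Fin (m + 2)) →L[ℝ] EuclideanSpace ℝ (Fin (m + 2)) →L[ℝ] ℝ :=
  innerSL ℝ - (2 : ℝ) • (EuclideanSpace.proj (0 : Fin (m + 2))).smulRight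
    (EuclideanSpace.proj (0 : Fin (m + 2)) : EuclideanSpace ℝ (Fin (m + 2)) →L[ℝ] ℝ)

theorem lorentzForm_apply (m : ℕ) (v w : EuclideanSpace ℝ (Fin (m + 2))) :
    lorentzForm m v w = -(v 0 * w 0) + ∑ i : Fin (m + 1), v i.succ * w i.succ := by
  have h : lorentzForm m v w = inner ℝ v w - 2 * (v 0 * w 0) := rfl
  rw [h, PiLp.inner_apply, Fin.sum_univ_succ]
  simp only [RCLike.inner_apply, conj_trivial, mul_comm (w _)]
  ring

theorem lorentzForm_comm (m : ℕ) (v w : EuclideanSpace ℝ (Fin (m + 2))) :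
    lorentzForm m v w = lorentzForm m w v := by
  simp only [lorentzForm_apply, mul_comm]

/-- The hyperbolic space `H^{m+1}(r) = {q ∈ ℝ^{m+2} : ⟨q, q⟩₁ = -r^2, q₀ > 0}`. -/
def Hyperboloid (m : ℕ) (r : ℝ) : Type :=
  {q : EuclideanSpace ℝ (Fin (m + 2)) // lorentzForm m q q = -r ^ 2 ∧ 0 < q 0}

variable {m : ℕ} {r : ℝ}

instance : TopologicalSpace (Hyperboloid m r) :=
  inferInstanceAs (TopologicalSpace
    {q : EuclideanSpace ℝ (Fin (m + 2)) // lorentzForm m q q = -r ^ 2 ∧ 0 < q 0})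

instance : T2Space (Hyperboloid m r) :=
  inferInstanceAs (T2Space
    {q : EuclideanSpace ℝ (Fin (m + 2)) // lorentzForm m q q = -r ^ 2 ∧ 0 < q 0})

namespace Hyperboloid

/-- The inclusion of `H^{m+1}(r)` in `ℝ^{m+2}`. -/
def incl (q : Hyperboloid m r) : EuclideanSpace ℝ (Fin (m + 2)) := q.1

theorem continuous_incl : Continuous (incl (m := m) (r := r)) := continuous_induced_dom

/-- Forgetting the coordinate with index `0`. -/
def spatial (m : ℕ) : EuclideanSpace ℝ (Fin (m + 2)) →L[ℝ] EuclideanSpace ℝ (Fin (m + 1)) :=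
  (EuclideanSpace.equiv (Fin (m + 1)) ℝ).symm.toContinuousLinearMap ∘L
    ContinuousLinearMap.pi fun i : Fin (m + 1) => EuclideanSpace.proj i.succ

@[simp] theorem spatial_apply (v : EuclideanSpace ℝ (Fin (m + 2))) (i : Fin (m + 1)) :
    spatial m v i = v i.succ := rfl

theorem lorentzForm_eq (v w : EuclideanSpace ℝ (Fin (m + 2))) :
    lorentzForm m v w = -(v 0 * w 0) + inner ℝ (spatial m v) (spatial m w) := by
  simp [lorentzForm_apply, PiLp.inner_apply, mul_comm]

/-- The point of the hyperboloid above `y`. -/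
def graphVec (r : ℝ) (y : EuclideanSpace ℝ (Fin (m + 1))) : EuclideanSpace ℝ (Fin (m + 2)) :=
  WithLp.toLp 2 (Fin.cons (Real.sqrt (r ^ 2 + ‖y‖ ^ 2)) fun i => y i)

@[simp] theorem graphVec_zero (y : EuclideanSpace ℝ (Fin (m + 1))) :
    graphVec r y 0 = Real.sqrt (r ^ 2 + ‖y‖ ^ 2) := rfl

@[simp] theorem spatial_graphVec (y : EuclideanSpace ℝ (Fin (m + 1))) :
    spatial m (graphVec r y) = y := by
  ext i
  simp [graphVec]

theorem contDiff_graphVec [hr : Fact (0 < r)] : ContDiff ℝ ∞ (graphVec (m := m) r) := by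
  rw [contDiff_euclidean]
  intro i
  refine Fin.cases ?_ (fun j => ?_) i
  · simp only [graphVec_zero]
    refine ContDiff.sqrt (contDiff_const.add (contDiff_norm_sq ℝ)) fun y => ?_
    have := hr.out
    positivity
  · simp only [graphVec, Fin.cons_succ]
    exact (EuclideanSpace.proj j : EuclideanSpace ℝ (Fin (m + 1)) →L[ℝ] ℝ).contDiff

/-- The inverse of the projection of the hyperboloid to `ℝ^{m+1}`. -/
def ofSpatial [hr : Fact (0 < r)] (y : EuclideanSpace ℝ (Fin (m + 1))) : Hyperboloid m r :=
  ⟨graphVec r y, by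
    have := hr.out
    constructor
    · rw [lorentzForm_eq, spatial_graphVec, graphVec_zero, Real.mul_self_sqrt (by positivity),
        real_inner_self_eq_norm_sq]
      ring
    · rw [graphVec_zero]
      positivity⟩

theorem graphVec_spatial (q : Hyperboloid m r) : graphVec r (spatial m q.incl) = q.incl := by
  have h : lorentzForm m q.incl q.incl = -r ^ 2 := q.2.1
  have h0 : 0 < q.incl 0 := q.2.2
  rw [lorentzForm_eq, real_inner_self_eq_norm_sq] at h
  ext i
  refine Fin.cases ?_ (fun j => ?_) i
  · rw [graphVec_zero]
    have : r ^ 2 + ‖spatial m q.incl‖ ^ 2 = q.incl 0 ^ 2 := by linarith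
    rw [this, Real.sqrt_sq h0.le]
  · simp [graphVec]

/-- The projection of the hyperboloid to `ℝ^{m+1}`, used as its only chart. -/
def homeo [hr : Fact (0 < r)] : Hyperboloid m r ≃ₜ EuclideanSpace ℝ (Fin (m + 1)) where
  toFun q := spatial m q.incl
  invFun := ofSpatial
  left_inv q := Subtype.ext (graphVec_spatial q)
  right_inv y := spatial_graphVec y
  continuous_toFun := (spatial m).continuous.comp continuous_incl
  continuous_invFun := continuous_induced_rng.2 (contDiff_graphVec (m := m) (r := r)).continuous

instance chartedSpace [Fact (0 < r)] :
    ChartedSpace (EuclideanSpace ℝ (Fin (m + 1))) (Hyperboloid m r) :=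
  homeo.toOpenPartialHomeomorph.singletonChartedSpace rfl

instance [Fact (0 < r)] : IsManifold (𝓡 (m + 1)) ∞ (Hyperboloid m r) :=
  { homeo.toOpenPartialHomeomorph.singleton_hasGroupoid rfl (contDiffGroupoid ∞ (𝓡 (m + 1))) with }

theorem contMDiff_incl [Fact (0 < r)] :
    ContMDiff (𝓡 (m + 1)) 𝓘(ℝ, EuclideanSpace ℝ (Fin (m + 2))) ∞ (incl (m := m) (r := r)) := by
  rw [contMDiff_iff]
  exact ⟨continuous_incl, fun _ _ => (contDiff_graphVec (m := m) (r := r)).contDiffOn⟩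

theorem mfderiv_incl [Fact (0 < r)] (q : Hyperboloid m r) :
    mfderiv (𝓡 (m + 1)) 𝓘(ℝ, EuclideanSpace ℝ (Fin (m + 2))) (incl (m := m) (r := r)) q
      = fderiv ℝ (graphVec (m := m) r) (spatial m q.incl) := by
  rw [(contMDiff_incl.mdifferentiable (by simp) q).mfderiv]
  simp only [mfld_simps, fderivWithin_univ]
  rfl

theorem mfderiv_incl_pos [hr : Fact (0 < r)] (q : Hyperboloid m r)
    (v : TangentSpace (𝓡 (m + 1)) q) (hv : v ≠ 0) :
    0 < inducedForm (lorentzForm m) (incl (m := m) (r := r)) q v v := by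
  rw [inducedForm_apply, mfderiv_incl]
  have key : ∀ y u : EuclideanSpace ℝ (Fin (m + 1)), u ≠ 0 →
      0 < lorentzForm m (fderiv ℝ (graphVec (m := m) r) y u)
        (fderiv ℝ (graphVec (m := m) r) y u) := by
    intro y u hu
    have hd : HasFDerivAt (graphVec (m := m) r) (fderiv ℝ (graphVec (m := m) r) y) y :=
      ((contDiff_graphVec (m := m) (r := r)).differentiable (by simp) y).hasFDerivAt
    set D := fderiv ℝ (graphVec (m := m) r) y
    have h1 : spatial m (D u) = u := by
      have h := (spatial m).hasFDerivAt.comp y hd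
      have h' : (spatial m) ∘ graphVec (m := m) r = id := funext fun z => spatial_graphVec z
      rw [h'] at h
      have := h.unique (hasFDerivAt_id y)
      exact congrArg (fun L => L u) this
    have h2 : graphVec r y 0 * D u 0 = inner ℝ y u := by
      have hp := (EuclideanSpace.proj (0 : Fin (m + 2)) :
        EuclideanSpace ℝ (Fin (m + 2)) →L[ℝ] ℝ).hasFDerivAt.comp y hd
      have h3 := hp.mul hp
      have h4 : HasFDerivAt (fun z : EuclideanSpace ℝ (Fin (m + 1)) => r ^ 2 + ‖z‖ ^ 2)
          ((2 : ℕ) • innerSL ℝ y) y := by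
        simpa using (hasStrictFDerivAt_norm_sq y).hasFDerivAt.const_add (r ^ 2)
      have h5 : ((EuclideanSpace.proj (0 : Fin (m + 2)) :
          EuclideanSpace ℝ (Fin (m + 2)) →L[ℝ] ℝ) ∘ graphVec (m := m) r) *
          ((EuclideanSpace.proj (0 : Fin (m + 2)) :
          EuclideanSpace ℝ (Fin (m + 2)) →L[ℝ] ℝ) ∘ graphVec (m := m) r) =
          fun z => r ^ 2 + ‖z‖ ^ 2 := by
        funext z
        have := hr.out
        simpa using Real.mul_self_sqrt (by positivity : (0 : ℝ) ≤ r ^ 2 + ‖z‖ ^ 2)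
      rw [h5] at h3
      have h6 := congrArg (fun L => L u) (h3.unique h4)
      simp at h6
      rw [graphVec_zero]
      linarith
    have h0 : graphVec r y 0 ^ 2 = r ^ 2 + ‖y‖ ^ 2 := by
      have := hr.out
      rw [graphVec_zero, Real.sq_sqrt (by positivity)]
    have hcs := abs_real_inner_le_norm y u
    rw [lorentzForm_eq, h1, real_inner_self_eq_norm_sq]
    have hu' : 0 < ‖u‖ := norm_pos_iff.2 hu
    have hsq : (graphVec r y 0 * D u 0) ^ 2 ≤ (‖y‖ * ‖u‖) ^ 2 := by
      rw [h2]
      exact sq_le_sq' (neg_le_of_abs_le hcs) (le_of_abs_le hcs)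
    rw [mul_pow, h0, mul_pow] at hsq
    have hrr : 0 < r ^ 2 := pow_pos hr.out 2
    by_contra! hcon
    have hle : ‖u‖ ^ 2 ≤ D u 0 ^ 2 := by nlinarith
    have hmul := mul_le_mul_of_nonneg_left hle (by positivity : 0 ≤ r ^ 2 + ‖y‖ ^ 2)
    have := mul_pos hrr (pow_pos hu' 2)
    nlinarith
  exact key _ v hv

/-- The Riemannian metric of `H^{m+1}(r)`, induced by the Lorentz form. -/
instance riemannianBundle [Fact (0 < r)] :
    RiemannianBundle (fun q : Hyperboloid m r => TangentSpace (𝓡 (m + 1)) q) :=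
  ⟨(inducedMetric (lorentzForm m) (lorentzForm_comm m) incl
    contMDiff_incl mfderiv_incl_pos).toRiemannianMetric⟩

theorem inner_eq [Fact (0 < r)] (q : Hyperboloid m r) (v w : TangentSpace (𝓡 (m + 1)) q) :
    inner ℝ v w = lorentzForm m
      (mfderiv (𝓡 (m + 1)) 𝓘(ℝ, EuclideanSpace ℝ (Fin (m + 2))) incl q v)
      (mfderiv (𝓡 (m + 1)) 𝓘(ℝ, EuclideanSpace ℝ (Fin (m + 2))) incl q w) := rfl

end Hyperboloid
end Hyperbolic

end NormalCurves

end

/-! The heart of the matter is the Gauss lemma. In a normal ball `exp_p` is an injective local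
diffeomorphism, so a curve `α` in the ball is `exp_p ∘ γ` with `γ = logMap ∘ α` of the same class,
and `α` is regular exactly when `γ` is. The only geodesic in the ball from `p` to `α s` is the
radial one `τ ↦ exp_p (τ γ(s))` (`IsNormalBall.eqOn_ray`), whose final velocity is the differential
of `exp_p` at `γ(s)` applied to `γ(s)`. The Gauss lemma (`pullbackMetric_radial`) therefore turns
the orthogonality condition into `⟨γ', γ⟩ = 0` (`IsNormalBall.orthogonal_iff`). This is half the
derivative of `‖γ‖²`, so it vanishes on an interval if and only if `‖γ‖` is constant. The constant
is positive because `γ = 0` would not be regular.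

The geodesic equation is handled through `covAccel`, the covariant acceleration for a field of
bilinear forms on a vector space. Its naturality under pull-back (`covAccel_pullbackForm`) gives
independence of charts, allows computations in `T_p M` through `exp_p`, and yields the geodesics of
submanifolds of a space with a constant form. Uniqueness of geodesics is Grönwall uniqueness for the
spray in a chart, spread over `[0, 1]` by a connectedness argument.

A normal ball exists because `exp_p` is smooth near the origin with identity differential there.
Smooth dependence on the initial velocity comes from the inverse function theorem in a Banach space:
the unknown is the acceleration, a continuous function on a fixed time interval, and the equation
`y'' = F (y, y')` becomes a fixed point equation for it. The spray is quadratic in the velocity, so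
the nonlinear part has zero derivative at the rest solution; hence solutions with small initial
velocity live on the whole interval and depend smoothly on it.

Spheres and hyperboloids are treated together as quadrics `B x x = κ⁻¹`. The curve `c(t‖v‖) p +
(s(t‖v‖)/‖v‖) v`, with `c` and `s` the cosine and sine of curvature `κ`, has acceleration
proportional to its position, hence normal to the quadric, and is a geodesic. This makes `exp_p`
explicit: the product with `p` determines `c(‖v‖)`, and the tangential part determines the direction
of `v`. Injectivity of `c` and nonvanishing of `s` on the relevant range give the normal ball. -/

open scoped Manifold ContDiff Topology
open Bundle Set

noncomputable section

namespace NormalCurves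

set_option synthInstance.maxHeartbeats 200000
set_option maxSynthPendingDepth 3

/-! ### The geodesic equation in a vector space with a variable bilinear form -/

section Calculus

variable {E F : Type*} [NormedAddCommGroup E] [NormedSpace ℝ E]
  [NormedAddCommGroup F] [NormedSpace ℝ F]

/-- The covariant acceleration of a curve with position `y`, velocity `u` and acceleration `a` with
respect to the metric `g`, tested against `w`. -/
def covAccel (g : E → E →L[ℝ] E →L[ℝ] ℝ) (y u a w : E) : ℝ :=
  g y a w + (fderiv ℝ (fun z => g z u w) y u - (1 / 2) * fderiv ℝ (fun z => g z u u) y w)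

/-- The pull-back of a field of bilinear forms. -/
def pullbackForm (φ : E → F) (G : F → F →L[ℝ] F →L[ℝ] ℝ) (y : E) : E →L[ℝ] E →L[ℝ] ℝ :=
  (G (φ y)).bilinearComp (fderiv ℝ φ y) (fderiv ℝ φ y)

@[simp] theorem pullbackForm_apply (φ : E → F) (G : F → F →L[ℝ] F →L[ℝ] ℝ) (y u v : E) :
    pullbackForm φ G y u v = G (φ y) (fderiv ℝ φ y u) (fderiv ℝ φ y v) := rfl

theorem covAccel_congr {g g' : E → E →L[ℝ] E →L[ℝ] ℝ} {y : E} (h : g =ᶠ[𝓝 y] g') (u a w : E) :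
    covAccel g y u a w = covAccel g' y u a w := by
  have h1 : ∀ u v, (fun z => g z u v) =ᶠ[𝓝 y] fun z => g' z u v := fun u v => by
    filter_upwards [h] with z hz
    rw [hz]
  unfold covAccel
  rw [h.eq_of_nhds, (h1 u w).fderiv_eq, (h1 u u).fderiv_eq]

theorem fderiv_fderiv_differentiableAt {φ : E → F} {y : E} (hφ : ContDiffAt ℝ 2 φ y) :
    DifferentiableAt ℝ (fderiv ℝ φ) y :=
  (hφ.fderiv_right (m := 1) (by norm_num)).differentiableAt one_ne_zero

theorem differentiableAt_pullbackForm {φ : E → F} {G : F → F →L[ℝ] F →L[ℝ] ℝ} {y : E}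
    (hφ : ContDiffAt ℝ 2 φ y) (hG : DifferentiableAt ℝ G (φ y)) :
    DifferentiableAt ℝ (pullbackForm φ G) y := by
  have h1 := DifferentiableAt.comp (g := G) y hG (hφ.differentiableAt two_ne_zero)
  have h2 := fderiv_fderiv_differentiableAt hφ
  -- Precomposition with `D` is `compL.flip D`, which is linear in `D`; the pull-back is the
  -- composite of this operator, `G (φ z)` and `D`.
  have h3 : DifferentiableAt ℝ
      (fun z => (ContinuousLinearMap.compL ℝ E F ℝ).flip (fderiv ℝ φ z)) y :=
    DifferentiableAt.comp (g := fun L => (ContinuousLinearMap.compL ℝ E F ℝ).flip L)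
      (f := fderiv ℝ φ) y (ContinuousLinearMap.differentiableAt _) h2
  exact h3.clm_comp (h1.clm_comp h2)

theorem fderiv_pullbackForm {φ : E → F} {G : F → F →L[ℝ] F →L[ℝ] ℝ} {y : E}
    (hφ : ContDiffAt ℝ 2 φ y) (hG : DifferentiableAt ℝ G (φ y)) (u v h : E) :
    fderiv ℝ (fun z => pullbackForm φ G z u v) y h =
      fderiv ℝ (fun z => G z (fderiv ℝ φ y u) (fderiv ℝ φ y v)) (φ y) (fderiv ℝ φ y h)
      + G (φ y) (fderiv ℝ (fderiv ℝ φ) y h u) (fderiv ℝ φ y v)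
      + G (φ y) (fderiv ℝ φ y u) (fderiv ℝ (fderiv ℝ φ) y h v) := by
  have h1 : HasFDerivAt φ (fderiv ℝ φ y) y := (hφ.differentiableAt two_ne_zero).hasFDerivAt
  have h2 : HasFDerivAt (fderiv ℝ φ) (fderiv ℝ (fderiv ℝ φ) y) y :=
    (fderiv_fderiv_differentiableAt hφ).hasFDerivAt
  have h3 : HasFDerivAt (fun z => G (φ z)) ((fderiv ℝ G (φ y)).comp (fderiv ℝ φ y)) y :=
    HasFDerivAt.comp (g := G) (f := φ) y hG.hasFDerivAt h1
  have hu := h2.clm_apply (hasFDerivAt_const u y)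
  have hv := h2.clm_apply (hasFDerivAt_const v y)
  have h4 := (h3.clm_apply hu).clm_apply hv
  have h5 := ((hG.hasFDerivAt.clm_apply (hasFDerivAt_const (fderiv ℝ φ y u) (φ y))).clm_apply
    (hasFDerivAt_const (fderiv ℝ φ y v) (φ y))).fderiv
  simp only [pullbackForm_apply]
  rw [h4.fderiv, h5]
  simp
  ring

theorem hasDerivAt_comp_curve {φ : E → F} {x : ℝ → E} {t : ℝ}
    (hφ : DifferentiableAt ℝ φ (x t)) (hx : DifferentiableAt ℝ x t) :
    HasDerivAt (fun τ => φ (x τ)) (fderiv ℝ φ (x t) (deriv x t)) t :=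
  hφ.hasFDerivAt.comp_hasDerivAt t hx.hasDerivAt

theorem ContDiffAt.deriv_curve {x : ℝ → E} {t : ℝ} {m : ℕ} (hx : ContDiffAt ℝ (m + 1 : ℕ) x t) :
    ContDiffAt ℝ m (deriv x) t := by
  have := (hx.fderiv_right (m := m) (by norm_cast)).clm_apply (contDiffAt_const (c := (1 : ℝ)))
  exact this

theorem deriv_deriv_comp {φ : E → F} {x : ℝ → E} {t : ℝ}
    (hφ : ContDiffAt ℝ 2 φ (x t)) (hx : ContDiffAt ℝ 2 x t) :
    deriv (deriv fun τ => φ (x τ)) t =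
      fderiv ℝ (fderiv ℝ φ) (x t) (deriv x t) (deriv x t)
        + fderiv ℝ φ (x t) (deriv (deriv x) t) := by
  have e : (deriv fun τ => φ (x τ)) =ᶠ[𝓝 t] fun τ => fderiv ℝ φ (x τ) (deriv x τ) := by
    have a1 := hx.continuousAt.eventually (hφ.eventually (by simp))
    filter_upwards [a1, hx.eventually (by simp)] with τ h1 h2
    exact (hasDerivAt_comp_curve (h1.differentiableAt two_ne_zero)
      (h2.differentiableAt two_ne_zero)).deriv
  rw [e.deriv_eq]
  have h1 := hasDerivAt_comp_curve (fderiv_fderiv_differentiableAt hφ)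
    (hx.differentiableAt two_ne_zero)
  have h2 : HasDerivAt (deriv x) (deriv (deriv x) t) t :=
    ((ContDiffAt.deriv_curve (m := 1) hx).differentiableAt one_ne_zero).hasDerivAt
  exact (h1.clm_apply h2).deriv

/-- The covariant acceleration is natural with respect to pull-back. -/
theorem covAccel_pullbackForm {φ : E → F} {G : F → F →L[ℝ] F →L[ℝ] ℝ} {x : ℝ → E} {t : ℝ}
    (hφ : ContDiffAt ℝ 2 φ (x t)) (hx : ContDiffAt ℝ 2 x t)
    (hG : DifferentiableAt ℝ G (φ (x t))) (hsymm : ∀ u v, G (φ (x t)) u v = G (φ (x t)) v u)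
    (w : E) :
    covAccel (pullbackForm φ G) (x t) (deriv x t) (deriv (deriv x) t) w =
      covAccel G (φ (x t)) (deriv (fun τ => φ (x τ)) t) (deriv (deriv fun τ => φ (x τ)) t)
        (fderiv ℝ φ (x t) w) := by
  -- Symmetry of the second derivative of `φ`, together with that of `G`, cancels the terms with
  -- `D²φ(u, w)`; the remaining one, `D²φ(u, u)`, is what the chain rule adds to the acceleration.
  have hs : IsSymmSndFDerivAt ℝ φ (x t) := hφ.isSymmSndFDerivAt (by simp)
  unfold covAccel
  rw [fderiv_pullbackForm hφ hG, fderiv_pullbackForm hφ hG, deriv_deriv_comp hφ hx,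
    (hasDerivAt_comp_curve (hφ.differentiableAt two_ne_zero)
      (hx.differentiableAt two_ne_zero)).deriv, pullbackForm_apply,
    hs.eq w (deriv x t), hsymm (fderiv ℝ φ (x t) (deriv x t))
      (fderiv ℝ (fderiv ℝ φ) (x t) (deriv x t) w)]
  simp only [map_add, add_apply]
  ring

theorem covAccel_const (B : E →L[ℝ] E →L[ℝ] ℝ) (y u a w : E) :
    covAccel (fun _ => B) y u a w = B a w := by
  simp [covAccel]

/-- Differentiable curves which agree on `[0, 1]` near `t` have the same derivative there. -/
theorem deriv_eventuallyEq_of_eventuallyEq_Icc {f g : ℝ → E} {t : ℝ}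
    (hf : ∀ᶠ τ in 𝓝 t, DifferentiableAt ℝ f τ) (hg : ∀ᶠ τ in 𝓝 t, DifferentiableAt ℝ g τ)
    (h : f =ᶠ[𝓝[Icc 0 1] t] g) : deriv f =ᶠ[𝓝[Icc 0 1] t] deriv g := by
  have h' := eventually_eventually_nhdsWithin.2 h
  filter_upwards [h', nhdsWithin_le_nhds hf, nhdsWithin_le_nhds hg, self_mem_nhdsWithin]
    with τ h1 h2 h3 h4
  -- Both two-sided derivatives are also derivatives within `[0, 1]`, which are unique even at the
  -- end points, where the curves need only agree on one side.
  have hu : UniqueDiffWithinAt ℝ (Icc (0 : ℝ) 1) τ := uniqueDiffOn_Icc one_pos τ h4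
  rw [← h2.derivWithin hu, ← h3.derivWithin hu]
  exact Filter.EventuallyEq.derivWithin_eq h1 (h1.self_of_nhdsWithin h4)

end Calculus

/-! ### Charts -/

section Charts

variable {n : ℕ} {M : Type*} [TopologicalSpace M] [ChartedSpace (EuclideanSpace ℝ (Fin n)) M]
  {V : Type*} [NormedAddCommGroup V]

theorem chart_symm_eventuallyEq {f : V → M} {y : V} {x₀ : M} (hf : ContinuousAt f y)
    (hy : f y ∈ (chartAt (EuclideanSpace ℝ (Fin n)) x₀).source) :
    (extChartAt (𝓡 n) x₀).symm ∘ (extChartAt (𝓡 n) x₀ ∘ f) =ᶠ[𝓝 y] f := by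
  filter_upwards [hf.preimage_mem_nhds ((chartAt _ x₀).open_source.mem_nhds hy)] with z hz
  exact (extChartAt (𝓡 n) x₀).left_inv (by rwa [extChartAt_source])

theorem velocity_eq_of_eqOn_Icc {f g : ℝ → M} {t : ℝ} (ht : t ∈ Icc (0 : ℝ) 1)
    (hf : MDifferentiableAt 𝓘(ℝ, ℝ) (𝓡 n) f t) (hg : MDifferentiableAt 𝓘(ℝ, ℝ) (𝓡 n) g t)
    (h : EqOn f g (Icc 0 1)) : velocity n f t = velocity n g t := by
  have hu : UniqueMDiffWithinAt 𝓘(ℝ, ℝ) (Icc (0 : ℝ) 1) t :=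
    (uniqueDiffOn_Icc one_pos).uniqueMDiffOn t ht
  have e := h ht
  unfold velocity
  rw [← mfderivWithin_eq_mfderiv hu hf, ← mfderivWithin_eq_mfderiv hu hg, mfderivWithin_congr h e]
  -- All tangent spaces unfold to the model space, so the foot point can be rewritten in a constant
  -- family of fibres.
  exact congrArg (fun q => (⟨q, mfderivWithin 𝓘(ℝ, ℝ) (𝓡 n) g (Icc 0 1) t (1 : ℝ)⟩ :
    TotalSpace (EuclideanSpace ℝ (Fin n)) (fun _ : M => EuclideanSpace ℝ (Fin n)))) e

variable [NormedSpace ℝ V] [IsManifold (𝓡 n) ∞ M]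

theorem mdifferentiableAt_extChartAt_symm {x₀ : M} {y : EuclideanSpace ℝ (Fin n)}
    (hy : y ∈ (extChartAt (𝓡 n) x₀).target) :
    MDifferentiableAt 𝓘(ℝ, EuclideanSpace ℝ (Fin n)) (𝓡 n) (extChartAt (𝓡 n) x₀).symm y :=
  (((contMDiffOn_extChartAt_symm (n := ∞) x₀).contMDiffAt
    ((isOpen_extChartAt_target x₀).mem_nhds hy))).mdifferentiableAt (by simp)

theorem contDiffAt_extChartAt_comp {f : V → M} {y : V} {x₀ : M} {k : WithTop ℕ∞} (hk : k ≤ ∞)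
    (hf : ContMDiffAt 𝓘(ℝ, V) (𝓡 n) k f y)
    (hy : f y ∈ (chartAt (EuclideanSpace ℝ (Fin n)) x₀).source) :
    ContDiffAt ℝ k (extChartAt (𝓡 n) x₀ ∘ f) y :=
  (((contMDiffAt_extChartAt' (n := ∞) hy).of_le hk).comp y hf).contDiffAt

theorem mfderiv_extChartAt_symm_injective {x₀ : M} {y : EuclideanSpace ℝ (Fin n)}
    (hy : y ∈ (extChartAt (𝓡 n) x₀).target) :
    Function.Injective (mfderiv 𝓘(ℝ, EuclideanSpace ℝ (Fin n)) (𝓡 n)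
      (extChartAt (𝓡 n) x₀).symm y) := by
  have h := (isInvertible_mfderivWithin_extChartAt_symm (I := 𝓡 n) hy).injective
  simpa [mfderivWithin_univ] using h

theorem fderiv_chart_comp_surjective {V : Type*} [NormedAddCommGroup V] [NormedSpace ℝ V]
    {f : V → M} {y : V} {x₀ : M} (hf : MDifferentiableAt 𝓘(ℝ, V) (𝓡 n) f y)
    (hs : Function.Surjective (mfderiv 𝓘(ℝ, V) (𝓡 n) f y))
    (h : f y ∈ (chartAt (EuclideanSpace ℝ (Fin n)) x₀).source) :
    Function.Surjective (fderiv ℝ (extChartAt (𝓡 n) x₀ ∘ f) y) := by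
  rw [← mfderiv_eq_fderiv, mfderiv_comp y (mdifferentiableAt_extChartAt h) hf]
  exact (isInvertible_mfderiv_extChartAt
    (by rwa [extChartAt_source])).surjective.comp hs

end Charts

/-! ### Pull-backs of a Riemannian metric to vector spaces -/

section Metric

variable {n : ℕ} {M : Type*} [TopologicalSpace M] [ChartedSpace (EuclideanSpace ℝ (Fin n)) M]
  [RiemannianBundle (fun x : M => TangentSpace (𝓡 n) x)]
  {V : Type*} [NormedAddCommGroup V] [NormedSpace ℝ V]

variable (n) in
/-- The Riemannian inner product of a tangent space as a continuous bilinear form. -/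
def tangentForm (q : M) : TangentSpace (𝓡 n) q →L[ℝ] TangentSpace (𝓡 n) q →L[ℝ] ℝ :=
  innerSL ℝ

/-- The pull-back of the Riemannian metric of `M` under a map from a vector space. -/
def pullbackMetric (n : ℕ) {M : Type*} [TopologicalSpace M]
    [ChartedSpace (EuclideanSpace ℝ (Fin n)) M] [RiemannianBundle (fun x : M => TangentSpace (𝓡 n) x)]
    {V : Type*} [NormedAddCommGroup V] [NormedSpace ℝ V] (f : V → M) (y : V) :
    V →L[ℝ] V →L[ℝ] ℝ :=
  let D : V →L[ℝ] TangentSpace (𝓡 n) (f y) := mfderiv 𝓘(ℝ, V) (𝓡 n) f y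
  (tangentForm n (f y)).bilinearComp D D

theorem pullbackMetric_apply (f : V → M) (y u v : V) :
    pullbackMetric n f y u v =
      inner ℝ (mfderiv 𝓘(ℝ, V) (𝓡 n) f y u) (mfderiv 𝓘(ℝ, V) (𝓡 n) f y v) := rfl

theorem pullbackMetric_comm (f : V → M) (y u v : V) :
    pullbackMetric n f y u v = pullbackMetric n f y v u := by
  rw [pullbackMetric_apply, pullbackMetric_apply, real_inner_comm]

/-- The metric in the coordinates of the chart at `x₀`, as a field of bilinear forms. -/
abbrev chartMetric (x₀ : M) :
    EuclideanSpace ℝ (Fin n) → EuclideanSpace ℝ (Fin n) →L[ℝ] EuclideanSpace ℝ (Fin n) →L[ℝ] ℝ :=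
  pullbackMetric n (extChartAt (𝓡 n) x₀).symm

theorem metricInChart_eq (x₀ : M) (y u v : EuclideanSpace ℝ (Fin n)) :
    metricInChart x₀ y u v = chartMetric x₀ y u v := rfl

theorem metricInChart_add_christoffelInChart (x₀ : M) (y u a w : EuclideanSpace ℝ (Fin n)) :
    metricInChart x₀ y a w + christoffelInChart x₀ y u u w = covAccel (chartMetric x₀) y u a w := by
  unfold covAccel christoffelInChart
  simp only [metricInChart_eq]
  ring

theorem pullbackMetric_comp {W : Type*} [NormedAddCommGroup W] [NormedSpace ℝ W]
    {f : V → M} {φ : W → V} {y : W}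
    (hf : MDifferentiableAt 𝓘(ℝ, V) (𝓡 n) f (φ y)) (hφ : DifferentiableAt ℝ φ y) :
    pullbackMetric n (f ∘ φ) y = pullbackForm φ (pullbackMetric n f) y := by
  ext u v
  rw [pullbackForm_apply, pullbackMetric_apply, pullbackMetric_apply,
    mfderiv_comp y hf hφ.mdifferentiableAt, mfderiv_eq_fderiv]
  rfl

theorem pullbackMetric_congr {f g : V → M} {y : V} (h : f =ᶠ[𝓝 y] g) :
    pullbackMetric n f y = pullbackMetric n g y := by
  have h1 : pullbackMetric n f y = pullbackMetric n g y ↔ ∀ u v, pullbackMetric n f y u v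
    = pullbackMetric n g y u v := ⟨fun h _ _ => by rw [h], fun h => by ext u v; exact h u v⟩
  rw [h1]
  intro u v
  rw [pullbackMetric_apply, pullbackMetric_apply]
  have h2 := h.mfderiv_eq (I := 𝓘(ℝ, V)) (I' := 𝓡 n)
  have h3 := h.eq_of_nhds
  -- The inner product depends on the foot point while the vectors are elements of the model space;
  -- for independent points the equation `q = q'` can be substituted.
  have key : ∀ (q q' : M) (hq : q = q') (L : V →L[ℝ] EuclideanSpace ℝ (Fin n)),
     tangentForm n q (L u) (L v) = tangentForm n q' (L u) (L v) := by
    rintro q _ rfl L; rfl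
  rw [h2]
  exact key _ _ h3 _

theorem pullbackMetric_pos {f : V → M} {y : V}
    (hf : Function.Injective (mfderiv 𝓘(ℝ, V) (𝓡 n) f y)) {u : V} (hu : u ≠ 0) :
    0 < pullbackMetric n f y u u := by
  rw [pullbackMetric_apply, real_inner_self_pos]
  exact fun h => hu (hf (h.trans (map_zero _).symm))

variable [IsManifold (𝓡 n) ∞ M]

/-- Near `y` the map `f` factors as the inverse chart after `extChartAt x₀ ∘ f`, so the chain rule
for pull-backs applies. -/
theorem pullbackMetric_eq_pullbackForm {f : V → M} {y : V} {x₀ : M}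
    (hf : MDifferentiableAt 𝓘(ℝ, V) (𝓡 n) f y)
    (hy : f y ∈ (chartAt (EuclideanSpace ℝ (Fin n)) x₀).source) :
    pullbackMetric n f y = pullbackForm (extChartAt (𝓡 n) x₀ ∘ f) (chartMetric x₀) y := by
  rw [← pullbackMetric_congr (chart_symm_eventuallyEq hf.continuousAt hy)]
  apply pullbackMetric_comp
  · exact mdifferentiableAt_extChartAt_symm
      ((extChartAt (𝓡 n) x₀).map_source (by rwa [extChartAt_source]))
  · exact ((mdifferentiableAt_extChartAt hy).comp y hf).differentiableAt

theorem pullbackMetric_eventuallyEq {f : V → M} {y : V} {x₀ : M}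
    (hf : ∀ᶠ z in 𝓝 y, MDifferentiableAt 𝓘(ℝ, V) (𝓡 n) f z)
    (hy : f y ∈ (chartAt (EuclideanSpace ℝ (Fin n)) x₀).source) :
    pullbackMetric n f =ᶠ[𝓝 y] pullbackForm (extChartAt (𝓡 n) x₀ ∘ f) (chartMetric x₀) := by
  filter_upwards [hf, hf.self_of_nhds.continuousAt.preimage_mem_nhds
    ((chartAt _ x₀).open_source.mem_nhds hy)] with z h1 h2
  exact pullbackMetric_eq_pullbackForm h1 h2

variable [IsContMDiffRiemannianBundle (𝓡 n) ∞ (EuclideanSpace ℝ (Fin n))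
        (fun x : M => TangentSpace (𝓡 n) x)]

/-- The coordinate fields are smooth sections of the tangent bundle, being images of constant fields
under the tangent map of the inverse chart, and the bundle metric is smooth on smooth sections. In
finite dimension a field of bilinear forms is smooth once its values on fixed vectors are. -/
theorem contDiffOn_chartMetric (x₀ : M) :
    ContDiffOn ℝ ∞ (chartMetric x₀) (extChartAt (𝓡 n) x₀).target := by
  have ho := isOpen_extChartAt_target (I := 𝓡 n) x₀
  have hsec : ∀ u : EuclideanSpace ℝ (Fin n),
      ContMDiffOn 𝓘(ℝ, EuclideanSpace ℝ (Fin n)) (𝓡 n).tangent ∞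
      (fun y => (⟨(extChartAt (𝓡 n) x₀).symm y,
        mfderiv 𝓘(ℝ, EuclideanSpace ℝ (Fin n)) (𝓡 n) (extChartAt (𝓡 n) x₀).symm y u⟩ :
          TangentBundle (𝓡 n) M)) (extChartAt (𝓡 n) x₀).target := by
    intro u
    have h1 := (contMDiffOn_extChartAt_symm (I := 𝓡 n) (n := ∞) x₀).contMDiffOn_tangentMapWithin
      (m := ∞) (by simp) ho.uniqueMDiffOn
    have h2 : ContMDiff 𝓘(ℝ, EuclideanSpace ℝ (Fin n))
        (𝓘(ℝ, EuclideanSpace ℝ (Fin n))).tangent ∞ (fun y => (⟨y, u⟩ :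
          TangentBundle 𝓘(ℝ, EuclideanSpace ℝ (Fin n)) (EuclideanSpace ℝ (Fin n)))) := by
      intro y
      rw [Bundle.contMDiffAt_totalSpace]
      refine ⟨contMDiffAt_id, ?_⟩
      simpa using contMDiffAt_const
    refine (h1.comp h2.contMDiffOn (fun y hy => hy)).congr fun y hy => ?_
    simp only [Function.comp_apply, tangentMapWithin]
    rw [mfderivWithin_of_mem_nhds (ho.mem_nhds hy)]
  refine contDiffOn_clm_apply.2 fun u => contDiffOn_clm_apply.2 fun v => ?_
  exact (ContMDiffOn.inner_bundle (hsec u) (hsec v)).contDiffOn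

theorem differentiableAt_pullbackMetric {f : V → M} {y : V}
    (hf : ∀ᶠ z in 𝓝 y, ContMDiffAt 𝓘(ℝ, V) (𝓡 n) ∞ f z) :
    DifferentiableAt ℝ (pullbackMetric n f) y := by
  have hy := mem_chart_source (EuclideanSpace ℝ (Fin n)) (f y)
  have e := pullbackMetric_eventuallyEq (x₀ := f y)
    (hf.mono fun z hz => hz.mdifferentiableAt (by simp)) hy
  refine DifferentiableAt.congr_of_eventuallyEq ?_ e
  have h1 := contDiffAt_extChartAt_comp (x₀ := f y) le_rfl hf.self_of_nhds hy
  have h2 : DifferentiableAt ℝ (chartMetric (n := n) (f y)) ((extChartAt (𝓡 n) (f y) ∘ f) y) :=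
    ((contDiffOn_chartMetric (f y)).contDiffAt ((isOpen_extChartAt_target _).mem_nhds
      (mem_extChartAt_target _))).differentiableAt (by simp)
  exact differentiableAt_pullbackForm (h1.of_le ENat.LEInfty.out) h2

end Metric

/-! ### The geodesic equation -/

section Geodesic

variable {n : ℕ} {M : Type*} [TopologicalSpace M] [ChartedSpace (EuclideanSpace ℝ (Fin n)) M]
  [RiemannianBundle (fun x : M => TangentSpace (𝓡 n) x)]

theorem isGeodesicAt_iff {β : ℝ → M} {t : ℝ} :
    IsGeodesicAt (n := n) β t ↔ ContMDiffAt 𝓘(ℝ, ℝ) (𝓡 n) 2 β t ∧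
      ∀ x₀ : M, β t ∈ (chartAt (EuclideanSpace ℝ (Fin n)) x₀).source →
        ∀ w : EuclideanSpace ℝ (Fin n),
          covAccel (chartMetric x₀) (extChartAt (𝓡 n) x₀ (β t))
            (deriv (extChartAt (𝓡 n) x₀ ∘ β) t) (deriv (deriv (extChartAt (𝓡 n) x₀ ∘ β)) t) w = 0 := by
  unfold IsGeodesicAt
  simp only [metricInChart_add_christoffelInChart]
  rfl

variable [IsManifold (𝓡 n) ∞ M]

/-- The geodesic equation at a point of `[0, 1]` only depends on the restriction of the curve to
`[0, 1]`, among curves of class `C^2`. -/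
theorem IsGeodesicAt.congr_Icc {β γ : ℝ → M} {t : ℝ} (h : IsGeodesicAt (n := n) β t)
    (ht : t ∈ Icc (0 : ℝ) 1) (hγ : ContMDiffAt 𝓘(ℝ, ℝ) (𝓡 n) 2 γ t)
    (e : EqOn β γ (Icc 0 1)) : IsGeodesicAt (n := n) γ t := by
  rw [isGeodesicAt_iff] at h ⊢
  obtain ⟨hβ, h⟩ := h
  have et := e ht
  refine ⟨hγ, fun x₀ hx₀ w => ?_⟩
  have hx₀' : β t ∈ (chartAt (EuclideanSpace ℝ (Fin n)) x₀).source := by rwa [et]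
  rw [← h x₀ hx₀' w]
  have c1 := contDiffAt_extChartAt_comp ENat.LEInfty.out hβ hx₀'
  have c2 := contDiffAt_extChartAt_comp ENat.LEInfty.out hγ hx₀
  have d : ∀ {x : ℝ → EuclideanSpace ℝ (Fin n)}, ContDiffAt ℝ 2 x t →
      (∀ᶠ τ in 𝓝 t, DifferentiableAt ℝ x τ) ∧ ∀ᶠ τ in 𝓝 t, DifferentiableAt ℝ (deriv x) τ := by
    intro x hx
    exact ⟨(hx.eventually (by simp)).mono fun τ h => h.differentiableAt two_ne_zero,
      ((ContDiffAt.deriv_curve (m := 1) hx).eventually (by simp)).mono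
        fun τ h => h.differentiableAt one_ne_zero⟩
  have e0 : (extChartAt (𝓡 n) x₀ ∘ β) =ᶠ[𝓝[Icc 0 1] t] (extChartAt (𝓡 n) x₀ ∘ γ) := by
    filter_upwards [self_mem_nhdsWithin] with τ hτ
    rw [Function.comp_apply, Function.comp_apply, e hτ]
  have e1 := deriv_eventuallyEq_of_eventuallyEq_Icc (d c1).1 (d c2).1 e0
  have e2 := deriv_eventuallyEq_of_eventuallyEq_Icc (d c1).2 (d c2).2 e1
  rw [e1.self_of_nhdsWithin ht, e2.self_of_nhdsWithin ht, et]

variable [IsContMDiffRiemannianBundle (𝓡 n) ∞ (EuclideanSpace ℝ (Fin n))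
        (fun x : M => TangentSpace (𝓡 n) x)]

theorem differentiableAt_chartMetric {x₀ : M} {y : EuclideanSpace ℝ (Fin n)}
    (hy : y ∈ (extChartAt (𝓡 n) x₀).target) : DifferentiableAt ℝ (chartMetric x₀) y :=
  ((contDiffOn_chartMetric x₀).contDiffAt ((isOpen_extChartAt_target _).mem_nhds
      hy)).differentiableAt (by simp)

/-- The covariant acceleration of a curve `f ∘ x` in a chart, expressed by means of the pull-back of
the metric under `f`. -/
theorem covAccel_pullbackMetric {V : Type*} [NormedAddCommGroup V] [NormedSpace ℝ V]
    {f : V → M} {x : ℝ → V} {t : ℝ} {x₀ : M}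
    (hf : ContMDiffAt 𝓘(ℝ, V) (𝓡 n) 2 f (x t)) (hx : ContDiffAt ℝ 2 x t)
    (h : f (x t) ∈ (chartAt (EuclideanSpace ℝ (Fin n)) x₀).source) (w : V) :
    covAccel (pullbackMetric n f) (x t) (deriv x t) (deriv (deriv x) t) w =
      covAccel (chartMetric x₀) (extChartAt (𝓡 n) x₀ (f (x t)))
        (deriv (extChartAt (𝓡 n) x₀ ∘ f ∘ x) t) (deriv (deriv (extChartAt (𝓡 n) x₀ ∘ f ∘ x)) t)
        (fderiv ℝ (extChartAt (𝓡 n) x₀ ∘ f) (x t) w) := by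
  have hev : ∀ᶠ z in 𝓝 (x t), MDifferentiableAt 𝓘(ℝ, V) (𝓡 n) f z :=
    ((contMDiffAt_iff_contMDiffAt_nhds (by simp)).1 hf).mono fun z hz => hz.mdifferentiableAt two_ne_zero
  rw [covAccel_congr (pullbackMetric_eventuallyEq hev h)]
  exact covAccel_pullbackForm (contDiffAt_extChartAt_comp ENat.LEInfty.out hf h) hx
    (differentiableAt_chartMetric ((extChartAt (𝓡 n) x₀).map_source (by rwa [extChartAt_source])))
    (fun u v => pullbackMetric_comm _ _ _ _) w

/-- To check the geodesic equation for `f ∘ x`, it suffices to check it for the pull-back of the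
metric under `f`, when `f` is a submersion. -/
theorem isGeodesicAt_comp {V : Type*} [NormedAddCommGroup V] [NormedSpace ℝ V]
    {f : V → M} {x : ℝ → V} {t : ℝ}
    (hf : ContMDiffAt 𝓘(ℝ, V) (𝓡 n) 2 f (x t)) (hx : ContDiffAt ℝ 2 x t)
    (hs : Function.Surjective (mfderiv 𝓘(ℝ, V) (𝓡 n) f (x t)))
    (h : ∀ w, covAccel (pullbackMetric n f) (x t) (deriv x t) (deriv (deriv x) t) w = 0) :
    IsGeodesicAt (n := n) (f ∘ x) t := by
  rw [isGeodesicAt_iff]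
  refine ⟨hf.comp t hx.contMDiffAt, fun x₀ hx₀ w => ?_⟩
  -- Since `f` is a submersion, every test vector in the chart comes from a test vector in `V`.
  obtain ⟨w, rfl⟩ := fderiv_chart_comp_surjective (hf.mdifferentiableAt two_ne_zero) hs hx₀ w
  rw [← h w, covAccel_pullbackMetric hf hx hx₀]
  rfl

/-- The converse of `isGeodesicAt_comp` holds without surjectivity, since only the images of vectors
of `V` are used as test vectors. -/
theorem IsGeodesicAt.covAccel_eq_zero {V : Type*} [NormedAddCommGroup V] [NormedSpace ℝ V]
    {f : V → M} {x : ℝ → V} {t : ℝ} (h : IsGeodesicAt (n := n) (f ∘ x) t)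
    (hf : ContMDiffAt 𝓘(ℝ, V) (𝓡 n) 2 f (x t)) (hx : ContDiffAt ℝ 2 x t) (w : V) :
    covAccel (pullbackMetric n f) (x t) (deriv x t) (deriv (deriv x) t) w = 0 := by
  have hx₀ := mem_chart_source (EuclideanSpace ℝ (Fin n)) (f (x t))
  rw [covAccel_pullbackMetric hf hx hx₀]
  exact (isGeodesicAt_iff.1 h).2 _ hx₀ _

end Geodesic

/-! ### The geodesic spray -/

section Spray

variable {E : Type*} [NormedAddCommGroup E] [NormedSpace ℝ E]

/-- The form `w ↦ g(Γ(u, u), w)`. -/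
def christoffelForm (g : E → E →L[ℝ] E →L[ℝ] ℝ) (y u : E) : E →L[ℝ] ℝ :=
  fderiv ℝ g y u u - (1 / 2 : ℝ) • ((fderiv ℝ g y).flip u).flip u

/-- The acceleration of the geodesics of the metric `g`. -/
def spray (g : E → E →L[ℝ] E →L[ℝ] ℝ) (p : E × E) : E :=
  (g p.1).inverse (-christoffelForm g p.1 p.2)

theorem christoffelForm_apply (g : E → E →L[ℝ] E →L[ℝ] ℝ) (y u w : E) :
    christoffelForm g y u w = fderiv ℝ g y u u w - (1 / 2) * fderiv ℝ g y w u u := by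
  simp [christoffelForm]

theorem covAccel_eq {g : E → E →L[ℝ] E →L[ℝ] ℝ} {y : E} (hg : DifferentiableAt ℝ g y) (u a w : E) :
    covAccel g y u a w = g y a w + christoffelForm g y u w := by
  have h : ∀ u v h, fderiv ℝ (fun z => g z u v) y h = fderiv ℝ g y h u v := fun u v h => by
    rw [((hg.hasFDerivAt.clm_apply (hasFDerivAt_const u y)).clm_apply (hasFDerivAt_const v y)).fderiv]
    simp
  rw [covAccel, h, h, christoffelForm_apply]

/-- Nondegeneracy of `g y` solves the weak form of the geodesic equation for the acceleration. -/
theorem covAccel_eq_zero_iff {g : E → E →L[ℝ] E →L[ℝ] ℝ} {y : E} (hg : DifferentiableAt ℝ g y)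
    (hinv : (g y).IsInvertible) {u a : E} :
    (∀ w, covAccel g y u a w = 0) ↔ a = spray g (y, u) := by
  rw [eq_comm, spray, hinv.inverse_apply_eq]
  simp only [covAccel_eq hg, ContinuousLinearMap.ext_iff, neg_apply,
    add_eq_zero_iff_eq_neg]
  exact forall_congr' fun w => eq_comm

theorem isInvertible_of_injective {W : Type*} [NormedAddCommGroup W] [NormedSpace ℝ W]
    [FiniteDimensional ℝ E] [FiniteDimensional ℝ W] {L : E →L[ℝ] W} (hL : Function.Injective L)
    (h : Module.finrank ℝ E = Module.finrank ℝ W) : L.IsInvertible :=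
  ⟨(LinearEquiv.ofInjectiveOfFinrankEq (L : E →ₗ[ℝ] W) hL h).toContinuousLinearEquiv, by
    ext v; rfl⟩

theorem finrank_continuousDual [FiniteDimensional ℝ E] :
    Module.finrank ℝ (E →L[ℝ] ℝ) = Module.finrank ℝ E :=
  (LinearMap.toContinuousLinearMap (𝕜 := ℝ) (E := E) (F' := ℝ)).symm.finrank_eq.trans
    (Subspace.dual_finrank_eq)

theorem isInvertible_of_pos [FiniteDimensional ℝ E] {b : E →L[ℝ] E →L[ℝ] ℝ}
    (hb : ∀ v, v ≠ 0 → 0 < b v v) : b.IsInvertible := by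
  refine isInvertible_of_injective ?_ finrank_continuousDual.symm
  rw [injective_iff_map_eq_zero]
  intro v hv
  by_contra h
  have := hb v h
  rw [hv] at this
  simp at this

/-- A basis of the finite-dimensional space `E` identifies a linear map with the tuple of its values
on the basis. -/
theorem contDiffAt_clm_apply {D W : Type*} [NormedAddCommGroup D] [NormedSpace ℝ D]
    [NormedAddCommGroup W] [NormedSpace ℝ W] [FiniteDimensional ℝ E] {k : WithTop ℕ∞}
    {f : D → E →L[ℝ] W} {x : D} :
    ContDiffAt ℝ k f x ↔ ∀ y, ContDiffAt ℝ k (fun x => f x y) x := by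
  refine ⟨fun h y => h.clm_apply contDiffAt_const, fun h => ?_⟩
  let d := Module.finrank ℝ E
  have hd : d = Module.finrank ℝ (Fin d → ℝ) := (Module.finrank_fin_fun ℝ).symm
  let e₁ := ContinuousLinearEquiv.ofFinrankEq hd
  let e₂ := (e₁.arrowCongr (1 : W ≃L[ℝ] W)).trans (ContinuousLinearEquiv.piRing (Fin d))
  rw [← Function.id_comp f, ← e₂.symm_comp_self]
  exact e₂.symm.contDiff.contDiffAt.comp x (contDiffAt_pi.mpr fun i => h _)

theorem contDiffAt_spray [FiniteDimensional ℝ E] {g : E → E →L[ℝ] E →L[ℝ] ℝ} {y : E}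
    (hg : ContDiffAt ℝ ∞ g y) (hinv : (g y).IsInvertible) (u : E) :
    ContDiffAt ℝ ∞ (spray g) (y, u) := by
  have hfst : ContDiffAt ℝ ∞ (fun p : E × E => p.1) (y, u) := contDiffAt_fst
  have hsnd : ContDiffAt ℝ ∞ (fun p : E × E => p.2) (y, u) := contDiffAt_snd
  have hg' : ContDiffAt ℝ ∞ (fun p : E × E => g p.1) (y, u) :=
    ContDiffAt.comp (g := g) (y, u) hg hfst
  have hD : ContDiffAt ℝ ∞ (fun p : E × E => fderiv ℝ g p.1) (y, u) :=
    ContDiffAt.comp (g := fderiv ℝ g) (y, u) (hg.fderiv_right (m := ∞) (by simp)) hfst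
  obtain ⟨e, he⟩ := hinv
  have hi : ContDiffAt ℝ ∞ (fun p : E × E => (g p.1).inverse) (y, u) := by
    have := contDiffAt_map_inverse (n := ∞) e
    rw [he] at this
    exact ContDiffAt.comp (g := ContinuousLinearMap.inverse) (f := fun p : E × E => g p.1) (y, u)
      this hg'
  have hc : ContDiffAt ℝ ∞ (fun p : E × E => christoffelForm g p.1 p.2) (y, u) := by
    rw [contDiffAt_clm_apply]
    intro w
    simp only [christoffelForm_apply]
    exact (((hD.clm_apply hsnd).clm_apply hsnd).clm_apply contDiffAt_const).sub
      (contDiffAt_const.mul (((hD.clm_apply contDiffAt_const).clm_apply hsnd).clm_apply hsnd))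
  exact hi.clm_apply hc.neg

/-- The spray is homogeneous of degree two, so that it vanishes to second order on zero
velocities. -/
theorem spray_smul (g : E → E →L[ℝ] E →L[ℝ] ℝ) (y u : E) (c : ℝ) :
    spray g (y, c • u) = c ^ 2 • spray g (y, u) := by
  have : christoffelForm g y (c • u) = c ^ 2 • christoffelForm g y u := by
    ext w
    simp [christoffelForm_apply]
    ring
  simp [spray, this, smul_neg]

end Spray

/-! ### Uniqueness of geodesics -/

section Uniqueness

variable {n : ℕ} {M : Type*} [TopologicalSpace M] [ChartedSpace (EuclideanSpace ℝ (Fin n)) M]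

/-- Position and velocity of a curve in the chart at `x₀`. -/
def phaseCurve (n : ℕ) {M : Type*} [TopologicalSpace M] [ChartedSpace (EuclideanSpace ℝ (Fin n)) M]
    (x₀ : M) (β : ℝ → M) (t : ℝ) :
    EuclideanSpace ℝ (Fin n) × EuclideanSpace ℝ (Fin n) :=
  (extChartAt (𝓡 n) x₀ (β t), deriv (extChartAt (𝓡 n) x₀ ∘ β) t)

variable [IsManifold (𝓡 n) ∞ M]

theorem deriv_chart_curve {x₀ : M} {β : ℝ → M} {t : ℝ}
    (hβ : MDifferentiableAt 𝓘(ℝ, ℝ) (𝓡 n) β t)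
    (h : β t ∈ (chartAt (EuclideanSpace ℝ (Fin n)) x₀).source) :
    deriv (extChartAt (𝓡 n) x₀ ∘ β) t =
      mfderiv (𝓡 n) 𝓘(ℝ, EuclideanSpace ℝ (Fin n)) (extChartAt (𝓡 n) x₀) (β t)
        (mfderiv 𝓘(ℝ, ℝ) (𝓡 n) β t (1 : ℝ)) := by
  rw [← fderiv_apply_one_eq_deriv, ← mfderiv_eq_fderiv,
    mfderiv_comp t (mdifferentiableAt_extChartAt h) hβ]
  rfl

/-- The chart is injective with invertible differential on its source. This moves comparisons from
the tangent bundle to one fixed vector space, where limits and uniqueness for differential equations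
are available. -/
theorem velocity_eq_iff {x₀ : M} {β γ : ℝ → M} {t : ℝ}
    (hβ : MDifferentiableAt 𝓘(ℝ, ℝ) (𝓡 n) β t) (hγ : MDifferentiableAt 𝓘(ℝ, ℝ) (𝓡 n) γ t)
    (h : β t ∈ (chartAt (EuclideanSpace ℝ (Fin n)) x₀).source)
    (h' : γ t ∈ (chartAt (EuclideanSpace ℝ (Fin n)) x₀).source) :
    velocity n β t = velocity n γ t ↔ phaseCurve n x₀ β t = phaseCurve n x₀ γ t := by
  unfold phaseCurve velocity
  rw [deriv_chart_curve hβ h, deriv_chart_curve hγ h']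
  have key : ∀ (q q' : M) (_ : q ∈ (chartAt (EuclideanSpace ℝ (Fin n)) x₀).source)
      (_ : q' ∈ (chartAt (EuclideanSpace ℝ (Fin n)) x₀).source)
      (v : TangentSpace (𝓡 n) q) (v' : TangentSpace (𝓡 n) q'),
      ((⟨q, v⟩ : TangentBundle (𝓡 n) M) = ⟨q', v'⟩ ↔
        (extChartAt (𝓡 n) x₀ q,
          mfderiv (𝓡 n) 𝓘(ℝ, EuclideanSpace ℝ (Fin n)) (extChartAt (𝓡 n) x₀) q v) =
        (extChartAt (𝓡 n) x₀ q',
          mfderiv (𝓡 n) 𝓘(ℝ, EuclideanSpace ℝ (Fin n)) (extChartAt (𝓡 n) x₀) q' v')) := by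
    intro q q' hq hq' v v'
    constructor
    · intro e
      cases e
      rfl
    · intro e
      obtain ⟨e1, e2⟩ := Prod.mk.inj e
      obtain rfl : q = q' := (extChartAt (𝓡 n) x₀).injOn (by rwa [extChartAt_source])
        (by rwa [extChartAt_source]) e1
      have := (isInvertible_mfderiv_extChartAt (I := 𝓡 n) (x := x₀) (y := q)
        (by rwa [extChartAt_source])).injective e2
      rw [this]
  exact key _ _ h h' _ _

theorem continuousAt_phaseCurve {x₀ : M} {β : ℝ → M} {t : ℝ}
    (hβ : ContMDiffAt 𝓘(ℝ, ℝ) (𝓡 n) 2 β t)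
    (h : β t ∈ (chartAt (EuclideanSpace ℝ (Fin n)) x₀).source) :
    ContinuousAt (phaseCurve n x₀ β) t := by
  have c := contDiffAt_extChartAt_comp ENat.LEInfty.out hβ h
  exact c.continuousAt.prodMk (ContDiffAt.deriv_curve (m := 1) c).continuousAt

/-- At a limit point the positions agree because `M` is Hausdorff. Both curves then enter a common
chart, in which their phase curves are continuous, so the velocities agree as well. -/
theorem isClosed_setOf_velocity_eq [T2Space M] {β γ : ℝ → M} {I : Set ℝ} (hI : IsClosed I)
    (hβ : ∀ t ∈ I, ContMDiffAt 𝓘(ℝ, ℝ) (𝓡 n) 2 β t)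
    (hγ : ∀ t ∈ I, ContMDiffAt 𝓘(ℝ, ℝ) (𝓡 n) 2 γ t) :
    IsClosed ({t | velocity n β t = velocity n γ t} ∩ I) := by
  rw [isClosed_iff_frequently]
  intro t ht
  have htI : t ∈ I := hI.mem_of_frequently_of_tendsto (ht.mono fun τ h => h.2) Filter.tendsto_id
  have e : β t = γ t := by
    by_contra hne
    have := ((hβ t htI).continuousAt.ne_iff_eventually_ne (hγ t htI).continuousAt).1 hne
    obtain ⟨τ, h1, h2⟩ := (ht.and_eventually this).exists
    exact h2 (congrArg TotalSpace.proj h1.1)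
  refine ⟨?_, htI⟩
  have hs := mem_chart_source (EuclideanSpace ℝ (Fin n)) (β t)
  have hs' : γ t ∈ (chartAt (EuclideanSpace ℝ (Fin n)) (β t)).source := by rw [← e]; exact hs
  show velocity n β t = velocity n γ t
  rw [velocity_eq_iff ((hβ t htI).mdifferentiableAt two_ne_zero)
    ((hγ t htI).mdifferentiableAt two_ne_zero) hs hs']
  by_contra hne
  have c1 := continuousAt_phaseCurve (hβ t htI) hs
  have c2 := continuousAt_phaseCurve (hγ t htI) hs'
  have ev := (c1.ne_iff_eventually_ne c2).1 hne
  have o := (chartAt (EuclideanSpace ℝ (Fin n)) (β t)).open_source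
  obtain ⟨τ, h1, h2, h3, h4⟩ := (ht.and_eventually (ev.and
    (((hβ t htI).continuousAt.eventually_mem (o.mem_nhds hs)).and
      ((hγ t htI).continuousAt.eventually_mem (o.mem_nhds hs'))))).exists
  exact h2 ((velocity_eq_iff ((hβ τ h1.2).mdifferentiableAt two_ne_zero)
    ((hγ τ h1.2).mdifferentiableAt two_ne_zero) h3 h4).1 h1.1)

variable [RiemannianBundle (fun x : M => TangentSpace (𝓡 n) x)]

theorem isInvertible_chartMetric {x₀ : M} {y : EuclideanSpace ℝ (Fin n)}
    (hy : y ∈ (extChartAt (𝓡 n) x₀).target) : (chartMetric x₀ y).IsInvertible :=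
  isInvertible_of_pos fun _ hv => pullbackMetric_pos (mfderiv_extChartAt_symm_injective hy) hv

variable [IsContMDiffRiemannianBundle (𝓡 n) ∞ (EuclideanSpace ℝ (Fin n))
    (fun x : M => TangentSpace (𝓡 n) x)]

/-- The second order geodesic equation as a first order system, to which uniqueness for Lipschitz
vector fields applies. -/
theorem IsGeodesicAt.hasDerivAt_phaseCurve {β : ℝ → M} {t : ℝ} {x₀ : M}
    (h : IsGeodesicAt (n := n) β t)
    (hx₀ : β t ∈ (chartAt (EuclideanSpace ℝ (Fin n)) x₀).source) :
    HasDerivAt (phaseCurve n x₀ β)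
      ((phaseCurve n x₀ β t).2, spray (chartMetric x₀) (phaseCurve n x₀ β t)) t := by
  rw [isGeodesicAt_iff] at h
  have c := contDiffAt_extChartAt_comp ENat.LEInfty.out h.1 hx₀
  have hy : extChartAt (𝓡 n) x₀ (β t) ∈ (extChartAt (𝓡 n) x₀).target :=
    (extChartAt (𝓡 n) x₀).map_source (by rwa [extChartAt_source])
  have e := (covAccel_eq_zero_iff (differentiableAt_chartMetric hy)
    (isInvertible_chartMetric hy)).1 (h.2 x₀ hx₀)
  have h1 : HasDerivAt (extChartAt (𝓡 n) x₀ ∘ β) (deriv (extChartAt (𝓡 n) x₀ ∘ β) t) t :=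
    (c.differentiableAt two_ne_zero).hasDerivAt
  have h2 : HasDerivAt (deriv (extChartAt (𝓡 n) x₀ ∘ β))
      (deriv (deriv (extChartAt (𝓡 n) x₀ ∘ β)) t) t :=
    ((ContDiffAt.deriv_curve (m := 1) c).differentiableAt one_ne_zero).hasDerivAt
  rw [e] at h2
  exact h1.prodMk h2

/-- A geodesic is determined by its initial velocity. -/
theorem IsGeodesicSegment.eqOn [T2Space M] {β γ : ℝ → M} (hβ : IsGeodesicSegment n β)
    (hγ : IsGeodesicSegment n γ) (h : velocity n β 0 = velocity n γ 0) : EqOn β γ (Icc 0 1) := by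
  suffices hsub : Icc (0 : ℝ) 1 ⊆ {t | velocity n β t = velocity n γ t} from
    fun t ht => congrArg TotalSpace.proj (hsub ht)
  -- Continuous induction on `[0, 1]`: the set of agreement is closed, contains `0`, and it remains
  -- to show that it contains a right neighborhood of each of its points `t < 1`.
  refine (isClosed_setOf_velocity_eq isClosed_Icc (fun t ht => (hβ t ht).1)
    (fun t ht => (hγ t ht).1)).Icc_subset_of_forall_mem_nhdsWithin h ?_
  rintro t ⟨hv, ht⟩
  have htI : t ∈ Icc (0 : ℝ) 1 := Ico_subset_Icc_self ht
  have e : β t = γ t := congrArg TotalSpace.proj hv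
  have hs := mem_chart_source (EuclideanSpace ℝ (Fin n)) (β t)
  have hs' : γ t ∈ (chartAt (EuclideanSpace ℝ (Fin n)) (β t)).source := by rw [← e]; exact hs
  set x₀ := β t with hx₀
  have hd : ∀ {δ : ℝ → M}, IsGeodesicSegment n δ → ∀ τ ∈ Icc (0 : ℝ) 1,
      MDifferentiableAt 𝓘(ℝ, ℝ) (𝓡 n) δ τ := fun h τ hτ => (h τ hτ).1.mdifferentiableAt two_ne_zero
  have hp := (velocity_eq_iff (hd hβ t htI) (hd hγ t htI) hs hs').1 hv
  have hy : extChartAt (𝓡 n) x₀ x₀ ∈ (extChartAt (𝓡 n) x₀).target := mem_extChartAt_target _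
  -- The vector field of the first order system is `C^1`, hence Lipschitz on a neighborhood `s` of
  -- the common phase at time `t`.
  have hX : ContDiffAt ℝ 1 (fun p : EuclideanSpace ℝ (Fin n) × EuclideanSpace ℝ (Fin n) =>
      (p.2, spray (chartMetric x₀) p)) (phaseCurve n x₀ β t) := by
    refine contDiffAt_snd.prodMk ((contDiffAt_spray ?_ (isInvertible_chartMetric hy) _).of_le
      (by simp))
    exact (contDiffOn_chartMetric x₀).contDiffAt ((isOpen_extChartAt_target _).mem_nhds hy)
  obtain ⟨K, s, hsn, hK⟩ := hX.exists_lipschitzOnWith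
  have o := (chartAt (EuclideanSpace ℝ (Fin n)) x₀).open_source
  have ev : ∀ {δ : ℝ → M}, IsGeodesicSegment n δ →
      δ t ∈ (chartAt (EuclideanSpace ℝ (Fin n)) x₀).source → s ∈ 𝓝 (phaseCurve n x₀ δ t) →
      ∀ᶠ τ in 𝓝 t, δ τ ∈ (chartAt (EuclideanSpace ℝ (Fin n)) x₀).source ∧
        phaseCurve n x₀ δ τ ∈ s := fun h h1 h2 =>
    ((h t htI).1.continuousAt.eventually_mem (o.mem_nhds h1)).and
      ((continuousAt_phaseCurve (h t htI).1 h1).eventually_mem h2)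
  have ev' : ∀ᶠ τ in 𝓝[≥] t, τ ≤ 1 ∧
      (β τ ∈ (chartAt (EuclideanSpace ℝ (Fin n)) x₀).source ∧ phaseCurve n x₀ β τ ∈ s) ∧
      (γ τ ∈ (chartAt (EuclideanSpace ℝ (Fin n)) x₀).source ∧ phaseCurve n x₀ γ τ ∈ s) :=
    nhdsWithin_le_nhds (((eventually_lt_nhds ht.2).mono fun _ h => h.le).and
      ((ev hβ hs hsn).and (ev hγ hs' (hp ▸ hsn))))
  obtain ⟨b, hb, hsub⟩ := mem_nhdsGE_iff_exists_Icc_subset.1 ev'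
  have hI : ∀ τ ∈ Icc t b, τ ∈ Icc (0 : ℝ) 1 := fun τ hτ => ⟨ht.1.trans hτ.1, (hsub hτ).1⟩
  have hbd : ∀ τ ∈ Icc t b, HasDerivAt (phaseCurve n x₀ β) ((phaseCurve n x₀ β τ).2,
      spray (chartMetric x₀) (phaseCurve n x₀ β τ)) τ := fun τ hτ =>
    (hβ τ (hI τ hτ)).hasDerivAt_phaseCurve (hsub hτ).2.1.1
  have hgd : ∀ τ ∈ Icc t b, HasDerivAt (phaseCurve n x₀ γ) ((phaseCurve n x₀ γ τ).2,
      spray (chartMetric x₀) (phaseCurve n x₀ γ τ)) τ := fun τ hτ =>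
    (hγ τ (hI τ hτ)).hasDerivAt_phaseCurve (hsub hτ).2.2.1
  have hEq := ODE_solution_unique_of_mem_Icc_right (v := fun _ p => (p.2, spray (chartMetric x₀) p))
    (s := fun _ => s) (K := K) (fun _ _ => hK)
    (fun τ hτ => (hbd τ hτ).continuousAt.continuousWithinAt)
    (fun τ hτ => (hbd τ (Ico_subset_Icc_self hτ)).hasDerivWithinAt)
    (fun τ hτ => (hsub (Ico_subset_Icc_self hτ)).2.1.2)
    (fun τ hτ => (hgd τ hτ).continuousAt.continuousWithinAt)
    (fun τ hτ => (hgd τ (Ico_subset_Icc_self hτ)).hasDerivWithinAt)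
    (fun τ hτ => (hsub (Ico_subset_Icc_self hτ)).2.2.2) hp
  filter_upwards [Ioc_mem_nhdsGT hb] with τ hτ
  have hτ' := Ioc_subset_Icc_self hτ
  exact (velocity_eq_iff (hd hβ τ (hI τ hτ')) (hd hγ τ (hI τ hτ')) (hsub hτ').2.1.1
    (hsub hτ').2.2.1).2 (hEq hτ')

end Uniqueness

/-! ### The Gauss lemma -/

section Gauss

variable {n : ℕ} {M : Type*} [TopologicalSpace M] [ChartedSpace (EuclideanSpace ℝ (Fin n)) M]
  [RiemannianBundle (fun x : M => TangentSpace (𝓡 n) x)] [IsManifold (𝓡 n) ∞ M]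
  [IsContMDiffRiemannianBundle (𝓡 n) ∞ (EuclideanSpace ℝ (Fin n))
    (fun x : M => TangentSpace (𝓡 n) x)]
  {V : Type*} [NormedAddCommGroup V] [InnerProductSpace ℝ V]

/-- The **Gauss lemma**: a smooth map from a star-shaped open set of an inner product space, which
maps the rays to geodesics and is isometric to first order at the origin, is a radial isometry. -/
theorem pullbackMetric_radial {f : V → M} {s : Set V} (hs : IsOpen s)
    (hstar : ∀ v ∈ s, ∀ t ∈ Icc (0 : ℝ) 1, t • v ∈ s)
    (hf : ∀ v ∈ s, ContMDiffAt 𝓘(ℝ, V) (𝓡 n) ∞ f v)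
    (hgeo : ∀ v ∈ s, ∀ t ∈ Icc (0 : ℝ) 1, IsGeodesicAt (n := n) (fun τ : ℝ => f (τ • v)) t)
    (h0 : ∀ v w, pullbackMetric n f 0 v w = inner ℝ v w) {v : V} (hv : v ∈ s) (w : V) :
    pullbackMetric n f v v w = inner ℝ v w := by
  set g := pullbackMetric n f with hg
  have hcomm : ∀ y u w, g y u w = g y w u := pullbackMetric_comm f
  have hd : ∀ u ∈ s, DifferentiableAt ℝ g u := fun u hu =>
    differentiableAt_pullbackMetric (Filter.eventually_of_mem (hs.mem_nhds hu) hf)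
  have hray : ∀ (u : V) (t : ℝ), HasDerivAt (fun τ : ℝ => τ • u) u t := fun u t => by
    simpa using (hasDerivAt_id t).smul_const u
  have hgd : ∀ u ∈ s, ∀ t ∈ Icc (0 : ℝ) 1, ∀ a b, HasDerivAt (fun τ : ℝ => g (τ • u) a b)
      (fderiv ℝ g (t • u) u a b) t := by
    intro u hu t ht a b
    have h1 := (hd _ (hstar u hu t ht)).hasFDerivAt.comp_hasDerivAt t (hray u t)
    simpa using (h1.clm_apply (hasDerivAt_const t a)).clm_apply (hasDerivAt_const t b)
  -- The ray is a geodesic of `g` with zero coordinate acceleration, so only the Christoffel terms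
  -- are left in its equation.
  have hgeq : ∀ u ∈ s, ∀ t ∈ Icc (0 : ℝ) 1, ∀ w,
      fderiv ℝ g (t • u) u u w = (1 / 2) * fderiv ℝ g (t • u) w u u := by
    intro u hu t ht w
    have e1 : deriv (fun τ : ℝ => τ • u) = fun _ => u := funext fun τ => (hray u τ).deriv
    have h := (hgeo u hu t ht).covAccel_eq_zero (f := f) (x := fun τ : ℝ => τ • u)
      ((hf _ (hstar u hu t ht)).of_le ENat.LEInfty.out)
      (contDiff_id.smul contDiff_const).contDiffAt w
    rw [e1, deriv_const, covAccel_eq (hd _ (hstar u hu t ht)), christoffelForm_apply] at h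
    simp only [map_zero, zero_apply] at h
    linarith
  -- With `w = u` the previous identity says that the radial length is constant along the ray; its
  -- value is read off at the origin.
  have hrad : ∀ u ∈ s, g u u u = inner ℝ u u := by
    intro u hu
    have hz : ∀ t ∈ Icc (0 : ℝ) 1, HasDerivAt (fun τ : ℝ => g (τ • u) u u) 0 t := by
      intro t ht
      have := hgeq u hu t ht u
      have e : fderiv ℝ g (t • u) u u u = 0 := by linarith
      exact e ▸ hgd u hu t ht u u
    have := constant_of_has_deriv_right_zero
      (fun t ht => (hz t ht).continuousAt.continuousWithinAt)
      (fun t ht => (hz t (Ico_subset_Icc_self ht)).hasDerivWithinAt) 1 (right_mem_Icc.2 zero_le_one)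
    simpa [h0] using this
  -- Differentiate `g z z z = ⟨z, z⟩` at `u` in an arbitrary direction `w`.
  have hdiff : ∀ u ∈ s, ∀ w, fderiv ℝ g u w u u = 2 * inner ℝ u w - 2 * g u u w := by
    intro u hu w
    have h1 := ((hd u hu).hasFDerivAt.clm_apply (hasFDerivAt_id u)).clm_apply (hasFDerivAt_id u)
    have h2 := (hasFDerivAt_id (𝕜 := ℝ) u).inner ℝ (hasFDerivAt_id u)
    have e : (fun z => g z z z) =ᶠ[𝓝 u] fun z => inner ℝ z z :=
      Filter.eventually_of_mem (hs.mem_nhds hu) hrad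
    have h3 := congrArg (fun L => L w) (h1.unique (h2.congr_of_eventuallyEq e))
    simp at h3
    rw [hcomm u w u, real_inner_comm u w] at h3
    linarith
  -- The factor `τ` makes the derivative `g v w - ⟨v, w⟩ + (t/2) ∂_w g(v, v)`, which `hdiff` at `t •
  -- v`, divided by `t`, shows to be zero. The function vanishes at `0`, hence at `1`.
  have hH : ∀ t ∈ Icc (0 : ℝ) 1,
      HasDerivAt (fun τ : ℝ => τ * (g (τ • v) v w - inner ℝ v w)) 0 t := by
    intro t ht
    have h1 := (hasDerivAt_id t).mul ((hgd v hv t ht v w).sub_const (inner ℝ v w))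
    have e : 1 * (g (t • v) v w - inner ℝ v w) + id t * fderiv ℝ g (t • v) v v w = 0 := by
      rcases eq_or_ne t 0 with rfl | ht0
      · simp [h0]
      have h2 := hdiff _ (hstar v hv t ht) w
      simp only [map_smul, smul_apply, inner_smul_left, smul_eq_mul,
        conj_trivial] at h2
      have h3 := hgeq v hv t ht w
      have h4 : t * fderiv ℝ g (t • v) w v v = 2 * inner ℝ v w - 2 * g (t • v) v w :=
        mul_left_cancel₀ ht0 (by linarith)
      rw [h3, id]
      linarith
    exact e ▸ h1
  have := constant_of_has_deriv_right_zero
      (fun t ht => (hH t ht).continuousAt.continuousWithinAt)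
      (fun t ht => (hH t (Ico_subset_Icc_self ht)).hasDerivWithinAt) 1 (right_mem_Icc.2 zero_le_one)
  simp at this
  linarith

end Gauss

/-! ### The exponential map -/

section Pushforward

variable {n : ℕ} {M : Type*} [TopologicalSpace M] [ChartedSpace (EuclideanSpace ℝ (Fin n)) M]
  {V : Type*} [NormedAddCommGroup V] [NormedSpace ℝ V]

/-- The image of the vector `w` at `v` under the differential of `f`, with its foot point. -/
def pushforward (n : ℕ) {M : Type*} [TopologicalSpace M] [ChartedSpace (EuclideanSpace ℝ (Fin n)) M]
    {V : Type*} [NormedAddCommGroup V] [NormedSpace ℝ V] (f : V → M) (v w : V) :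
    TangentBundle (𝓡 n) M :=
  ⟨f v, mfderiv 𝓘(ℝ, V) (𝓡 n) f v w⟩

theorem velocity_comp {f : V → M} {γ : ℝ → V} {t : ℝ}
    (hf : MDifferentiableAt 𝓘(ℝ, V) (𝓡 n) f (γ t)) (hγ : DifferentiableAt ℝ γ t) :
    velocity n (f ∘ γ) t = pushforward n f (γ t) (deriv γ t) := by
  unfold velocity pushforward
  rw [mfderiv_comp t hf hγ.mdifferentiableAt, mfderiv_eq_fderiv]
  rfl

theorem velocityWithin_eq_pushforward {f : V → M} {γ : ℝ → V} {α : ℝ → M} {J : Set ℝ} {s : ℝ}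
    (hJ : UniqueDiffOn ℝ J) (hs : s ∈ J)
    (hf : MDifferentiableAt 𝓘(ℝ, V) (𝓡 n) f (γ s)) (hγ : DifferentiableWithinAt ℝ γ J s)
    (h : ∀ s ∈ J, α s = f (γ s)) :
    (⟨α s, mfderivWithin 𝓘(ℝ, ℝ) (𝓡 n) α J s (1 : ℝ)⟩ : TangentBundle (𝓡 n) M) =
      pushforward n f (γ s) (derivWithin γ J s) := by
  have e : mfderivWithin 𝓘(ℝ, ℝ) (𝓡 n) α J s = mfderivWithin 𝓘(ℝ, ℝ) (𝓡 n) (f ∘ γ) J s :=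
    mfderivWithin_congr h (h s hs)
  unfold pushforward
  rw [e, mfderiv_comp_mfderivWithin s hf hγ.mdifferentiableWithinAt (hJ s hs).uniqueMDiffWithinAt,
    mfderivWithin_eq_fderivWithin]
  exact congrArg (fun q => (⟨q, mfderiv 𝓘(ℝ, V) (𝓡 n) f (γ s) (fderivWithin ℝ γ J s 1)⟩ :
    TotalSpace (EuclideanSpace ℝ (Fin n)) (fun _ : M => EuclideanSpace ℝ (Fin n)))) (h s hs)

/-- Tangent vectors at points which are only propositionally equal are compared inside the tangent
bundle, where the equation of foot points can be eliminated. -/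
theorem eq_zero_iff_of_mk_eq {q q' : M} {v : TangentSpace (𝓡 n) q} {v' : TangentSpace (𝓡 n) q'}
    (h : (⟨q, v⟩ : TangentBundle (𝓡 n) M) = ⟨q', v'⟩) : v = 0 ↔ v' = 0 := by
  cases h
  rfl

theorem velocity_scale {β : ℝ → M} {p : M} {v : TangentSpace (𝓡 n) p} (c : ℝ)
    (hβ : MDifferentiableAt 𝓘(ℝ, ℝ) (𝓡 n) β 0) (h : velocity n β 0 = ⟨p, v⟩) :
    velocity n (fun τ => β (c * τ)) 0 = ⟨p, c • v⟩ := by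
  have hc : HasDerivAt (fun τ : ℝ => c * τ) c 0 := by
    simpa using (hasDerivAt_id (0 : ℝ)).const_mul c
  have h0 : c * 0 = (0 : ℝ) := mul_zero c
  have h1 : velocity n (β ∘ fun τ => c * τ) 0 = pushforward n β (c * 0) (deriv (fun τ => c * τ) 0) :=
    velocity_comp (by rwa [h0]) hc.differentiableAt
  have h2 : pushforward n β 0 c = ⟨p, c • v⟩ := by
    have : pushforward n β 0 c = ⟨β 0, c • (mfderiv 𝓘(ℝ, ℝ) (𝓡 n) β 0 (1 : ℝ) :
        TangentSpace (𝓡 n) (β 0))⟩ := by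
      let D : ℝ →L[ℝ] TangentSpace (𝓡 n) (β 0) := mfderiv 𝓘(ℝ, ℝ) (𝓡 n) β 0
      have hD : D c = c • D 1 := by rw [← map_smul, smul_eq_mul, mul_one]
      exact congrArg (fun x => (⟨β 0, x⟩ : TangentBundle (𝓡 n) M)) hD
    rw [this]
    unfold velocity at h
    cases h
    rfl
  rw [hc.deriv, h0, h2] at h1
  exact h1

variable [RiemannianBundle (fun x : M => TangentSpace (𝓡 n) x)]

theorem inner_eq_of_mk_eq {q q' : M} {v w : TangentSpace (𝓡 n) q} {v' w' : TangentSpace (𝓡 n) q'}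
    (hv : (⟨q, v⟩ : TangentBundle (𝓡 n) M) = ⟨q', v'⟩)
    (hw : (⟨q, w⟩ : TangentBundle (𝓡 n) M) = ⟨q', w'⟩) :
    (inner ℝ v w : ℝ) = inner ℝ v' w' := by
  cases hv
  cases hw
  rfl

end Pushforward

/-! ### The exponential map along rays -/

section Exp

variable {n : ℕ} {M : Type*} [TopologicalSpace M] [ChartedSpace (EuclideanSpace ℝ (Fin n)) M]
  [RiemannianBundle (fun x : M => TangentSpace (𝓡 n) x)]

theorem isOpen_tangentBall (p : M) (ε : ENNReal) : IsOpen (tangentBall (n := n) p ε) :=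
  isOpen_lt continuous_enorm continuous_const

theorem smul_mem_tangentBall {p : M} {ε : ENNReal} {v : TangentSpace (𝓡 n) p}
    (hv : v ∈ tangentBall p ε) {t : ℝ} (ht : t ∈ Icc (0 : ℝ) 1) : t • v ∈ tangentBall p ε := by
  refine lt_of_le_of_lt (b := ‖v‖ₑ) ?_ hv
  rw [enorm_smul]
  refine mul_le_of_le_one_left (by simp) ?_
  rw [Real.enorm_eq_ofReal ht.1]
  exact ENNReal.ofReal_le_one.2 ht.2

variable [IsManifold (𝓡 n) ∞ M]
  [IsContMDiffRiemannianBundle (𝓡 n) ∞ (EuclideanSpace ℝ (Fin n))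
    (fun x : M => TangentSpace (𝓡 n) x)]

/-- Both terms of the geodesic equation are multiplied by `c ^ 2`: the acceleration by the chain
rule, the Christoffel term because it is quadratic in the velocity. -/
theorem IsGeodesicAt.scale {β : ℝ → M} {t c : ℝ} (h : IsGeodesicAt (n := n) β (c * t)) :
    IsGeodesicAt (n := n) (fun τ => β (c * τ)) t := by
  rw [isGeodesicAt_iff] at h ⊢
  have hc : ContDiff ℝ 2 (fun τ : ℝ => c * τ) := contDiff_const.mul contDiff_id
  refine ⟨h.1.comp t hc.contMDiff.contMDiffAt, fun x₀ hx₀ w => ?_⟩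
  have e1 : deriv (extChartAt (𝓡 n) x₀ ∘ fun τ => β (c * τ)) =
      fun τ => c • deriv (extChartAt (𝓡 n) x₀ ∘ β) (c * τ) :=
    funext fun τ => deriv_comp_mul_left c (extChartAt (𝓡 n) x₀ ∘ β) τ
  have e2 : deriv (deriv (extChartAt (𝓡 n) x₀ ∘ fun τ => β (c * τ))) t =
      c ^ 2 • deriv (deriv (extChartAt (𝓡 n) x₀ ∘ β)) (c * t) := by
    rw [e1, deriv_fun_const_smul_field, deriv_comp_mul_left c (deriv (extChartAt (𝓡 n) x₀ ∘ β)) t,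
      smul_smul, sq]
  have hd := differentiableAt_chartMetric (x₀ := x₀) (y := extChartAt (𝓡 n) x₀ (β (c * t)))
    ((extChartAt (𝓡 n) x₀).map_source (by rwa [extChartAt_source]))
  have h3 := h.2 x₀ hx₀ w
  rw [covAccel_eq hd, christoffelForm_apply] at h3 ⊢
  rw [e2, e1]
  simp only [map_smul, smul_apply, smul_eq_mul]
  linear_combination c ^ 2 * h3

variable [T2Space M]

/-- Uniqueness of geodesics makes the choice in the definition of `expMap` irrelevant. -/
theorem IsGeodesicSegment.expMap_eq {β : ℝ → M} {p : M} {v : TangentSpace (𝓡 n) p}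
    (hβ : IsGeodesicSegment n β) (h : velocity n β 0 = ⟨p, v⟩) : expMap p v = β 1 := by
  have hv : v ∈ expDomain (n := n) p := ⟨β, hβ, h⟩
  rw [expMap, dif_pos hv]
  exact hv.choose_spec.1.eqOn hβ (hv.choose_spec.2.trans h.symm) (right_mem_Icc.2 zero_le_one)

theorem IsGeodesicSegment.expMap_smul_eq {β : ℝ → M} {p : M} {v : TangentSpace (𝓡 n) p}
    (hβ : IsGeodesicSegment n β) (h : velocity n β 0 = ⟨p, v⟩) {t : ℝ} (ht : t ∈ Icc (0 : ℝ) 1) :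
    expMap p (t • v) = β t := by
  have h1 : IsGeodesicSegment n (fun τ => β (t * τ)) := fun τ hτ =>
    (hβ (t * τ) ⟨mul_nonneg ht.1 hτ.1, mul_le_one₀ ht.2 hτ.1 hτ.2⟩).scale
  rw [h1.expMap_eq (velocity_scale t ((hβ 0 (left_mem_Icc.2 zero_le_one)).1.mdifferentiableAt
    two_ne_zero) h), mul_one]

/-- The exponential map is smooth at the points of `s`. -/
theorem isGeodesicSegment_expMap_ray {p : M} {v : TangentSpace (𝓡 n) p} (hv : v ∈ expDomain p)
    (hs : ∀ t ∈ Icc (0 : ℝ) 1,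
      ContMDiffAt 𝓘(ℝ, TangentSpace (𝓡 n) p) (𝓡 n) ∞ (expMap (n := n) p) (t • v)) :
    IsGeodesicSegment n (fun τ : ℝ => expMap (n := n) p (τ • v)) ∧
      velocity n (fun τ : ℝ => expMap (n := n) p (τ • v)) 0 = ⟨p, v⟩ := by
  obtain ⟨β, hβ, h⟩ := hv
  -- The geodesic `β` and the ray agree only on `[0, 1]`; smoothness of the ray at the end points is
  -- what allows the equation and the initial velocity to be transferred.
  have e : EqOn β (fun τ : ℝ => expMap (n := n) p (τ • v)) (Icc 0 1) := fun t ht =>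
    (hβ.expMap_smul_eq h ht).symm
  have hc : ContDiff ℝ 2 (fun τ : ℝ => τ • v) := contDiff_id.smul contDiff_const
  have hsm : ∀ t ∈ Icc (0 : ℝ) 1,
      ContMDiffAt 𝓘(ℝ, ℝ) (𝓡 n) 2 (fun τ : ℝ => expMap (n := n) p (τ • v)) t := fun t ht =>
    ((hs t ht).of_le ENat.LEInfty.out).comp t hc.contMDiff.contMDiffAt
  have h0 : (0 : ℝ) ∈ Icc (0 : ℝ) 1 := left_mem_Icc.2 zero_le_one
  refine ⟨fun t ht => (hβ t ht).congr_Icc ht (hsm t ht) e, ?_⟩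
  rw [← h]
  exact (velocity_eq_of_eqOn_Icc h0 ((hβ 0 h0).1.mdifferentiableAt two_ne_zero)
    ((hsm 0 h0).mdifferentiableAt two_ne_zero) e).symm

end Exp

/-! ### Normal curves in a normal ball -/

section NormalBall

variable {n : ℕ} {M : Type*} [TopologicalSpace M] [ChartedSpace (EuclideanSpace ℝ (Fin n)) M]
  [RiemannianBundle (fun x : M => TangentSpace (𝓡 n) x)]
  {p : M} {ε : ENNReal}

theorem uniqueDiffOn_of_ordConnected {J : Set ℝ} (hJ : J.OrdConnected) (hJ' : J.Nontrivial) :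
    UniqueDiffOn ℝ J :=
  uniqueDiffOn_convex hJ.convex (hJ.convex.nontrivial_iff_nonempty_interior.1 hJ')

/-- A curve on an interval is orthogonal to its velocity if and only if it lies on a sphere. -/
theorem inner_derivWithin_eq_zero_iff {V : Type*} [NormedAddCommGroup V] [InnerProductSpace ℝ V]
    {J : Set ℝ} (hJ : J.OrdConnected) (hJ' : J.Nontrivial) {γ : ℝ → V}
    (hγ : DifferentiableOn ℝ γ J) :
    (∀ s ∈ J, (inner ℝ (derivWithin γ J s) (γ s) : ℝ) = 0) ↔ ∃ R, ∀ s ∈ J, ‖γ s‖ = R := by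
  have hd : ∀ s ∈ J, HasDerivWithinAt (fun s => ‖γ s‖ ^ 2) (2 * inner ℝ (γ s) (derivWithin γ J s))
      J s := fun s hs => (hγ s hs).hasDerivWithinAt.norm_sq
  have hu := uniqueDiffOn_of_ordConnected hJ hJ'
  constructor
  · intro h
    obtain ⟨s₀, hs₀⟩ := hJ'.nonempty
    refine ⟨‖γ s₀‖, fun s hs => ?_⟩
    have := hJ.convex.is_const_of_fderivWithin_eq_zero (𝕜 := ℝ) (f := fun s => ‖γ s‖ ^ 2)
      (fun s hs => (hd s hs).differentiableWithinAt) (fun s hs => ?_) hs hs₀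
    · exact (sq_eq_sq₀ (norm_nonneg _) (norm_nonneg _)).1 this
    · ext
      rw [fderivWithin_derivWithin, (hd s hs).derivWithin (hu s hs),
        real_inner_comm, h s hs]
      simp
  · rintro ⟨R, hR⟩ s hs
    have h1 : HasDerivWithinAt (fun s => ‖γ s‖ ^ 2) 0 J s :=
      (hasDerivWithinAt_const s J (R ^ 2)).congr (fun s hs => by rw [hR s hs]) (by rw [hR s hs])
    have := (hu s hs).eq_deriv _ (hd s hs) h1
    rw [real_inner_comm]
    linarith

theorem IsNormalBall.contMDiffAt (h : IsNormalBall n p ε) {v : TangentSpace (𝓡 n) p}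
    (hv : v ∈ tangentBall p ε) :
    ContMDiffAt 𝓘(ℝ, TangentSpace (𝓡 n) p) (𝓡 n) ∞ (expMap (n := n) p) v :=
  (h.isLocalDiffeomorphOn ⟨v, hv⟩).contMDiffAt

theorem IsNormalBall.mdifferentiableAt (h : IsNormalBall n p ε) {v : TangentSpace (𝓡 n) p}
    (hv : v ∈ tangentBall p ε) :
    MDifferentiableAt 𝓘(ℝ, TangentSpace (𝓡 n) p) (𝓡 n) (expMap (n := n) p) v :=
  (h.contMDiffAt hv).mdifferentiableAt (by simp)

theorem IsNormalBall.mfderiv_injective (h : IsNormalBall n p ε) {v : TangentSpace (𝓡 n) p}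
    (hv : v ∈ tangentBall p ε) :
    Function.Injective (mfderiv 𝓘(ℝ, TangentSpace (𝓡 n) p) (𝓡 n) (expMap (n := n) p) v) :=
  ((h.isLocalDiffeomorphOn ⟨v, hv⟩).mfderivToContinuousLinearEquiv (by simp)).injective

theorem IsNormalBall.zero_mem (h : IsNormalBall n p ε) :
    (0 : TangentSpace (𝓡 n) p) ∈ tangentBall p ε := by
  show ‖(0 : TangentSpace (𝓡 n) p)‖ₑ < ε
  rw [enorm_zero]
  exact h.pos

/-- The inverse of the exponential map of a normal ball. -/
def logMap (n : ℕ) {M : Type*} [TopologicalSpace M] [ChartedSpace (EuclideanSpace ℝ (Fin n)) M]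
    [RiemannianBundle (fun x : M => TangentSpace (𝓡 n) x)] (p : M) (ε : ENNReal) :
    M → TangentSpace (𝓡 n) p :=
  Function.invFunOn (expMap (n := n) p) (tangentBall p ε)

theorem logMap_mem {q : M} (hq : q ∈ geodesicBall n p ε) : logMap n p ε q ∈ tangentBall p ε :=
  Function.invFunOn_mem hq

theorem expMap_logMap {q : M} (hq : q ∈ geodesicBall n p ε) : expMap p (logMap n p ε q) = q :=
  Function.invFunOn_eq hq

theorem IsNormalBall.logMap_expMap (h : IsNormalBall n p ε) {v : TangentSpace (𝓡 n) p}
    (hv : v ∈ tangentBall p ε) : logMap n p ε (expMap p v) = v :=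
  h.injOn (logMap_mem (mem_image_of_mem _ hv)) hv (expMap_logMap (mem_image_of_mem _ hv))

/-- Near `q` the inverse chosen on the whole ball coincides with the smooth local inverse: the
latter takes values in the open ball near `q`, and `exp_p` is injective there. -/
theorem IsNormalBall.contMDiffAt_logMap (h : IsNormalBall n p ε) {q : M}
    (hq : q ∈ geodesicBall n p ε) :
    ContMDiffAt (𝓡 n) 𝓘(ℝ, TangentSpace (𝓡 n) p) ∞ (logMap n p ε) q := by
  obtain ⟨v, hv, rfl⟩ := hq
  have hl := h.isLocalDiffeomorphOn ⟨v, hv⟩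
  have hL := hl.localInverse_contMDiffAt
  refine hL.congr_of_eventuallyEq ?_
  have h1 : hl.localInverse (expMap p v) ∈ tangentBall p ε := by
    have : hl.localInverse (expMap p v) = v := hl.localInverse_left_inv hl.localInverse_mem_target
    rw [this]
    exact hv
  filter_upwards [hL.continuousAt.eventually_mem ((isOpen_tangentBall p ε).mem_nhds h1),
    hl.localInverse_eventuallyEq_right] with q h2 h3
  have h4 : expMap p (hl.localInverse q) = q := h3
  conv_lhs => rw [← h4]
  exact h.logMap_expMap h2

theorem IsNormalBall.velocity_ray (h : IsNormalBall n p ε) {v : TangentSpace (𝓡 n) p} {t : ℝ}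
    (hv : t • v ∈ tangentBall p ε) :
    velocity n (fun τ : ℝ => expMap (n := n) p (τ • v)) t = pushforward n (expMap p) (t • v) v := by
  have hd : HasDerivAt (fun τ : ℝ => τ • v) v t := by simpa using (hasDerivAt_id t).smul_const v
  have := velocity_comp (n := n) (f := expMap p) (γ := fun τ : ℝ => τ • v) (t := t)
    (h.mdifferentiableAt hv) hd.differentiableAt
  rw [hd.deriv] at this
  exact this

variable {J : Set ℝ} {α : ℝ → M} {γ : ℝ → TangentSpace (𝓡 n) p}

/-- `exp_p` is an immersion on the ball, so regularity passes between `γ` and `exp_p ∘ γ`. -/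
theorem IsNormalBall.mfderivWithin_eq_zero_iff (h : IsNormalBall n p ε) (hJ : UniqueDiffOn ℝ J)
    (hα : ∀ s ∈ J, α s = expMap p (γ s)) (hmem : ∀ s ∈ J, γ s ∈ tangentBall p ε)
    (hγ : DifferentiableOn ℝ γ J) {s : ℝ} (hs : s ∈ J) :
    mfderivWithin 𝓘(ℝ, ℝ) (𝓡 n) α J s (1 : ℝ) = 0 ↔ derivWithin γ J s = 0 := by
  have hv := velocityWithin_eq_pushforward (n := n) hJ hs (h.mdifferentiableAt (hmem s hs))
    (hγ s hs) hα
  rw [eq_zero_iff_of_mk_eq hv]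
  exact map_eq_zero_iff _ (h.mfderiv_injective (hmem s hs))

theorem mem_tangentBall_iff {v : TangentSpace (𝓡 n) p} {R : ℝ} (hv : ‖v‖ = R) :
    v ∈ tangentBall p ε ↔ ENNReal.ofReal R < ε := by
  rw [← hv, ofReal_norm]
  rfl

theorem IsNormalBall.contDiffOn_logMap {k : ℕ∞} (h : IsNormalBall n p ε)
    (hα : ContMDiffOn 𝓘(ℝ, ℝ) (𝓡 n) k α J) (hU : MapsTo α J (geodesicBall n p ε)) :
    ContDiffOn ℝ k (logMap n p ε ∘ α) J := by
  rw [← contMDiffOn_iff_contDiffOn]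
  intro s hs
  exact ((h.contMDiffAt_logMap (hU hs)).of_le ENat.LEInfty.out).comp_contMDiffWithinAt s (hα s hs)

variable [IsManifold (𝓡 n) ∞ M]
  [IsContMDiffRiemannianBundle (𝓡 n) ∞ (EuclideanSpace ℝ (Fin n))
    (fun x : M => TangentSpace (𝓡 n) x)] [T2Space M]

theorem IsNormalBall.ray (h : IsNormalBall n p ε) {v : TangentSpace (𝓡 n) p}
    (hv : v ∈ tangentBall p ε) :
    IsGeodesicSegment n (fun τ : ℝ => expMap (n := n) p (τ • v)) ∧
      velocity n (fun τ : ℝ => expMap (n := n) p (τ • v)) 0 = ⟨p, v⟩ :=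
  isGeodesicSegment_expMap_ray (h.subset_expDomain hv) fun _ ht =>
    h.contMDiffAt (smul_mem_tangentBall hv ht)

theorem IsNormalBall.pushforward_zero (h : IsNormalBall n p ε) {v : TangentSpace (𝓡 n) p}
    (hv : v ∈ tangentBall p ε) : pushforward n (expMap p) 0 v = ⟨p, v⟩ := by
  rw [← (h.ray hv).2, h.velocity_ray (by rw [zero_smul]; exact h.zero_mem), zero_smul]

/-- For vectors in the ball this is `pushforward_zero`, read off from the initial velocities of
rays. Arbitrary vectors are scaled into the ball by a common positive factor, which cancels by
bilinearity. -/
theorem IsNormalBall.pullbackMetric_zero (h : IsNormalBall n p ε) (v w : TangentSpace (𝓡 n) p) :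
    pullbackMetric n (expMap p) 0 v w = inner ℝ v w := by
  have hsm : ∀ v : TangentSpace (𝓡 n) p, ∀ᶠ c : ℝ in 𝓝[>] 0, c • v ∈ tangentBall p ε := by
    intro v
    have hc : Continuous fun c : ℝ => c • v := continuous_id.smul continuous_const
    refine nhdsWithin_le_nhds (hc.continuousAt.eventually_mem
      ((isOpen_tangentBall p ε).mem_nhds ?_))
    rw [zero_smul]
    exact h.zero_mem
  obtain ⟨c, hv, hw, hc⟩ := ((hsm v).and ((hsm w).and self_mem_nhdsWithin)).exists
  have hc0 : c ≠ 0 := (show (0 : ℝ) < c from hc).ne'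
  have key : pullbackMetric n (expMap p) 0 (c • v) (c • w) = inner ℝ (c • v) (c • w) :=
    inner_eq_of_mk_eq (h.pushforward_zero hv) (h.pushforward_zero hw)
  simp only [map_smul, smul_apply, smul_eq_mul, inner_smul_left, inner_smul_right,
    conj_trivial] at key
  exact mul_left_cancel₀ hc0 (mul_left_cancel₀ hc0 key)

theorem IsNormalBall.pullbackMetric_radial (h : IsNormalBall n p ε) {v : TangentSpace (𝓡 n) p}
    (hv : v ∈ tangentBall p ε) (w : TangentSpace (𝓡 n) p) :
    pullbackMetric n (expMap p) v v w = inner ℝ v w :=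
  NormalCurves.pullbackMetric_radial (n := n) (V := TangentSpace (𝓡 n) p) (f := expMap p)
    (s := tangentBall p ε) (isOpen_tangentBall p ε)
    (fun _ hv _ ht => smul_mem_tangentBall hv ht) (fun _ hv => h.contMDiffAt hv)
    (fun _ hv => (h.ray hv).1) h.pullbackMetric_zero hv w

theorem IsNormalBall.isGeodesicSegmentIn_ray (h : IsNormalBall n p ε) {v : TangentSpace (𝓡 n) p}
    (hv : v ∈ tangentBall p ε) :
    IsGeodesicSegmentIn n (geodesicBall n p ε) p (expMap p v)
      (fun τ : ℝ => expMap (n := n) p (τ • v)) where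
  geodesic := (h.ray hv).1
  mapsTo _ ht := mem_image_of_mem _ (smul_mem_tangentBall hv ht)
  source := congrArg TotalSpace.proj (h.ray hv).2
  target := by rw [one_smul]

/-- A geodesic in a normal ball which starts at the center is a radial geodesic. -/
theorem IsNormalBall.eqOn_ray (h : IsNormalBall n p ε) {v : TangentSpace (𝓡 n) p}
    (hv : v ∈ tangentBall p ε) {β : ℝ → M}
    (hβ : IsGeodesicSegmentIn n (geodesicBall n p ε) p (expMap p v) β) :
    EqOn β (fun τ : ℝ => expMap (n := n) p (τ • v)) (Icc 0 1) := by
  obtain ⟨w, hw⟩ : ∃ w : TangentSpace (𝓡 n) p, velocity n β 0 = ⟨p, w⟩ := by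
    obtain rfl := hβ.source
    exact ⟨_, rfl⟩
  have hexp : ∀ t ∈ Icc (0 : ℝ) 1, expMap p (t • w) = β t := fun t ht =>
    hβ.geodesic.expMap_smul_eq hw ht
  -- Once the initial velocity is known to lie in the ball, injectivity of `exp_p` identifies it
  -- with `v`.
  suffices hmem : w ∈ tangentBall p ε by
    have e : w = v := h.injOn hmem hv (by
      rw [← hβ.target, ← hexp 1 (right_mem_Icc.2 zero_le_one), one_smul])
    subst e
    exact fun t ht => (hexp t ht).symm
  by_contra hcon
  have hle : ε ≤ ‖w‖ₑ := not_lt.1 hcon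
  have hfin : ε ≠ ⊤ := ne_top_of_le_ne_top enorm_ne_top hle
  have hεpos : 0 < ε.toReal := ENNReal.toReal_pos h.pos.ne' hfin
  have hle' : ε.toReal ≤ ‖w‖ := by
    rw [← toReal_enorm]
    exact ENNReal.toReal_mono enorm_ne_top hle
  have hwpos : 0 < ‖w‖ := hεpos.trans_le hle'
  have hball : ∀ u : TangentSpace (𝓡 n) p, u ∈ tangentBall p ε ↔ ‖u‖ < ε.toReal := by
    intro u
    rw [← toReal_enorm, ENNReal.toReal_lt_toReal enorm_ne_top hfin]
    rfl
  -- The time at which `t • w` reaches the boundary of the ball. Before it, `log (β t) = t • w`;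
  -- since `β t₀` is still in the normal ball, continuity of the logarithm forces `t₀ • w = log (β
  -- t₀)` into the open ball, although its norm is `ε`.
  set t₀ := ε.toReal / ‖w‖ with ht₀
  have ht₀pos : 0 < t₀ := div_pos hεpos hwpos
  have ht₀I : t₀ ∈ Icc (0 : ℝ) 1 := ⟨ht₀pos.le, (div_le_one hwpos).2 hle'⟩
  have hβt := hβ.mapsTo ht₀I
  have hL : ContinuousAt (fun t => logMap n p ε (β t)) t₀ :=
    ContinuousAt.comp (g := logMap n p ε) (h.contMDiffAt_logMap hβt).continuousAt
      (hβ.geodesic t₀ ht₀I).1.continuousAt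
  have h1 : Filter.Tendsto (fun t : ℝ => t • w) (𝓝[<] t₀) (𝓝 (t₀ • w)) :=
    ((continuous_id.smul continuous_const).tendsto t₀).mono_left nhdsWithin_le_nhds
  have h2 : Filter.Tendsto (fun t : ℝ => t • w) (𝓝[<] t₀) (𝓝 (logMap n p ε (β t₀))) := by
    refine (hL.tendsto.mono_left nhdsWithin_le_nhds).congr' ?_
    filter_upwards [Ioo_mem_nhdsLT ht₀pos] with t ht
    have htI : t ∈ Icc (0 : ℝ) 1 := ⟨ht.1.le, ht.2.le.trans ht₀I.2⟩
    rw [← hexp t htI]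
    refine h.logMap_expMap ((hball _).2 ?_)
    rw [norm_smul, Real.norm_of_nonneg ht.1.le]
    exact (lt_div_iff₀ hwpos).1 ht.2
  have h3 := (hball _).1 (logMap_mem hβt)
  rw [← tendsto_nhds_unique h1 h2, norm_smul, Real.norm_of_nonneg ht₀pos.le, ht₀,
    div_mul_cancel₀ _ hwpos.ne'] at h3
  exact lt_irrefl _ h3

theorem IsNormalBall.velocity_one_eq (h : IsNormalBall n p ε) {v : TangentSpace (𝓡 n) p}
    (hv : v ∈ tangentBall p ε) {β : ℝ → M}
    (hβ : IsGeodesicSegmentIn n (geodesicBall n p ε) p (expMap p v) β) :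
    velocity n β 1 = pushforward n (expMap p) v v := by
  have h1 : (1 : ℝ) ∈ Icc (0 : ℝ) 1 := right_mem_Icc.2 zero_le_one
  rw [velocity_eq_of_eqOn_Icc h1 ((hβ.geodesic 1 h1).1.mdifferentiableAt two_ne_zero)
    (((h.ray hv).1 1 h1).1.mdifferentiableAt two_ne_zero) (h.eqOn_ray hv hβ),
    h.velocity_ray (by rwa [one_smul]), one_smul]

/-- The orthogonality condition for `exp_p ∘ γ`, in terms of `γ`. -/
theorem IsNormalBall.orthogonal_iff (h : IsNormalBall n p ε) (hJ : UniqueDiffOn ℝ J)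
    (hα : ∀ s ∈ J, α s = expMap p (γ s)) (hmem : ∀ s ∈ J, γ s ∈ tangentBall p ε)
    (hγ : DifferentiableOn ℝ γ J) {s : ℝ} (hs : s ∈ J) :
    (∃ β : ℝ → M, IsGeodesicSegmentIn n (geodesicBall n p ε) p (α s) β ∧
      ∃ w : TangentSpace (𝓡 n) (α s), velocity n β 1 = ⟨α s, w⟩ ∧
        inner ℝ (mfderivWithin 𝓘(ℝ, ℝ) (𝓡 n) α J s (1 : ℝ) : TangentSpace (𝓡 n) (α s)) w = 0) ↔
      (inner ℝ (derivWithin γ J s) (γ s) : ℝ) = 0 := by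
  have hv := velocityWithin_eq_pushforward (n := n) hJ hs (h.mdifferentiableAt (hmem s hs))
    (hγ s hs) hα
  -- The Gauss lemma: the radial vector `γ s` is one of the two arguments, so `exp_p` preserves the
  -- inner product.
  have key : ∀ w : TangentSpace (𝓡 n) (α s),
      (⟨α s, w⟩ : TangentBundle (𝓡 n) M) = pushforward n (expMap p) (γ s) (γ s) →
      (inner ℝ (mfderivWithin 𝓘(ℝ, ℝ) (𝓡 n) α J s (1 : ℝ) : TangentSpace (𝓡 n) (α s)) w : ℝ) =
        inner ℝ (derivWithin γ J s) (γ s) := by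
    intro w hw
    rw [inner_eq_of_mk_eq hv hw, real_inner_comm, real_inner_comm (γ s)]
    exact h.pullbackMetric_radial (hmem s hs) _
  constructor
  · rintro ⟨β, hβ, w, hw, h0⟩
    rw [hα s hs] at hβ
    rw [← key w (hw.symm.trans (h.velocity_one_eq (hmem s hs) hβ)), h0]
  · intro h0
    have hβ := h.isGeodesicSegmentIn_ray (hmem s hs)
    obtain ⟨w, hw⟩ : ∃ w : TangentSpace (𝓡 n) (α s),
        pushforward n (expMap p) (γ s) (γ s) = ⟨α s, w⟩ := by
      rw [hα s hs]
      exact ⟨_, rfl⟩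
    refine ⟨_, by rw [hα s hs]; exact hβ, w, (h.velocity_one_eq (hmem s hs) hβ).trans hw, ?_⟩
    rw [key w hw.symm, h0]

theorem IsNormalBall.isNormalCurve_iff {k : ℕ∞} (h : IsNormalBall n p ε) (hJ : J.OrdConnected)
    (hJ' : J.Nontrivial) (hα : ∀ s ∈ J, α s = expMap p (γ s))
    (hmem : ∀ s ∈ J, γ s ∈ tangentBall p ε) (hγ : DifferentiableOn ℝ γ J)
    (hreg : IsRegularCurve n k α J) :
    IsNormalCurve n k p (geodesicBall n p ε) α J ↔ ∃ R, ∀ s ∈ J, ‖γ s‖ = R := by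
  have hu := uniqueDiffOn_of_ordConnected hJ hJ'
  rw [← inner_derivWithin_eq_zero_iff hJ hJ' hγ]
  refine ⟨fun hn s hs => (h.orthogonal_iff hu hα hmem hγ hs).1 (hn.orthogonal s hs),
    fun h0 => ⟨hreg, fun s hs => ?_, fun s hs => (h.orthogonal_iff hu hα hmem hγ hs).2 (h0 s hs)⟩⟩
  rw [hα s hs]
  exact mem_image_of_mem _ (hmem s hs)

/-- Radius zero is excluded by regularity: `γ` would vanish identically and `α` would have zero
velocity. -/
theorem IsNormalBall.exists_radius {k : ℕ∞} (h : IsNormalBall n p ε) (hJ : J.OrdConnected)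
    (hJ' : J.Nontrivial) (hα : ∀ s ∈ J, α s = expMap p (γ s))
    (hmem : ∀ s ∈ J, γ s ∈ tangentBall p ε) (hγ : DifferentiableOn ℝ γ J)
    (hn : IsNormalCurve n k p (geodesicBall n p ε) α J) :
    ∃ R : ℝ, 0 < R ∧ ENNReal.ofReal R < ε ∧ ∀ s ∈ J, ‖γ s‖ = R := by
  obtain ⟨R, hR⟩ := (h.isNormalCurve_iff hJ hJ' hα hmem hγ hn.regular).1 hn
  have hu := uniqueDiffOn_of_ordConnected hJ hJ'
  obtain ⟨s, hs⟩ := hJ'.nonempty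
  refine ⟨R, ?_, (mem_tangentBall_iff (hR s hs)).1 (hmem s hs), hR⟩
  rw [← hR s hs]
  refine norm_pos_iff.2 fun h0 => hn.regular.deriv_ne_zero s hs ?_
  rw [h.mfderivWithin_eq_zero_iff hu hα hmem hγ hs]
  have hz : ∀ τ ∈ J, γ τ = 0 := fun τ hτ => by
    rw [← norm_eq_zero, hR τ hτ, ← hR s hs, h0, norm_zero]
  exact ((hasDerivWithinAt_const s J (0 : TangentSpace (𝓡 n) p)).congr hz h0).derivWithin (hu s hs)

/-- In a normal ball the normal curves are the geodesic spherical curves. -/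
theorem IsNormalBall.normalIffSpherical (h : IsNormalBall n p ε) : NormalIffSpherical n p ε where
  existsUnique_geodesic := by
    rintro q ⟨v, hv, rfl⟩
    exact ⟨_, h.isGeodesicSegmentIn_ray hv, fun β' hβ' => h.eqOn_ray hv hβ'⟩
  normal_iff_mem_geodesicSphere := by
    intro k hk J hJ hJ' α hα hU
    have hk' : (k : WithTop ℕ∞) ≠ 0 := by
      exact_mod_cast (zero_lt_one.trans_le hk).ne'
    have hd := (h.contDiffOn_logMap hα.contMDiffOn hU).differentiableOn hk'
    have he : ∀ s ∈ J, α s = expMap p ((logMap n p ε ∘ α) s) := fun s hs =>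
      (expMap_logMap (hU hs)).symm
    have hmem : ∀ s ∈ J, (logMap n p ε ∘ α) s ∈ tangentBall p ε := fun s hs =>
      logMap_mem (hU hs)
    constructor
    · intro hn
      obtain ⟨R, h1, h2, h3⟩ := h.exists_radius hJ hJ' he hmem hd hn
      exact ⟨R, h1, h2, fun s hs => ⟨_, h3 s hs, (he s hs).symm⟩⟩
    · rintro ⟨R, h1, h2, h3⟩
      refine (h.isNormalCurve_iff hJ hJ' he hmem hd hα).2 ⟨R, fun s hs => ?_⟩
      obtain ⟨u, hu, hu'⟩ := h3 s hs
      have hub : u ∈ tangentBall p ε := (mem_tangentBall_iff hu).2 h2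
      -- The geodesic sphere only supplies some vector `u` of norm `R`; since `R < ε`, injectivity
      -- identifies it with the logarithm.
      rw [h.injOn (hmem s hs) hub ((he s hs).symm.trans hu'.symm)]
      exact hu
  normal_iff_image := by
    intro k hk J hJ hJ' α
    have hk' : (k : WithTop ℕ∞) ≠ 0 := by
      exact_mod_cast (zero_lt_one.trans_le hk).ne'
    have hu := uniqueDiffOn_of_ordConnected hJ hJ'
    constructor
    · intro hn
      have hU := hn.mapsTo
      have hc := h.contDiffOn_logMap hn.regular.contMDiffOn hU
      have hd := hc.differentiableOn hk'
      have he : ∀ s ∈ J, α s = expMap p ((logMap n p ε ∘ α) s) := fun s hs =>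
        (expMap_logMap (hU hs)).symm
      have hmem : ∀ s ∈ J, (logMap n p ε ∘ α) s ∈ tangentBall p ε := fun s hs =>
        logMap_mem (hU hs)
      obtain ⟨R, h1, h2, h3⟩ := h.exists_radius hJ hJ' he hmem hd hn
      refine ⟨R, logMap n p ε ∘ α, h1, h2, ⟨hc, fun s hs => ?_, h3⟩, he⟩
      exact fun h0 => hn.regular.deriv_ne_zero s hs
        ((h.mfderivWithin_eq_zero_iff hu he hmem hd hs).2 h0)
    · rintro ⟨R, γ, h1, h2, hγ, he⟩
      have hmem : ∀ s ∈ J, γ s ∈ tangentBall p ε := fun s hs =>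
        (mem_tangentBall_iff (hγ.norm_eq s hs)).2 h2
      have hd := hγ.contDiffOn.differentiableOn hk'
      refine (h.isNormalCurve_iff hJ hJ' he hmem hd ⟨?_, fun s hs h0 => ?_⟩).2 ⟨R, hγ.norm_eq⟩
      · refine ContMDiffOn.congr (f := expMap p ∘ γ) (fun s hs => ?_) he
        exact ((h.contMDiffAt (hmem s hs)).of_le ENat.LEInfty.out).comp_contMDiffWithinAt s
          (hγ.contDiffOn.contMDiffOn s hs)
      · exact hγ.deriv_ne_zero s hs ((h.mfderivWithin_eq_zero_iff hu he hmem hd hs).1 h0)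

end NormalBall

/-! ### Superposition operators on spaces of continuous functions -/

section Superposition

universe u

variable {K : Type*} [TopologicalSpace K] [CompactSpace K]

/-- The pointwise application of a continuous family of linear maps to a continuous function. -/
def applyFamily (K : Type*) [TopologicalSpace K] [CompactSpace K] (A B : Type*)
    [NormedAddCommGroup A] [NormedSpace ℝ A] [NormedAddCommGroup B] [NormedSpace ℝ B] :
    C(K, A →L[ℝ] B) →L[ℝ] C(K, A) →L[ℝ] C(K, B) :=
  LinearMap.mkContinuous₂
    (LinearMap.mk₂ ℝ (fun L h => ⟨fun t => L t (h t), L.continuous.clm_apply h.continuous⟩)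
      (fun _ _ _ => by ext; simp) (fun _ _ _ => by ext; simp)
      (fun _ _ _ => by ext; simp) (fun _ _ _ => by ext; simp)) 1 fun L h => by
    rw [one_mul, ContinuousMap.norm_le _ (by positivity)]
    intro t
    exact ((L t).le_opNorm _).trans (mul_le_mul (L.norm_coe_le_norm t) (h.norm_coe_le_norm t)
      (norm_nonneg _) (norm_nonneg _))

/-- The mean value inequality is applied at each point of `K`. Uniform continuity of the derivative
gives one `δ` for all of them, hence an estimate in the supremum norm. -/
theorem hasFDerivAt_superposition {A B : Type*} [NormedAddCommGroup A] [NormedSpace ℝ A]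
    [NormedAddCommGroup B] [NormedSpace ℝ B] {F : C(A, B)} {F' : C(A, A →L[ℝ] B)}
    (hF : ∀ x, HasFDerivAt F (F' x) x) (hu : UniformContinuous F') (f : C(K, A)) :
    HasFDerivAt (fun f : C(K, A) => F.comp f) (applyFamily K A B (F'.comp f)) f := by
  rw [hasFDerivAt_iff_isLittleO_nhds_zero, Asymptotics.isLittleO_iff]
  intro c hc
  obtain ⟨δ, hδ, hδ'⟩ := Metric.uniformContinuous_iff.1 hu c hc
  filter_upwards [Metric.ball_mem_nhds (0 : C(K, A)) hδ] with h hh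
  rw [mem_ball_zero_iff] at hh
  rw [ContinuousMap.norm_le _ (by positivity)]
  intro t
  have ht : ‖h t‖ < δ := (h.norm_coe_le_norm t).trans_lt hh
  have key := (convex_ball (f t) δ).norm_image_sub_le_of_norm_hasFDerivWithin_le'
    (f := F) (f' := F') (φ := F' (f t)) (C := c) (x := f t) (y := f t + h t)
    (fun x _ => (hF x).hasFDerivWithinAt)
    (fun x hx => by rw [← dist_eq_norm]; exact (hδ' hx).le)
    (Metric.mem_ball_self hδ) (by simpa using ht)
  rw [add_sub_cancel_left] at key
  exact key.trans (mul_le_mul_of_nonneg_left (h.norm_coe_le_norm t) hc.le)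

/-- Induction on the order: the derivative is superposition with `fderiv ℝ F`, followed by the
bounded linear operator `applyFamily`. Compact support is inherited by derivatives and supplies
uniform continuity. The target varies in the induction, and `A →L[ℝ] B` stays in the universe of `A`
and `B`. -/
theorem contDiff_superposition {A : Type u} [NormedAddCommGroup A] [NormedSpace ℝ A] (k : ℕ) :
    ∀ {B : Type u} [NormedAddCommGroup B] [NormedSpace ℝ B] (F : C(A, B)),
      ContDiff ℝ ∞ F → HasCompactSupport F → ContDiff ℝ k (fun f : C(K, A) => F.comp f) := by
  induction k with
  | zero =>
    intro B _ _ F _ _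
    exact contDiff_zero.2 (ContinuousMap.continuous_postcomp F)
  | succ k ih =>
    intro B _ _ F hF hc
    have hF1 : ContDiff ℝ ∞ (fderiv ℝ F) := hF.fderiv_right (by simp)
    let F' : C(A, A →L[ℝ] B) := ⟨fderiv ℝ F, hF1.continuous⟩
    have hd := hasFDerivAt_superposition (K := K) (F := F) (F' := F')
      (fun x => (hF.differentiable (by simp) x).hasFDerivAt)
      ((hc.fderiv ℝ).uniformContinuous_of_continuous hF1.continuous)
    have e : fderiv ℝ (fun f : C(K, A) => F.comp f) =
      fun f => applyFamily K A B (F'.comp f) := funext fun f => (hd f).fderiv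
    rw [Nat.cast_add, Nat.cast_one, contDiff_succ_iff_fderiv]
    refine ⟨fun f => (hd f).differentiableAt, by simp, ?_⟩
    rw [e]
    exact (applyFamily K A B).contDiff.comp (ih F' hF1 (hc.fderiv ℝ))

end Superposition

/-! ### Integration as an operator on continuous functions -/

section Integration

open intervalIntegral

/-- The parameter interval for solutions of differential equations; it contains `[0, 1]` in its
interior. -/
abbrev timeInterval : Set ℝ := Icc (-2) 2

theorem timeInterval_le : (-2 : ℝ) ≤ 2 := by norm_num

/-- The extension of a continuous function on the time interval to the real line. -/
def extendTime {E : Type*} [TopologicalSpace E] (f : C(timeInterval, E)) : ℝ → E := IccExtend timeInterval_le f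

theorem continuous_extendTime {E : Type*} [TopologicalSpace E] (f : C(timeInterval, E)) : Continuous (extendTime f) :=
  f.continuous.Icc_extend'

theorem extendTime_apply {E : Type*} [TopologicalSpace E] (f : C(timeInterval, E)) {t : ℝ} (ht : t ∈ timeInterval) :
    extendTime f t = f ⟨t, ht⟩ := IccExtend_of_mem _ _ ht

theorem norm_extendTime_le {E : Type*} [NormedAddCommGroup E] (f : C(timeInterval, E)) (t : ℝ) : ‖extendTime f t‖ ≤ ‖f‖ :=
  f.norm_coe_le_norm _

variable {E : Type*} [NormedAddCommGroup E] [NormedSpace ℝ E]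

variable (E) in
/-- Constant functions on the time interval. -/
def constL : E →L[ℝ] C(timeInterval, E) :=
  LinearMap.mkContinuous
    { toFun := fun v => ContinuousMap.const _ v
      map_add' := fun _ _ => rfl
      map_smul' := fun _ _ => rfl } 1 fun v => by
    rw [one_mul, ContinuousMap.norm_le _ (norm_nonneg _)]
    exact fun _ => le_rfl

/-- The curve with initial point `y₀`, initial velocity `q.1` and acceleration `q.2`. -/
def curveOf (y₀ : E) (q : E × C(timeInterval, E)) (t : ℝ) : E :=
  y₀ + ∫ s in (0 : ℝ)..t, (q.1 + ∫ r in (0 : ℝ)..s, extendTime q.2 r)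

theorem curveOf_zero (y₀ : E) (q : E × C(timeInterval, E)) : curveOf y₀ q 0 = y₀ := by
  simp [curveOf]

variable [CompleteSpace E]

theorem hasDerivAt_integral_extendTime (f : C(timeInterval, E)) (t : ℝ) :
    HasDerivAt (fun t => ∫ s in (0 : ℝ)..t, extendTime f s) (extendTime f t) t :=
  integral_hasDerivAt_right ((continuous_extendTime f).intervalIntegrable _ _)
    (continuous_extendTime f).stronglyMeasurable.stronglyMeasurableAtFilter
    (continuous_extendTime f).continuousAt

variable (E) in
/-- Integration from `0`, as an operator on continuous functions on the time interval. -/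
def primitiveL : C(timeInterval, E) →L[ℝ] C(timeInterval, E) :=
  LinearMap.mkContinuous
    { toFun := fun f => ⟨fun t => ∫ s in (0 : ℝ)..t, extendTime f s,
        (continuous_iff_continuousAt.2 fun t =>
          (hasDerivAt_integral_extendTime f t).continuousAt).comp continuous_subtype_val⟩
      map_add' := fun f g => by
        ext t
        exact integral_add ((continuous_extendTime f).intervalIntegrable _ _)
          ((continuous_extendTime g).intervalIntegrable _ _)
      map_smul' := fun c f => by
        ext t
        exact integral_smul c _ } 2 fun f => by
    rw [ContinuousMap.norm_le _ (by positivity)]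
    intro t
    refine (norm_integral_le_of_norm_le_const (C := ‖f‖) fun s _ => norm_extendTime_le f s).trans ?_
    rw [sub_zero, mul_comm]
    exact mul_le_mul_of_nonneg_right (abs_le.2 t.2) (norm_nonneg _)

theorem primitiveL_apply (f : C(timeInterval, E)) (t : timeInterval) :
    primitiveL E f t = ∫ s in (0 : ℝ)..t, extendTime f s := rfl

variable (E) in
/-- The velocity on the time interval, from the initial velocity and the acceleration. -/
def velocityL : E × C(timeInterval, E) →L[ℝ] C(timeInterval, E) :=
  (constL E).comp (ContinuousLinearMap.fst ℝ E _) +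
    (primitiveL E).comp (ContinuousLinearMap.snd ℝ E _)

variable (E) in
/-- The displacement and the velocity on the time interval, from the initial velocity and the
acceleration. -/
def phaseL : E × C(timeInterval, E) →L[ℝ] C(timeInterval, E × E) :=
  ((ContinuousLinearMap.inl ℝ E E).compLeftContinuous ℝ timeInterval).comp
    ((primitiveL E).comp (velocityL E)) +
  ((ContinuousLinearMap.inr ℝ E E).compLeftContinuous ℝ timeInterval).comp (velocityL E)

theorem phaseL_apply (q : E × C(timeInterval, E)) (t : timeInterval) :
    phaseL E q t = (primitiveL E (velocityL E q) t, velocityL E q t) := by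
  simp [phaseL]

theorem hasDerivAt_velocity (q : E × C(timeInterval, E)) (t : ℝ) :
    HasDerivAt (fun t => q.1 + ∫ r in (0 : ℝ)..t, extendTime q.2 r) (extendTime q.2 t) t :=
  (hasDerivAt_integral_extendTime q.2 t).const_add q.1

theorem continuous_velocity (q : E × C(timeInterval, E)) :
    Continuous (fun t => q.1 + ∫ r in (0 : ℝ)..t, extendTime q.2 r) :=
  continuous_iff_continuousAt.2 fun t => (hasDerivAt_velocity q t).continuousAt

theorem deriv_curveOf (y₀ : E) (q : E × C(timeInterval, E)) :
    deriv (curveOf y₀ q) = fun t => q.1 + ∫ r in (0 : ℝ)..t, extendTime q.2 r := by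
  have hc := continuous_velocity q
  exact funext fun t => ((integral_hasDerivAt_right (hc.intervalIntegrable _ _)
    hc.stronglyMeasurable.stronglyMeasurableAtFilter hc.continuousAt).const_add y₀).deriv

theorem deriv_deriv_curveOf (y₀ : E) (q : E × C(timeInterval, E)) :
    deriv (deriv (curveOf y₀ q)) = extendTime q.2 := by
  rw [deriv_curveOf]
  exact funext fun t => (hasDerivAt_velocity q t).deriv

/-- The acceleration is extended continuously beyond the time interval, so integrating twice gives a
`C^2` curve on the whole line. -/
theorem contDiff_curveOf (y₀ : E) (q : E × C(timeInterval, E)) : ContDiff ℝ 2 (curveOf y₀ q) := by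
  have hc := continuous_velocity q
  rw [show (2 : WithTop ℕ∞) = 1 + 1 from rfl, contDiff_succ_iff_deriv]
  refine ⟨fun t => ((integral_hasDerivAt_right (hc.intervalIntegrable _ _)
    hc.stronglyMeasurable.stronglyMeasurableAtFilter hc.continuousAt).const_add
      y₀).differentiableAt, by simp, ?_⟩
  rw [contDiff_one_iff_deriv, deriv_deriv_curveOf, deriv_curveOf]
  exact ⟨fun t => (hasDerivAt_velocity q t).differentiableAt, continuous_extendTime q.2⟩

theorem curveOf_eq (y₀ : E) (q : E × C(timeInterval, E)) {t : ℝ} (ht : t ∈ timeInterval) :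
    curveOf y₀ q t = y₀ + primitiveL E (velocityL E q) ⟨t, ht⟩ := by
  rw [primitiveL_apply, curveOf]
  congr 1
  refine integral_congr fun s hs => ?_
  have h0 : (0 : ℝ) ∈ timeInterval := by constructor <;> norm_num
  have hs' : s ∈ timeInterval := (convex_Icc _ _).ordConnected.uIcc_subset h0 ht hs
  rw [extendTime_apply _ hs']
  rfl

/-- The phase of the curve is affine in the pair of initial velocity and acceleration; this is what
makes the differential equation an equation between functions on the time interval. -/
theorem curveOf_phase (y₀ : E) (q : E × C(timeInterval, E)) {t : ℝ} (ht : t ∈ timeInterval) :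
    (curveOf y₀ q t, deriv (curveOf y₀ q) t) = (y₀, 0) + phaseL E q ⟨t, ht⟩ := by
  rw [phaseL_apply, curveOf_eq y₀ q ht, deriv_curveOf]
  exact Prod.ext rfl (zero_add _).symm

theorem deriv_curveOf_zero (y₀ : E) (q : E × C(timeInterval, E)) : deriv (curveOf y₀ q) 0 = q.1 := by
  simp [deriv_curveOf]

end Integration

/-! ### The inverse function theorem -/

section InverseFunction

/-- The source is shrunk to the points of `U` with invertible derivative, an open set because
invertible operators are open. The inverse is then smooth on all of its domain and not only at the
image of `a`. The spaces may be infinite-dimensional. -/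
theorem exists_localInverse {X Y : Type*} [NormedAddCommGroup X] [NormedSpace ℝ X]
    [CompleteSpace X] [NormedAddCommGroup Y] [NormedSpace ℝ Y] {G : X → Y} {U : Set X} {a : X}
    (hU : IsOpen U) (ha : a ∈ U) (hG : ContDiffOn ℝ ∞ G U) {e : X ≃L[ℝ] Y}
    (he : HasFDerivAt G (e : X →L[ℝ] Y) a) :
    ∃ Φ : OpenPartialHomeomorph X Y, a ∈ Φ.source ∧ Φ.source ⊆ U ∧ Φ = G ∧
      ContDiffOn ℝ ∞ Φ.symm Φ.target := by
  have hGa : ContDiffAt ℝ ∞ G a := hG.contDiffAt (hU.mem_nhds ha)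
  have hV : IsOpen (U ∩ fderiv ℝ G ⁻¹' range ((↑) : (X ≃L[ℝ] Y) → X →L[ℝ] Y)) :=
    (hG.continuousOn_fderiv_of_isOpen hU (by simp)).isOpen_inter_preimage hU
      ContinuousLinearEquiv.isOpen
  let Φ₀ := hGa.toOpenPartialHomeomorph G he (by simp)
  have h0 : (Φ₀ : X → Y) = G := hGa.toOpenPartialHomeomorph_coe he (by simp)
  have hs : (Φ₀.restrOpen _ hV).source =
      Φ₀.source ∩ (U ∩ fderiv ℝ G ⁻¹' range ((↑) : (X ≃L[ℝ] Y) → X →L[ℝ] Y)) :=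
    Φ₀.restrOpen_source _ hV
  refine ⟨Φ₀.restrOpen _ hV, ?_, ?_, h0, fun y hy => ?_⟩
  · rw [hs]
    exact ⟨hGa.mem_toOpenPartialHomeomorph_source he (by simp), ha, e, he.fderiv.symm⟩
  · rw [hs]
    exact fun x hx => hx.2.1
  · have hx := (Φ₀.restrOpen _ hV).map_target hy
    rw [hs] at hx
    obtain ⟨e', h'⟩ := hx.2.2
    have hc : ContDiffAt ℝ ∞ G ((Φ₀.restrOpen _ hV).symm y) :=
      hG.contDiffAt (hU.mem_nhds hx.2.1)
    refine ((Φ₀.restrOpen _ hV).contDiffAt_symm (f₀' := e') hy ?_ ?_).contDiffWithinAt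
    · rw [h']
      change HasFDerivAt Φ₀ _ _
      rw [h0]
      exact (hc.differentiableAt (by simp)).hasFDerivAt
    · change ContDiffAt ℝ ∞ Φ₀ _
      rw [h0]
      exact hc

variable {n : ℕ} {M : Type*} [TopologicalSpace M] [ChartedSpace (EuclideanSpace ℝ (Fin n)) M]
  [IsManifold (𝓡 n) ∞ M]

/-- The inverse function theorem for maps from a vector space to a manifold. -/
theorem isLocalDiffeomorphAt_of_surjective {V : Type*} [NormedAddCommGroup V] [NormedSpace ℝ V]
    [FiniteDimensional ℝ V] (hn : Module.finrank ℝ V = n) {f : V → M} {U : Set V} {a : V}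
    (hU : IsOpen U) (ha : a ∈ U) (hf : ContMDiffOn 𝓘(ℝ, V) (𝓡 n) ∞ f U)
    (hs : Function.Surjective (mfderiv 𝓘(ℝ, V) (𝓡 n) f a)) :
    IsLocalDiffeomorphAt 𝓘(ℝ, V) (𝓡 n) ∞ f a := by
  have : CompleteSpace V := FiniteDimensional.complete ℝ V
  have hs₀ := (chartAt (EuclideanSpace ℝ (Fin n)) (f a)).open_source
  have hU' : IsOpen (U ∩ f ⁻¹' (chartAt (EuclideanSpace ℝ (Fin n)) (f a)).source) :=
    hf.continuousOn.isOpen_inter_preimage hU hs₀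
  have ha' : a ∈ U ∩ f ⁻¹' (chartAt (EuclideanSpace ℝ (Fin n)) (f a)).source :=
    ⟨ha, mem_chart_source _ _⟩
  have hG : ContDiffOn ℝ ∞ (extChartAt (𝓡 n) (f a) ∘ f)
      (U ∩ f ⁻¹' (chartAt (EuclideanSpace ℝ (Fin n)) (f a)).source) := fun y hy =>
    (contDiffAt_extChartAt_comp le_rfl (hf.contMDiffAt (hU.mem_nhds hy.1)) hy.2).contDiffWithinAt
  have hfa : MDifferentiableAt 𝓘(ℝ, V) (𝓡 n) f a :=
    (hf.contMDiffAt (hU.mem_nhds ha)).mdifferentiableAt (by simp)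
  have hd : HasFDerivAt (extChartAt (𝓡 n) (f a) ∘ f)
      (fderiv ℝ (extChartAt (𝓡 n) (f a) ∘ f) a) a :=
    ((hG.contDiffAt (hU'.mem_nhds ha')).differentiableAt (by simp)).hasFDerivAt
  have hsurj : Function.Surjective (fderiv ℝ (extChartAt (𝓡 n) (f a) ∘ f) a) := fun w =>
    fderiv_chart_comp_surjective hfa hs (mem_chart_source _ _) w
  have hfin : Module.finrank ℝ V = Module.finrank ℝ (EuclideanSpace ℝ (Fin n)) := by
    rw [hn, finrank_euclideanSpace_fin]
  -- In equal finite dimensions a surjective differential is an isomorphism.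
  obtain ⟨e, he⟩ := isInvertible_of_injective
    ((LinearMap.injective_iff_surjective_of_finrank_eq_finrank hfin).2 hsurj) hfin
  rw [← he] at hd
  obtain ⟨Φ, haΦ, hΦU, hΦ, hΦs⟩ := exists_localInverse hU' ha' hG hd
  have hΦ' : ∀ y ∈ Φ.source, extChartAt (𝓡 n) (f a) (f y) = Φ y := fun y _ => by
    rw [hΦ]
    rfl
  have hΦ'' : ∀ y ∈ Φ.source, f y = (extChartAt (𝓡 n) (f a)).symm (Φ y) := fun y hy => by
    rw [← hΦ' y hy, (extChartAt (𝓡 n) (f a)).left_inv]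
    rw [extChartAt_source]
    exact (hΦU hy).2
  have ht : IsOpen ((chartAt (EuclideanSpace ℝ (Fin n)) (f a)).source ∩
      extChartAt (𝓡 n) (f a) ⁻¹' Φ.target) := by
    rw [← extChartAt_source (𝓡 n)]
    exact (continuousOn_extChartAt (f a)).isOpen_inter_preimage (isOpen_extChartAt_source _)
      Φ.open_target
  refine ⟨
    { toFun := f
      invFun := Φ.symm ∘ extChartAt (𝓡 n) (f a)
      source := Φ.source
      target := (chartAt (EuclideanSpace ℝ (Fin n)) (f a)).source ∩
        extChartAt (𝓡 n) (f a) ⁻¹' Φ.target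
      map_source' := fun y hy => ⟨(hΦU hy).2, by
        rw [mem_preimage, hΦ' y hy]
        exact Φ.map_source hy⟩
      map_target' := fun q hq => Φ.map_target hq.2
      left_inv' := fun y hy => by
        rw [Function.comp_apply, hΦ' y hy, Φ.left_inv hy]
      right_inv' := fun q hq => by
        rw [Function.comp_apply, hΦ'' _ (Φ.map_target hq.2), Φ.right_inv hq.2,
          (extChartAt (𝓡 n) (f a)).left_inv]
        rw [extChartAt_source]
        exact hq.1
      open_source := Φ.open_source
      open_target := ht
      contMDiffOn_toFun := hf.mono fun y hy => (hΦU hy).1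
      contMDiffOn_invFun := hΦs.contMDiffOn.comp
        ((contMDiffOn_extChartAt (n := ∞)).mono inter_subset_left) fun q hq => hq.2 }, haΦ,
    fun y _ => rfl⟩

end InverseFunction

/-! ### Solutions of second order differential equations with small initial velocity -/

section Solutions

universe u

variable {E : Type u} [NormedAddCommGroup E] [NormedSpace ℝ E] [CompleteSpace E]

/-- The equation `y'' = F (y, y')` has solutions with initial point `y₀` and initial velocity
close to zero, whose acceleration depends smoothly on the initial velocity, if `F` vanishes to
second order at `(y₀, 0)`. -/
theorem exists_acceleration (F : C(E × E, E)) (hF : ContDiff ℝ ∞ F) (hc : HasCompactSupport F)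
    {y₀ : E} (h0 : F (y₀, 0) = 0) (h1 : fderiv ℝ F (y₀, 0) = 0) :
    ∃ (W : Set E) (z : E → C(timeInterval, E)), IsOpen W ∧ 0 ∈ W ∧ z 0 = 0 ∧
      ContDiffOn ℝ ∞ z W ∧ HasFDerivAt z (0 : E →L[ℝ] C(timeInterval, E)) 0 ∧
      ∀ v ∈ W, z v = F.comp (ContinuousMap.const _ (y₀, 0) + phaseL E (v, z v)) := by
  let P : E × C(timeInterval, E) → C(timeInterval, E × E) := fun q =>
    ContinuousMap.const _ (y₀, 0) + phaseL E q
  -- A pair `(v, z)` is mapped to `(v, 0)` exactly when `z` is the acceleration of a solution with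
  -- initial velocity `v`. The derivative of `G` at `0` is the identity because that of `F` at `(y₀,
  -- 0)` vanishes, so the local inverse applied to `(v, 0)` yields `z v`.
  let G : E × C(timeInterval, E) → E × C(timeInterval, E) := fun q => (q.1, q.2 - F.comp (P q))
  have hP : ContDiff ℝ ∞ P := contDiff_const.add (phaseL E).contDiff
  have hsup : ContDiff ℝ ∞ (fun f : C(timeInterval, E × E) => F.comp f) :=
    contDiff_infty.2 fun k => contDiff_superposition k F hF hc
  have hG : ContDiff ℝ ∞ G := contDiff_fst.prodMk (contDiff_snd.sub (hsup.comp hP))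
  have hF1 : ContDiff ℝ ∞ (fderiv ℝ F) := hF.fderiv_right (by simp)
  have hP0 : P 0 = ContinuousMap.const _ (y₀, 0) := by simp [P]
  have hd0 : HasFDerivAt (fun q => F.comp (P q))
      (0 : E × C(timeInterval, E) →L[ℝ] C(timeInterval, E)) 0 := by
    have ha := hasFDerivAt_superposition (K := timeInterval) (F := F)
      (F' := ⟨fderiv ℝ F, hF1.continuous⟩)
      (fun x => (hF.differentiable (by simp) x).hasFDerivAt)
      ((hc.fderiv ℝ).uniformContinuous_of_continuous hF1.continuous) (P 0)
    have hb := ha.comp (0 : E × C(timeInterval, E))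
      ((hP.differentiable (by simp) 0).hasFDerivAt)
    refine hb.congr_fderiv (ContinuousLinearMap.ext fun q => ContinuousMap.ext fun t => ?_)
    rw [hP0]
    change fderiv ℝ F (y₀, 0) (fderiv ℝ P 0 q t) = 0
    rw [h1, zero_apply]
  have hd : HasFDerivAt G
      ((ContinuousLinearEquiv.refl ℝ (E × C(timeInterval, E)) :
        E × C(timeInterval, E) →L[ℝ] E × C(timeInterval, E))) 0 := by
    have := (hasFDerivAt_fst (𝕜 := ℝ) (p := (0 : E × C(timeInterval, E)))).prodMk
      ((hasFDerivAt_snd (𝕜 := ℝ) (p := (0 : E × C(timeInterval, E)))).sub hd0)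
    refine this.congr_fderiv (ContinuousLinearMap.ext fun q => ?_)
    simp
  obtain ⟨Φ, h0Φ, -, hΦ, hΦs⟩ := exists_localInverse isOpen_univ (mem_univ _) hG.contDiffOn hd
  have hG0 : G 0 = 0 := by
    refine Prod.ext rfl ?_
    ext t
    simp [G, hP0, h0]
  have hΦ0 : Φ 0 = 0 := by rw [hΦ, hG0]
  have h0t : (0 : E × C(timeInterval, E)) ∈ Φ.target := by
    have := Φ.map_source h0Φ
    rwa [hΦ0] at this
  have hs0 : Φ.symm 0 = 0 := by
    have := Φ.left_inv h0Φ
    rwa [hΦ0] at this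
  let j : E →L[ℝ] E × C(timeInterval, E) := ContinuousLinearMap.inl ℝ E _
  have hj : ContDiffOn ℝ ∞ (fun v => Φ.symm (j v)) (j ⁻¹' Φ.target) :=
    hΦs.comp j.contDiff.contDiffOn fun v hv => hv
  have key : ∀ v ∈ j ⁻¹' Φ.target, (Φ.symm (j v)).1 = v ∧
      (Φ.symm (j v)).2 = F.comp (P (Φ.symm (j v))) := by
    intro v hv
    have h := Φ.right_inv hv
    rw [hΦ] at h
    exact ⟨congrArg Prod.fst h, sub_eq_zero.1 (congrArg Prod.snd h)⟩
  refine ⟨j ⁻¹' Φ.target, fun v => (Φ.symm (j v)).2, Φ.open_target.preimage j.continuous,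
    by rwa [mem_preimage, map_zero], by simp [hs0], contDiff_snd.comp_contDiffOn hj, ?_, ?_⟩
  · have hsymm : HasFDerivAt Φ.symm ((ContinuousLinearEquiv.refl ℝ (E × C(timeInterval, E))).symm :
        E × C(timeInterval, E) →L[ℝ] E × C(timeInterval, E)) 0 := by
      refine Φ.hasFDerivAt_symm h0t ?_
      rw [hs0, hΦ]
      exact hd
    have h2 : HasFDerivAt (fun v => Φ.symm (j v)) j 0 := by
      have hj0 : j 0 = 0 := map_zero j
      rw [← hj0] at hsymm
      exact hsymm.comp (0 : E) j.hasFDerivAt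
    refine h2.snd.congr_fderiv ?_
    ext v
    simp [j]
  · intro v hv
    obtain ⟨e1, e2⟩ := key v hv
    exact e2.trans (congrArg (fun q => F.comp (P q)) (Prod.ext e1 rfl))

end Solutions

/-! ### Cutting off a vector field -/

section Cutoff

variable {A B : Type*} [NormedAddCommGroup A] [NormedSpace ℝ A] [FiniteDimensional ℝ A]
  [NormedAddCommGroup B] [NormedSpace ℝ B]

/-- Superposition operators were shown to be smooth for globally defined functions of compact
support, while the spray is defined usefully only over the chart. -/
theorem exists_compactSupport_eqOn {S : A → B} {U : Set A} {a : A} (hU : IsOpen U) (ha : a ∈ U)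
    (hS : ContDiffOn ℝ ∞ S U) :
    ∃ F : C(A, B), ContDiff ℝ ∞ F ∧ HasCompactSupport F ∧
      ∃ η > 0, Metric.ball a η ⊆ U ∧ EqOn F S (Metric.ball a η) := by
  obtain ⟨δ, hδ, hδU⟩ := Metric.isOpen_iff.1 hU a ha
  -- The closed support, of radius `δ / 2`, lies inside the ball of radius `δ` in `U`; on the ball
  -- of radius `δ / 4` the function is `1`.
  let χ : ContDiffBump a := ⟨δ / 4, δ / 2, by positivity, by linarith⟩
  have hsub : tsupport χ ⊆ U := by
    rw [χ.tsupport_eq]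
    exact (Metric.closedBall_subset_ball (half_lt_self hδ)).trans hδU
  have hF : ContDiff ℝ ∞ (fun x => χ x • S x) := by
    refine contDiff_iff_contDiffAt.2 fun x => ?_
    by_cases hx : x ∈ tsupport χ
    · exact χ.contDiff.contDiffAt.smul (hS.contDiffAt (hU.mem_nhds (hsub hx)))
    · refine contDiffAt_const (c := (0 : B)) |>.congr_of_eventuallyEq ?_
      filter_upwards [notMem_tsupport_iff_eventuallyEq.1 hx] with y hy
      simp [hy]
  refine ⟨⟨fun x => χ x • S x, hF.continuous⟩, hF, χ.hasCompactSupport.smul_right, δ / 4,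
    by positivity, (Metric.ball_subset_ball (by linarith)).trans hδU, fun x hx => ?_⟩
  change χ x • S x = S x
  rw [χ.one_of_mem_closedBall (Metric.ball_subset_closedBall hx), one_smul]

end Cutoff

/-! ### The exponential map near the origin -/

section ExpMap

/-- The spray vanishes at all zero velocities, so position directions contribute nothing; it is
quadratic in the velocity, so velocity directions contribute nothing either. -/
theorem fderiv_spray_zero {E : Type*} [NormedAddCommGroup E] [NormedSpace ℝ E]
    {g : E → E →L[ℝ] E →L[ℝ] ℝ} {y : E} (h : DifferentiableAt ℝ (spray g) (y, 0)) :
    fderiv ℝ (spray g) (y, 0) = 0 := by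
  have h0 : ∀ y, spray g (y, 0) = 0 := fun y => by
    simpa using spray_smul g y 0 0
  have h1 : ∀ a, fderiv ℝ (spray g) (y, 0) (a, 0) = 0 := fun a => by
    have := (h.hasFDerivAt.hasLineDerivAt (a, 0)).lineDeriv
    rw [← this]
    simp [lineDeriv, h0]
  have h2 : ∀ b, fderiv ℝ (spray g) (y, 0) (0, b) = 0 := fun b => by
    have := (h.hasFDerivAt.hasLineDerivAt (0, b)).lineDeriv
    rw [← this]
    have e : (fun t : ℝ => spray g ((y, 0) + t • ((0 : E), b))) = fun t => t ^ 2 • spray g (y, b) :=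
      funext fun t => by simp [← spray_smul]
    have hd : HasDerivAt (fun t : ℝ => t ^ 2 • spray g (y, b)) 0 0 := by
      simpa using (hasDerivAt_pow 2 (0 : ℝ)).smul_const (spray g (y, b))
    rw [lineDeriv, e, hd.deriv]
  refine ContinuousLinearMap.ext fun p => ?_
  rw [show p = (p.1, 0) + (0, p.2) by simp, map_add, h1, h2]
  simp

variable {n : ℕ} {M : Type*} [TopologicalSpace M] [ChartedSpace (EuclideanSpace ℝ (Fin n)) M]
  [IsManifold (𝓡 n) ∞ M]

/-- The tangent space at `p` is the model space by way of the chart at `p`, so in this chart the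
differential of the inverse chart is the identity. -/
theorem pushforward_extChartAt_symm (p : M) (v : TangentSpace (𝓡 n) p) :
    pushforward n (extChartAt (𝓡 n) p).symm (extChartAt (𝓡 n) p p)
      (v : EuclideanSpace ℝ (Fin n)) = ⟨p, v⟩ := by
  have h := mfderivWithin_range_extChartAt_symm (I := 𝓡 n) (x := p)
  rw [ModelWithCorners.Boundaryless.range_eq_univ, mfderivWithin_univ] at h
  unfold pushforward
  rw [h]
  exact Bundle.TotalSpace.ext (extChartAt_to_inv p) HEq.rfl

variable [RiemannianBundle (fun x : M => TangentSpace (𝓡 n) x)]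
  [IsContMDiffRiemannianBundle (𝓡 n) ∞ (EuclideanSpace ℝ (Fin n))
    (fun x : M => TangentSpace (𝓡 n) x)] [T2Space M]

/-- The exponential map in the chart at its center, for small initial velocities. -/
theorem exists_expMap_eq (p : M) :
    ∃ (W : Set (EuclideanSpace ℝ (Fin n)))
      (e : EuclideanSpace ℝ (Fin n) → EuclideanSpace ℝ (Fin n)),
      IsOpen W ∧ 0 ∈ W ∧ ContDiffOn ℝ ∞ e W ∧ e 0 = extChartAt (𝓡 n) p p ∧
      HasFDerivAt e (ContinuousLinearMap.id ℝ (EuclideanSpace ℝ (Fin n))) 0 ∧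
      ∀ v ∈ W, e v ∈ (extChartAt (𝓡 n) p).target ∧
        (v : TangentSpace (𝓡 n) p) ∈ expDomain (n := n) p ∧
        expMap (n := n) p (v : TangentSpace (𝓡 n) p) = (extChartAt (𝓡 n) p).symm (e v) := by
  set y₀ := extChartAt (𝓡 n) p p
  have hT := isOpen_extChartAt_target (I := 𝓡 n) p
  have hS : ContDiffOn ℝ ∞ (spray (chartMetric (n := n) p))
      ((extChartAt (𝓡 n) p).target ×ˢ univ) := fun q hq =>
    (contDiffAt_spray ((contDiffOn_chartMetric p).contDiffAt (hT.mem_nhds hq.1))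
      (isInvertible_chartMetric hq.1) q.2).contDiffWithinAt
  have hm : (y₀, 0) ∈ (extChartAt (𝓡 n) p).target ×ˢ (univ : Set (EuclideanSpace ℝ (Fin n))) :=
    ⟨mem_extChartAt_target p, mem_univ _⟩
  obtain ⟨F, hF, hFc, η, hη, hηU, hFS⟩ :=
    exists_compactSupport_eqOn (hT.prod isOpen_univ) hm hS
  have hF0 : F (y₀, 0) = 0 := by
    rw [hFS (Metric.mem_ball_self hη)]
    simpa using spray_smul (chartMetric (n := n) p) y₀ 0 0
  have hF1 : fderiv ℝ F (y₀, 0) = 0 := by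
    rw [(hFS.eventuallyEq_of_mem (Metric.ball_mem_nhds _ hη)).fderiv_eq]
    exact fderiv_spray_zero ((hS.contDiffAt ((hT.prod isOpen_univ).mem_nhds hm)).differentiableAt
      (by simp))
  obtain ⟨W, z, hW, h0W, hz0, hz, hz', hsol⟩ := exists_acceleration F hF hFc hF0 hF1
  have hPc : ContinuousOn (fun v => phaseL _ (v, z v)) W :=
    (phaseL _).continuous.comp_continuousOn (continuousOn_id.prodMk hz.continuousOn)
  have h1 : (1 : ℝ) ∈ timeInterval := by constructor <;> norm_num
  have hI : Icc (0 : ℝ) 1 ⊆ timeInterval := Icc_subset_Icc (by norm_num) (by norm_num)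
  let L : EuclideanSpace ℝ (Fin n) × C(timeInterval, EuclideanSpace ℝ (Fin n)) →L[ℝ]
      EuclideanSpace ℝ (Fin n) :=
    (ContinuousLinearMap.fst ℝ _ _).comp ((ContinuousMap.evalCLM ℝ ⟨1, h1⟩).comp (phaseL _))
  have hL : ∀ q, curveOf y₀ q 1 = y₀ + L q := fun q =>
    congrArg Prod.fst (curveOf_phase y₀ q h1)
  have he : (fun v => curveOf y₀ (v, z v) 1) = fun v => y₀ + L (v, z v) := funext fun v => hL _
  -- The initial velocities are restricted so that the phase curve stays in the ball on which the
  -- cut-off field equals the spray; there the solution is a genuine geodesic inside the chart.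
  refine ⟨W ∩ (fun v => phaseL _ (v, z v)) ⁻¹' Metric.ball 0 η,
    fun v => curveOf y₀ (v, z v) 1, hPc.isOpen_inter_preimage hW Metric.isOpen_ball,
    ⟨h0W, ?_⟩, ?_, ?_, ?_, fun v hv => ?_⟩
  · rw [mem_preimage, hz0, show ((0 : EuclideanSpace ℝ (Fin n)),
      (0 : C(timeInterval, EuclideanSpace ℝ (Fin n)))) = 0 from rfl, map_zero]
    exact Metric.mem_ball_self hη
  · rw [he]
    exact contDiffOn_const.add (L.contDiff.comp_contDiffOn
      (contDiffOn_id.prodMk (hz.mono inter_subset_left)))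
  · change curveOf y₀ (0, z 0) 1 = y₀
    rw [hL, hz0, Prod.mk_zero_zero, map_zero, add_zero]
  · rw [he]
    refine ((L.hasFDerivAt.comp (0 : EuclideanSpace ℝ (Fin n))
      ((hasFDerivAt_id _).prodMk hz')).const_add y₀).congr_fderiv
        (ContinuousLinearMap.ext fun v => ?_)
    -- As `z` has zero derivative at `0`, the derivative of the time-one map is `v ↦ L (v, 0)`, the
    -- displacement in unit time with constant velocity `v`.
    have h := hL (v, 0)
    have h' : curveOf y₀ (v, 0) 1 = y₀ + v := by simp [curveOf, extendTime, IccExtend]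
    exact (add_left_cancel (h'.symm.trans h)).symm
  · have hph : ∀ t ∈ timeInterval, (curveOf y₀ (v, z v) t, deriv (curveOf y₀ (v, z v)) t) ∈
        Metric.ball (y₀, (0 : EuclideanSpace ℝ (Fin n))) η := fun t ht => by
      rw [curveOf_phase y₀ _ ht, mem_ball_iff_norm, add_sub_cancel_left]
      exact ((phaseL _ (v, z v)).norm_coe_le_norm _).trans_lt (mem_ball_zero_iff.1 hv.2)
    have hmem : ∀ t ∈ timeInterval, curveOf y₀ (v, z v) t ∈ (extChartAt (𝓡 n) p).target :=
      fun t ht => (hηU (hph t ht)).1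
    have hacc : ∀ t ∈ timeInterval, deriv (deriv (curveOf y₀ (v, z v))) t =
        spray (chartMetric (n := n) p)
          (curveOf y₀ (v, z v) t, deriv (curveOf y₀ (v, z v)) t) := fun t ht => by
      rw [← hFS (hph t ht), deriv_deriv_curveOf, extendTime_apply _ ht, curveOf_phase y₀ _ ht]
      exact congrArg (fun f => f ⟨t, ht⟩) (hsol v hv.1)
    have hsm : ∀ t ∈ timeInterval, ContMDiffAt 𝓘(ℝ, EuclideanSpace ℝ (Fin n)) (𝓡 n) ∞
        (extChartAt (𝓡 n) p).symm (curveOf y₀ (v, z v) t) := fun t ht =>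
      (contMDiffOn_extChartAt_symm p).contMDiffAt (hT.mem_nhds (hmem t ht))
    have hgeo : IsGeodesicSegment n ((extChartAt (𝓡 n) p).symm ∘ curveOf y₀ (v, z v)) :=
      fun t ht => isGeodesicAt_comp ((hsm t (hI ht)).of_le ENat.LEInfty.out)
        (contDiff_curveOf _ _).contDiffAt
        (by simpa [mfderivWithin_univ] using
          (isInvertible_mfderivWithin_extChartAt_symm (I := 𝓡 n) (hmem t (hI ht))).surjective)
        ((covAccel_eq_zero_iff (differentiableAt_chartMetric (hmem t (hI ht)))
          (isInvertible_chartMetric (hmem t (hI ht)))).2 (hacc t (hI ht)))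
    have h0 : (0 : ℝ) ∈ timeInterval := hI (left_mem_Icc.2 zero_le_one)
    have hvel : velocity n ((extChartAt (𝓡 n) p).symm ∘ curveOf y₀ (v, z v)) 0 = ⟨p, v⟩ := by
      rw [velocity_comp ((hsm 0 h0).mdifferentiableAt (by simp))
        ((contDiff_curveOf _ _).differentiable two_ne_zero _), deriv_curveOf_zero, curveOf_zero]
      exact pushforward_extChartAt_symm p v
    exact ⟨hmem 1 h1, ⟨_, hgeo, hvel⟩, hgeo.expMap_eq hvel⟩

end ExpMap

/-! ### Existence of normal balls -/

section NormalBall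

/-- The differential of `f` at `0` is a composite of three isomorphisms. The equivalence `I`
reconciles the Riemannian norm of the tangent space with the standard norm of the coordinate space.
-/
theorem isLocalDiffeomorphAt_of_chart {n : ℕ} {M : Type*} [TopologicalSpace M]
    [ChartedSpace (EuclideanSpace ℝ (Fin n)) M] [IsManifold (𝓡 n) ∞ M]
    {V : Type*} [NormedAddCommGroup V] [NormedSpace ℝ V]
    (I : V ≃L[ℝ] EuclideanSpace ℝ (Fin n)) {f : V → M} {p : M} {W : Set (EuclideanSpace ℝ (Fin n))}
    {e : EuclideanSpace ℝ (Fin n) → EuclideanSpace ℝ (Fin n)} (hW : IsOpen W) (h0 : 0 ∈ W)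
    (he : ContDiffOn ℝ ∞ e W) (D : EuclideanSpace ℝ (Fin n) ≃L[ℝ] EuclideanSpace ℝ (Fin n))
    (he' : HasFDerivAt e (D : EuclideanSpace ℝ (Fin n) →L[ℝ] EuclideanSpace ℝ (Fin n)) 0)
    (hT : ∀ v ∈ W, e v ∈ (extChartAt (𝓡 n) p).target)
    (h : ∀ v, I v ∈ W → f v = (extChartAt (𝓡 n) p).symm (e (I v))) :
    IsLocalDiffeomorphAt 𝓘(ℝ, V) (𝓡 n) ∞ f 0 := by
  have hWo : IsOpen (I ⁻¹' W) := hW.preimage I.continuous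
  have h0' : (0 : V) ∈ I ⁻¹' W := by rwa [mem_preimage, map_zero]
  have heI : ContDiffOn ℝ ∞ (e ∘ I) (I ⁻¹' W) := he.comp I.contDiff.contDiffOn fun v hv => hv
  have hsm : ContMDiffOn 𝓘(ℝ, V) (𝓡 n) ∞ ((extChartAt (𝓡 n) p).symm ∘ (e ∘ I)) (I ⁻¹' W) :=
    (contMDiffOn_extChartAt_symm p).comp heI.contMDiffOn fun v hv => hT _ hv
  have hexp : ContMDiffOn 𝓘(ℝ, V) (𝓡 n) ∞ f (I ⁻¹' W) := hsm.congr fun v hv => h _ hv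
  have := I.symm.finiteDimensional
  have hn : Module.finrank ℝ V = n := by
    rw [I.toLinearEquiv.finrank_eq, finrank_euclideanSpace_fin]
  refine isLocalDiffeomorphAt_of_surjective hn hWo h0' hexp ?_
  have hev : f =ᶠ[𝓝 0] (extChartAt (𝓡 n) p).symm ∘ (e ∘ I) :=
    Filter.eventuallyEq_of_mem (hWo.mem_nhds h0') fun v hv => h _ hv
  have hd : HasFDerivAt (e ∘ I) ((D : EuclideanSpace ℝ (Fin n) →L[ℝ] EuclideanSpace ℝ (Fin n)).comp
      (I : V →L[ℝ] EuclideanSpace ℝ (Fin n))) 0 := by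
    rw [← map_zero I] at he'
    exact he'.comp 0 I.hasFDerivAt
  have hy : (e ∘ I) 0 ∈ (extChartAt (𝓡 n) p).target := hT _ h0'
  have hc : MDifferentiableAt 𝓘(ℝ, EuclideanSpace ℝ (Fin n)) (𝓡 n) (extChartAt (𝓡 n) p).symm
      ((e ∘ I) 0) :=
    ((contMDiffOn_extChartAt_symm (n := ∞) p).contMDiffAt
      ((isOpen_extChartAt_target p).mem_nhds hy)).mdifferentiableAt (by simp)
  rw [hev.mfderiv_eq, mfderiv_comp 0 hc hd.differentiableAt.mdifferentiableAt, mfderiv_eq_fderiv,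
    hd.fderiv]
  have hs := (isInvertible_mfderivWithin_extChartAt_symm (I := 𝓡 n) hy).surjective
  rw [ModelWithCorners.Boundaryless.range_eq_univ, mfderivWithin_univ] at hs
  exact hs.comp (D.surjective.comp I.surjective)

theorem isLocalDiffeomorphAt_of_injective {n : ℕ} {M : Type*} [TopologicalSpace M]
    [ChartedSpace (EuclideanSpace ℝ (Fin n)) M] [IsManifold (𝓡 n) ∞ M]
    {V : Type*} [NormedAddCommGroup V] [NormedSpace ℝ V]
    (I : V ≃L[ℝ] EuclideanSpace ℝ (Fin n)) {f : V → M} {U : Set V} {a : V} (hU : IsOpen U)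
    (ha : a ∈ U) (hf : ContMDiffOn 𝓘(ℝ, V) (𝓡 n) ∞ f U)
    (hi : Function.Injective (mfderiv 𝓘(ℝ, V) (𝓡 n) f a)) :
    IsLocalDiffeomorphAt 𝓘(ℝ, V) (𝓡 n) ∞ f a := by
  have := I.symm.finiteDimensional
  have hn : Module.finrank ℝ V = n := by
    rw [I.toLinearEquiv.finrank_eq, finrank_euclideanSpace_fin]
  let D : V →L[ℝ] EuclideanSpace ℝ (Fin n) := mfderiv 𝓘(ℝ, V) (𝓡 n) f a
  have hs : Function.Surjective (D : V →ₗ[ℝ] EuclideanSpace ℝ (Fin n)) :=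
    (LinearMap.injective_iff_surjective_of_finrank_eq_finrank
      (hn.trans finrank_euclideanSpace_fin.symm)).1 hi
  exact isLocalDiffeomorphAt_of_surjective hn hU ha hf hs

variable {n : ℕ} {M : Type*} [TopologicalSpace M] [ChartedSpace (EuclideanSpace ℝ (Fin n)) M]
  [IsManifold (𝓡 n) ∞ M] [RiemannianBundle (fun x : M => TangentSpace (𝓡 n) x)]

/-- The tangent space with its Riemannian norm, as a coordinate space. -/
def tangentCoord (p : M) : TangentSpace (𝓡 n) p ≃L[ℝ] EuclideanSpace ℝ (Fin n) :=
  ContinuousLinearEquiv.refl ℝ (EuclideanSpace ℝ (Fin n))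

variable [IsContMDiffRiemannianBundle (𝓡 n) ∞ (EuclideanSpace ℝ (Fin n))
    (fun x : M => TangentSpace (𝓡 n) x)] [T2Space M]

theorem exists_expMap (p : M) :
    ∃ W : Set (TangentSpace (𝓡 n) p), IsOpen W ∧ 0 ∈ W ∧ W ⊆ expDomain (n := n) p ∧
      IsLocalDiffeomorphAt 𝓘(ℝ, TangentSpace (𝓡 n) p) (𝓡 n) ∞ (expMap (n := n) p) 0 := by
  obtain ⟨W, e, hW, h0, he, -, he', h⟩ := exists_expMap_eq (n := n) p
  refine ⟨tangentCoord (n := n) p ⁻¹' W, hW.preimage (tangentCoord p).continuous, ?_,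
    fun v hv => (h _ hv).2.1, ?_⟩
  · rwa [mem_preimage, map_zero]
  · have hT : ∀ v ∈ W, e v ∈ (extChartAt (𝓡 n) p).target := fun v hv => (h v hv).1
    have hexp : ∀ v, tangentCoord (n := n) p v ∈ W →
      expMap (n := n) p v = (extChartAt (𝓡 n) p).symm (e (tangentCoord (n := n) p v)) :=
      fun v hv => (h _ hv).2.2
    exact isLocalDiffeomorphAt_of_chart (tangentCoord p) hW h0 he
      (ContinuousLinearEquiv.refl ℝ _) he' hT hexp

variable (n) in
-- Any ball about the origin works which lies both in the domain of the exponential map and in the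
-- source of the partial diffeomorphism given by the inverse function theorem.
theorem exists_isNormalBall (p : M) :
    ∃ ε : ENNReal, IsNormalBall n p ε ∧ geodesicBall n p ε ∈ 𝓝 p := by
  obtain ⟨W, hW, h0, hdom, Φ, h0Φ, hΦ⟩ := exists_expMap (n := n) p
  obtain ⟨δ, hδ, hδs⟩ := Metric.isOpen_iff.1 (hW.inter Φ.open_source) 0 ⟨h0, h0Φ⟩
  have hsub : tangentBall p (ENNReal.ofReal δ) ⊆ W ∩ Φ.source := fun v hv =>
    hδs (mem_ball_zero_iff.2 ((ENNReal.ofReal_lt_ofReal_iff hδ).1 (by rwa [ofReal_norm])))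
  have hN : IsNormalBall n p (ENNReal.ofReal δ) :=
    { pos := ENNReal.ofReal_pos.2 hδ
      subset_expDomain := fun v hv => hdom (hsub hv).1
      injOn := fun v hv w hw h => Φ.injOn (hsub hv).2 (hsub hw).2 (by
        rwa [hΦ (hsub hv).2, hΦ (hsub hw).2] at h)
      isLocalDiffeomorphOn := fun v => ⟨Φ, (hsub v.2).2, hΦ⟩ }
  refine ⟨_, hN, ?_⟩
  have hz := congrArg Bundle.TotalSpace.proj (hN.pushforward_zero hN.zero_mem)
  have hp : expMap (n := n) p 0 = p := hz
  -- A local homeomorphism is open at `0`, and `exp_p 0 = p`.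
  have hmap := ((hN.isLocalDiffeomorphOn.isLocalHomeomorphOn).map_nhds_eq hN.zero_mem)
  rw [hp] at hmap
  rw [← hmap]
  exact Filter.image_mem_map ((isOpen_tangentBall p _).mem_nhds hN.zero_mem)

end NormalBall

/-! ### Maps into an immersed manifold -/

section Immersion

variable {n : ℕ} {M : Type*} [TopologicalSpace M] [ChartedSpace (EuclideanSpace ℝ (Fin n)) M]
  {F : Type*} [NormedAddCommGroup F] [NormedSpace ℝ F]

section Smooth

variable [IsManifold (𝓡 n) ∞ M]

theorem contDiffAt_comp_extChartAt_symm {ι : M → F} (hι : ContMDiff (𝓡 n) 𝓘(ℝ, F) ∞ ι) {x₀ : M}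
    {y : EuclideanSpace ℝ (Fin n)} (hy : y ∈ (extChartAt (𝓡 n) x₀).target) :
    ContDiffAt ℝ ∞ (ι ∘ (extChartAt (𝓡 n) x₀).symm) y :=
  ((hι _).comp y ((contMDiffOn_extChartAt_symm (n := ∞) x₀).contMDiffAt
    ((isOpen_extChartAt_target x₀).mem_nhds hy))).contDiffAt

theorem fderiv_comp_extChartAt_symm_injective {ι : M → F} (hι : ContMDiff (𝓡 n) 𝓘(ℝ, F) ∞ ι)
    {x₀ : M} {y : EuclideanSpace ℝ (Fin n)} (hy : y ∈ (extChartAt (𝓡 n) x₀).target)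
    (hinj : Function.Injective (mfderiv (𝓡 n) 𝓘(ℝ, F) ι ((extChartAt (𝓡 n) x₀).symm y))) :
    Function.Injective (fderiv ℝ (ι ∘ (extChartAt (𝓡 n) x₀).symm) y) := by
  rw [← mfderiv_eq_fderiv, mfderiv_comp y ((hι _).mdifferentiableAt (by simp))
    (mdifferentiableAt_extChartAt_symm hy)]
  exact hinj.comp (mfderiv_extChartAt_symm_injective hy)

/-- A continuous map into an immersed manifold is smooth if it is smooth as a map into the ambient
space. -/
theorem contMDiffAt_of_comp_immersion [FiniteDimensional ℝ F] {V : Type*} [NormedAddCommGroup V]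
    [NormedSpace ℝ V] {ι : M → F} (hι : ContMDiff (𝓡 n) 𝓘(ℝ, F) ∞ ι) {f : V → M} {a : V}
    (hinj : Function.Injective (mfderiv (𝓡 n) 𝓘(ℝ, F) ι (f a))) (hc : ContinuousAt f a)
    (hf : ContDiffAt ℝ ∞ (ι ∘ f) a) : ContMDiffAt 𝓘(ℝ, V) (𝓡 n) ∞ f a := by
  have hT := isOpen_extChartAt_target (I := 𝓡 n) (f a)
  have hy := mem_extChartAt_target (I := 𝓡 n) (f a)
  have hD := fderiv_comp_extChartAt_symm_injective hι hy (by rwa [extChartAt_to_inv])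
  -- A linear left inverse of the differential of `ι` in the chart. Composing `ι` with it gives a
  -- local diffeomorphism `Φ` in coordinates, so near `a` the map `f` is the inverse chart after
  -- `Φ⁻¹ ∘ P ∘ ι ∘ f`.
  obtain ⟨l, hl⟩ := LinearMap.exists_leftInverse_of_injective
    (fderiv ℝ (ι ∘ (extChartAt (𝓡 n) (f a)).symm) (extChartAt (𝓡 n) (f a) (f a)) :
      EuclideanSpace ℝ (Fin n) →ₗ[ℝ] F) (LinearMap.ker_eq_bot.2 hD)
  let P : F →L[ℝ] EuclideanSpace ℝ (Fin n) := LinearMap.toContinuousLinearMap l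
  have hG : ContDiffOn ℝ ∞ (P ∘ (ι ∘ (extChartAt (𝓡 n) (f a)).symm))
      (extChartAt (𝓡 n) (f a)).target := fun y hy =>
    (P.contDiff.contDiffAt.comp y (contDiffAt_comp_extChartAt_symm hι hy)).contDiffWithinAt
  have hd : HasFDerivAt (P ∘ (ι ∘ (extChartAt (𝓡 n) (f a)).symm))
      ((ContinuousLinearEquiv.refl ℝ (EuclideanSpace ℝ (Fin n)) :
        EuclideanSpace ℝ (Fin n) →L[ℝ] EuclideanSpace ℝ (Fin n)))
      (extChartAt (𝓡 n) (f a) (f a)) := by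
    refine (P.hasFDerivAt.comp _ ((contDiffAt_comp_extChartAt_symm hι hy).differentiableAt
      (by simp)).hasFDerivAt).congr_fderiv (ContinuousLinearMap.ext fun w => ?_)
    exact congrArg (fun L => L w) hl
  obtain ⟨Φ, haΦ, hΦT, hΦ, hΦs⟩ := exists_localInverse hT hy hG hd
  have h1 : ∀ᶠ x in 𝓝 a, f x ∈ (extChartAt (𝓡 n) (f a)).source :=
    hc.eventually_mem (extChartAt_source_mem_nhds _)
  have h2 : ∀ᶠ x in 𝓝 a, extChartAt (𝓡 n) (f a) (f x) ∈ Φ.source :=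
    ((continuousAt_extChartAt (f a)).comp hc).eventually_mem (Φ.open_source.mem_nhds haΦ)
  have h3 : ∀ x, f x ∈ (extChartAt (𝓡 n) (f a)).source →
      extChartAt (𝓡 n) (f a) (f x) ∈ Φ.source →
      P (ι (f x)) = Φ (extChartAt (𝓡 n) (f a) (f x)) := fun x hx _ => by
    rw [hΦ]
    simp only [Function.comp_apply, (extChartAt (𝓡 n) (f a)).left_inv hx]
  have h4 : f =ᶠ[𝓝 a] (extChartAt (𝓡 n) (f a)).symm ∘ (Φ.symm ∘ (P ∘ (ι ∘ f))) := by
    filter_upwards [h1, h2] with x hx hx'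
    simp only [Function.comp_apply]
    rw [h3 x hx hx', Φ.left_inv hx', (extChartAt (𝓡 n) (f a)).left_inv hx]
  have ha : P (ι (f a)) ∈ Φ.target := by
    rw [h3 a (mem_extChartAt_source _) haΦ]
    exact Φ.map_source haΦ
  have h5 : ContDiffAt ℝ ∞ (Φ.symm ∘ (P ∘ (ι ∘ f))) a :=
    ContDiffAt.comp (g := Φ.symm) (f := P ∘ (ι ∘ f)) a
      (hΦs.contDiffAt (Φ.open_target.mem_nhds ha)) (P.contDiff.contDiffAt.comp a hf)
  have h6 : (Φ.symm ∘ (P ∘ (ι ∘ f))) a = extChartAt (𝓡 n) (f a) (f a) := by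
    simp only [Function.comp_apply]
    rw [h3 a (mem_extChartAt_source _) haΦ, Φ.left_inv haΦ]
  refine ContMDiffAt.congr_of_eventuallyEq ?_ h4
  refine ContMDiffAt.comp a ?_ h5.contMDiffAt
  rw [h6]
  exact (contMDiffOn_extChartAt_symm (n := ∞) (f a)).contMDiffAt (hT.mem_nhds hy)

end Smooth

/-! ### Quadrics in a vector space with a bilinear form -/

variable [RiemannianBundle (fun x : M => TangentSpace (𝓡 n) x)]

/-- The differential of a map from a manifold to a vector space. -/
def differential (n : ℕ) {M : Type*} [TopologicalSpace M]
    [ChartedSpace (EuclideanSpace ℝ (Fin n)) M]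
    [RiemannianBundle (fun x : M => TangentSpace (𝓡 n) x)] {F : Type*} [NormedAddCommGroup F]
    [NormedSpace ℝ F] (ι : M → F) (q : M) : TangentSpace (𝓡 n) q →L[ℝ] F :=
  mfderiv (𝓡 n) 𝓘(ℝ, F) ι q

/-- The Riemannian metric of `M` is induced by the map `ι` to a vector space with the symmetric
bilinear form `B`, and `ι` maps `M` to the quadric `B x x = κ⁻¹`. -/
structure IsQuadricModel (n : ℕ) {M : Type*} [TopologicalSpace M]
    [ChartedSpace (EuclideanSpace ℝ (Fin n)) M]
    [RiemannianBundle (fun x : M => TangentSpace (𝓡 n) x)] {F : Type*} [NormedAddCommGroup F]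
    [NormedSpace ℝ F] (B : F →L[ℝ] F →L[ℝ] ℝ) (κ : ℝ) (ι : M → F) : Prop where
  symm : ∀ x y, B x y = B y x
  ne_zero : κ ≠ 0
  finrank_eq : Module.finrank ℝ F = n + 1
  contMDiff : ContMDiff (𝓡 n) 𝓘(ℝ, F) ∞ ι
  isEmbedding : Topology.IsEmbedding ι
  inner_eq : ∀ (q : M) (v w : TangentSpace (𝓡 n) q),
    inner ℝ v w = B (differential n ι q v) (differential n ι q w)
  form_self : ∀ q, B (ι q) (ι q) = κ⁻¹

variable {B : F →L[ℝ] F →L[ℝ] ℝ} {κ : ℝ} {ι : M → F}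

namespace IsQuadricModel

/-- `B` itself may be indefinite, but its pull-back is the positive definite Riemannian inner
product. -/
theorem differential_injective (h : IsQuadricModel n B κ ι) (q : M) :
    Function.Injective (differential n ι q) := by
  rw [injective_iff_map_eq_zero]
  intro v hv
  rw [← inner_self_eq_zero (𝕜 := ℝ), h.inner_eq, hv, map_zero]

theorem pullbackMetric_eq (h : IsQuadricModel n B κ ι) {V : Type*} [NormedAddCommGroup V]
    [NormedSpace ℝ V] {f : V → M} {y : V} (hf : MDifferentiableAt 𝓘(ℝ, V) (𝓡 n) f y) :
    pullbackMetric n f y = pullbackForm (ι ∘ f) (fun _ => B) y := by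
  refine ContinuousLinearMap.ext fun u => ContinuousLinearMap.ext fun v => ?_
  rw [pullbackMetric_apply, pullbackForm_apply, h.inner_eq, ← mfderiv_eq_fderiv,
    mfderiv_comp y ((h.contMDiff _).mdifferentiableAt (by simp)) hf]
  rfl

/-- Position vectors are orthogonal to the quadric. -/
theorem form_differential (h : IsQuadricModel n B κ ι) (q : M) (w : TangentSpace (𝓡 n) q) :
    B (ι q) (differential n ι q w) = 0 := by
  have hd : HasMFDerivAt (𝓡 n) 𝓘(ℝ, F) ι q (mfderiv (𝓡 n) 𝓘(ℝ, F) ι q) :=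
    ((h.contMDiff q).mdifferentiableAt (by simp)).hasMFDerivAt
  have hB : HasFDerivAt (fun x => B x x) (B (ι q) + B.flip (ι q)) (ι q) := by
    refine (B.hasFDerivAt.clm_apply (hasFDerivAt_id (ι q))).congr_fderiv
      (ContinuousLinearMap.ext fun x => ?_)
    simp
  have hc := hB.hasMFDerivAt.comp q hd
  have e : (fun x => B x x) ∘ ι = fun _ => κ⁻¹ := funext fun q => h.form_self q
  rw [e] at hc
  have e' := congrArg (fun L => L w)
    (hasMFDerivAt_unique hc (hasMFDerivAt_const (I' := 𝓘(ℝ, ℝ)) κ⁻¹ q))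
  have e'' : B (ι q) (differential n ι q w) + B (differential n ι q w) (ι q) = 0 := e'
  rw [h.symm _ (ι q)] at e''
  linarith

theorem velocity_eq (h : IsQuadricModel n B κ ι) {β : ℝ → M} {t : ℝ} {q : M}
    {w : TangentSpace (𝓡 n) q} (hβ : MDifferentiableAt 𝓘(ℝ, ℝ) (𝓡 n) β t) (hq : β t = q)
    (hw : deriv (ι ∘ β) t = differential n ι q w) : velocity n β t = ⟨q, w⟩ := by
  subst hq
  unfold velocity
  congr 1
  refine h.differential_injective _ (Eq.trans ?_ hw)
  rw [← fderiv_apply_one_eq_deriv, ← mfderiv_eq_fderiv,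
    mfderiv_comp t ((h.contMDiff _).mdifferentiableAt (by simp)) hβ]
  rfl

variable [IsManifold (𝓡 n) ∞ M]

/-- A constant form has no Christoffel terms, so naturality of the covariant acceleration reduces
the geodesic equation to orthogonality of the ambient acceleration to the tangent space. -/
theorem isGeodesicAt (h : IsQuadricModel n B κ ι) {β : ℝ → M} {t : ℝ}
    (hβ : ContMDiffAt 𝓘(ℝ, ℝ) (𝓡 n) 2 β t)
    (hacc : ∀ w, B (deriv (deriv (ι ∘ β)) t) (differential n ι (β t) w) = 0) :
    IsGeodesicAt (n := n) β t := by
  rw [isGeodesicAt_iff]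
  refine ⟨hβ, fun x₀ hx₀ w => ?_⟩
  have hT := isOpen_extChartAt_target (I := 𝓡 n) x₀
  have hy : extChartAt (𝓡 n) x₀ (β t) ∈ (extChartAt (𝓡 n) x₀).target :=
    (extChartAt (𝓡 n) x₀).map_source (by rwa [extChartAt_source])
  have hx := contDiffAt_extChartAt_comp ENat.LEInfty.out hβ hx₀
  have e1 : chartMetric x₀ =ᶠ[𝓝 (extChartAt (𝓡 n) x₀ (β t))]
      pullbackForm (ι ∘ (extChartAt (𝓡 n) x₀).symm) fun _ => B := by
    filter_upwards [hT.mem_nhds hy] with y hy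
    exact h.pullbackMetric_eq (mdifferentiableAt_extChartAt_symm hy)
  have e2 : (fun τ => (ι ∘ (extChartAt (𝓡 n) x₀).symm) ((extChartAt (𝓡 n) x₀ ∘ β) τ)) =ᶠ[𝓝 t]
      ι ∘ β := by
    filter_upwards [hβ.continuousAt.eventually_mem
      ((chartAt (EuclideanSpace ℝ (Fin n)) x₀).open_source.mem_nhds hx₀)] with τ hτ
    simp only [Function.comp_apply]
    rw [(extChartAt (𝓡 n) x₀).left_inv (by rwa [extChartAt_source])]
  rw [covAccel_congr e1]
  refine (covAccel_pullbackForm (x := extChartAt (𝓡 n) x₀ ∘ β)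
    ((contDiffAt_comp_extChartAt_symm h.contMDiff hy).of_le ENat.LEInfty.out) hx
    (differentiableAt_const B) h.symm w).trans ?_
  rw [covAccel_const, e2.deriv.deriv_eq, Function.comp_apply, ← mfderiv_eq_fderiv,
    mfderiv_comp _ ((h.contMDiff _).mdifferentiableAt (by simp))
      (mdifferentiableAt_extChartAt_symm hy)]
  have e3 : (extChartAt (𝓡 n) x₀).symm (extChartAt (𝓡 n) x₀ (β t)) = β t :=
    (extChartAt (𝓡 n) x₀).left_inv (by rwa [extChartAt_source])
  have key : ∀ q, q = β t → ∀ w : TangentSpace (𝓡 n) q,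
      B (deriv (deriv (ι ∘ β)) t) (differential n ι q w) = 0 := by
    rintro q rfl
    exact hacc
  exact key _ e3 _

end IsQuadricModel

end Immersion

/-! ### The exponential map of a quadric -/

section Quadric

/-- The functions `c` and `s` are the generalized cosine and sine of curvature `κ`. -/
structure IsTrigPair (κ : ℝ) (c s : ℝ → ℝ) : Prop where
  contDiff_cos : ContDiff ℝ ∞ c
  contDiff_sin : ContDiff ℝ ∞ s
  hasDerivAt_cos : ∀ x, HasDerivAt c (-(κ * s x)) x
  hasDerivAt_sin : ∀ x, HasDerivAt s (c x) x
  cos_zero : c 0 = 1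
  sin_zero : s 0 = 0

/-- The expression has zero derivative and the value `1` at `0`. -/
theorem IsTrigPair.sq_add_sq {κ : ℝ} {c s : ℝ → ℝ} (h : IsTrigPair κ c s) (x : ℝ) :
    c x ^ 2 + κ * s x ^ 2 = 1 := by
  have hd : ∀ x, HasDerivAt (fun x => c x ^ 2 + κ * s x ^ 2) 0 x := fun x => by
    refine (((h.hasDerivAt_cos x).pow 2).add (((h.hasDerivAt_sin x).pow 2).const_mul κ)).congr_deriv
      ?_
    push_cast
    ring
  have := is_const_of_deriv_eq_zero (fun x => (hd x).differentiableAt) (fun x => (hd x).deriv) x 0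
  simpa [h.cos_zero, h.sin_zero] using this

variable {n : ℕ} {M : Type*} [TopologicalSpace M] [ChartedSpace (EuclideanSpace ℝ (Fin n)) M]
  [RiemannianBundle (fun x : M => TangentSpace (𝓡 n) x)]
  {F : Type*} [NormedAddCommGroup F] [NormedSpace ℝ F]
  {B : F →L[ℝ] F →L[ℝ] ℝ} {κ : ℝ} {ι : M → F} {c s : ℝ → ℝ} {p : M}

/-- The geodesic of a quadric with initial point `p` and initial velocity `v`. -/
def quadricRay (ι : M → F) (c s : ℝ → ℝ) (p : M) (v : TangentSpace (𝓡 n) p) (t : ℝ) : F :=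
  c (t * ‖v‖) • ι p + (s (t * ‖v‖) / ‖v‖) • differential n ι p v

namespace IsQuadricModel

theorem norm_sq_eq (h : IsQuadricModel n B κ ι) (v : TangentSpace (𝓡 n) p) :
    B (differential n ι p v) (differential n ι p v) = ‖v‖ ^ 2 := by
  rw [← h.inner_eq, real_inner_self_eq_norm_sq]

theorem form_combination (h : IsQuadricModel n B κ ι) (a b : ℝ) (v : TangentSpace (𝓡 n) p) :
    B (a • ι p + b • differential n ι p v) (a • ι p + b • differential n ι p v) =
      a ^ 2 * κ⁻¹ + b ^ 2 * ‖v‖ ^ 2 := by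
  simp only [map_add, map_smul, add_apply, smul_apply, smul_eq_mul, h.form_self,
    h.symm (differential n ι p v) (ι p), h.form_differential, h.norm_sq_eq]
  ring

theorem form_combination_center (h : IsQuadricModel n B κ ι) (a b : ℝ)
    (v : TangentSpace (𝓡 n) p) : B (a • ι p + b • differential n ι p v) (ι p) = κ⁻¹ * a := by
  simp only [map_add, map_smul, add_apply, smul_apply, smul_eq_mul, h.form_self,
    h.symm (differential n ι p v) (ι p), h.form_differential]
  ring

/-- The position `ι p` is orthogonal to the tangent vector, so the claim is the identity `c² + κ s²
= 1`. -/
theorem form_quadricRay (h : IsQuadricModel n B κ ι) (hcs : IsTrigPair κ c s)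
    (v : TangentSpace (𝓡 n) p) (t : ℝ) :
    B (quadricRay ι c s p v t) (quadricRay ι c s p v t) = κ⁻¹ := by
  have hsq := hcs.sq_add_sq (t * ‖v‖)
  have hκ := h.ne_zero
  rw [quadricRay, h.form_combination]
  rcases eq_or_ne ‖v‖ 0 with hv | hv
  · simp [hv, hcs.cos_zero]
  · rw [div_pow, div_mul_cancel₀ _ (pow_ne_zero 2 hv)]
    field_simp
    linarith

theorem hasDerivAt_quadricRay (hcs : IsTrigPair κ c s) (v : TangentSpace (𝓡 n) p) (t : ℝ) :
    HasDerivAt (quadricRay ι c s p v)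
      ((-(κ * s (t * ‖v‖)) * ‖v‖) • ι p + c (t * ‖v‖) • differential n ι p v) t := by
  have hm : HasDerivAt (fun t : ℝ => t * ‖v‖) ‖v‖ t := hasDerivAt_mul_const _
  have h1 := ((hcs.hasDerivAt_cos (t * ‖v‖)).comp t hm).smul_const (ι p)
  have h2 := (((hcs.hasDerivAt_sin (t * ‖v‖)).comp t hm).div_const ‖v‖).smul_const
    (differential n ι p v)
  refine (h1.add h2).congr_deriv ?_
  -- For `v = 0` the quotient by `‖v‖` has the default value `0`, which is harmless because it
  -- multiplies the image of `v`.
  rcases eq_or_ne ‖v‖ 0 with hv | hv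
  · simp [norm_eq_zero.1 hv]
  · rw [mul_div_cancel_right₀ _ hv]

/-- The acceleration is a multiple of the position vector, hence normal to the quadric; this is why
these curves are geodesics. -/
theorem deriv_deriv_quadricRay (hcs : IsTrigPair κ c s) (v : TangentSpace (𝓡 n) p) (t : ℝ) :
    deriv (deriv (quadricRay ι c s p v)) t = (-(κ * ‖v‖ ^ 2)) • quadricRay ι c s p v t := by
  have e : deriv (quadricRay ι c s p v) = fun t =>
      (-(κ * s (t * ‖v‖)) * ‖v‖) • ι p + c (t * ‖v‖) • differential n ι p v :=
    funext fun t => (hasDerivAt_quadricRay hcs v t).deriv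
  have hm : HasDerivAt (fun t : ℝ => t * ‖v‖) ‖v‖ t := hasDerivAt_mul_const _
  have h1 := ((((hcs.hasDerivAt_sin (t * ‖v‖)).comp t hm).const_mul κ).neg.mul_const
    ‖v‖).smul_const (ι p)
  have h2 := ((hcs.hasDerivAt_cos (t * ‖v‖)).comp t hm).smul_const (differential n ι p v)
  rw [e]
  refine (h1.add h2).deriv.trans ?_
  rw [quadricRay, smul_add, smul_smul, smul_smul]
  rcases eq_or_ne ‖v‖ 0 with hv | hv
  · simp [norm_eq_zero.1 hv]
  · congr 2
    · ring
    · field_simp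

theorem contDiff_quadricRay (hcs : IsTrigPair κ c s) (v : TangentSpace (𝓡 n) p) :
    ContDiff ℝ ∞ (quadricRay ι c s p v) := by
  have hm : ContDiff ℝ ∞ (fun t : ℝ => t * ‖v‖) := contDiff_id.mul contDiff_const
  exact ((hcs.contDiff_cos.comp hm).smul contDiff_const).add
    (((hcs.contDiff_sin.comp hm).div_const _).smul contDiff_const)

variable [IsManifold (𝓡 n) ∞ M]
  [IsContMDiffRiemannianBundle (𝓡 n) ∞ (EuclideanSpace ℝ (Fin n))
    (fun x : M => TangentSpace (𝓡 n) x)] [T2Space M] [FiniteDimensional ℝ F]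

/-- Since `ι` is an embedding and an immersion, the explicit ambient curve lifts to a smooth curve
in `M`. Its acceleration is normal and its initial velocity is `v`, so uniqueness of geodesics
identifies its end point with `exp_p v`. -/
theorem mem_expDomain_and_expMap_eq (h : IsQuadricModel n B κ ι) (hcs : IsTrigPair κ c s)
    (hr : ∀ (v : TangentSpace (𝓡 n) p) (t : ℝ), quadricRay ι c s p v t ∈ range ι)
    (v : TangentSpace (𝓡 n) p) :
    v ∈ expDomain (n := n) p ∧ ι (expMap p v) = quadricRay ι c s p v 1 := by
  choose β hβ using hr v
  have e : ι ∘ β = quadricRay ι c s p v := funext hβ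
  have hc : Continuous β := by
    rw [h.isEmbedding.isInducing.continuous_iff, e]
    exact (contDiff_quadricRay hcs v).continuous
  have hs : ∀ t, ContMDiffAt 𝓘(ℝ, ℝ) (𝓡 n) ∞ β t := fun t =>
    contMDiffAt_of_comp_immersion h.contMDiff (h.differential_injective (β t)) hc.continuousAt
      (by rw [e]; exact (contDiff_quadricRay hcs v).contDiffAt)
  have hg : IsGeodesicSegment n β := fun t _ => by
    refine h.isGeodesicAt ((hs t).of_le ENat.LEInfty.out) fun w => ?_
    rw [e, deriv_deriv_quadricRay hcs, ← e, map_smul, smul_apply, Function.comp_apply,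
      h.form_differential, smul_zero]
  have h0 : β 0 = p := h.isEmbedding.injective (by
    rw [hβ]
    simp [quadricRay, hcs.cos_zero, hcs.sin_zero])
  have hv : velocity n β 0 = ⟨p, v⟩ := by
    refine h.velocity_eq ((hs 0).mdifferentiableAt (by simp)) h0 ?_
    rw [e, (hasDerivAt_quadricRay hcs v 0).deriv]
    simp [hcs.cos_zero, hcs.sin_zero]
  refine ⟨⟨β, hg, hv⟩, ?_⟩
  rw [hg.expMap_eq hv, hβ]

end IsQuadricModel

end Quadric

/-! ### Normal balls of quadrics -/

section QuadricBall

variable {n : ℕ} {M : Type*} [TopologicalSpace M] [ChartedSpace (EuclideanSpace ℝ (Fin n)) M]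
  [RiemannianBundle (fun x : M => TangentSpace (𝓡 n) x)]
  {F : Type*} [NormedAddCommGroup F] [NormedSpace ℝ F]
  {B : F →L[ℝ] F →L[ℝ] ℝ} {κ : ℝ} {ι : M → F} {c s : ℝ → ℝ} {p : M}

theorem quadricRay_one (v : TangentSpace (𝓡 n) p) :
    quadricRay ι c s p v 1 = c ‖v‖ • ι p + (s ‖v‖ / ‖v‖) • differential n ι p v := by
  rw [quadricRay, one_mul]

/-- The coefficient `k` is left unspecified because it multiplies the derivative of the norm, which
is shown to vanish wherever the formula is used. -/
theorem IsTrigPair.hasFDerivAt_quadricRay_one (hcs : IsTrigPair κ c s) {v : TangentSpace (𝓡 n) p}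
    (hv : v ≠ 0) : ∃ k : ℝ, HasFDerivAt (fun v => quadricRay ι c s p v 1)
      ((-(κ * s ‖v‖) • fderiv ℝ norm v).smulRight (ι p) +
        ((s ‖v‖ / ‖v‖) • differential n ι p +
          (k • fderiv ℝ norm v).smulRight (differential n ι p v))) v := by
  have hN : HasFDerivAt (norm : TangentSpace (𝓡 n) p → ℝ) (fderiv ℝ norm v) v :=
    ((contDiffAt_norm ℝ hv (n := 1)).differentiableAt one_ne_zero).hasFDerivAt
  have hv' : ‖v‖ ≠ 0 := norm_ne_zero_iff.2 hv
  have hc := (hcs.hasDerivAt_cos ‖v‖).comp_hasFDerivAt v hN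
  have hs := ((hcs.hasDerivAt_sin ‖v‖).div (hasDerivAt_id ‖v‖) hv').comp_hasFDerivAt v hN
  refine ⟨(c ‖v‖ * ‖v‖ - s ‖v‖ * 1) / ‖v‖ ^ 2, ?_⟩
  have := (hc.smul_const (ι p)).add (hs.smul (differential n ι p).hasFDerivAt)
  refine this.congr_of_eventuallyEq (Filter.Eventually.of_forall fun w => ?_)
  exact quadricRay_one w

theorem IsTrigPair.contDiffAt_quadricRay_one (hcs : IsTrigPair κ c s) {v : TangentSpace (𝓡 n) p}
    (hv : v ≠ 0) : ContDiffAt ℝ ∞ (fun v => quadricRay ι c s p v 1) v := by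
  simp only [quadricRay_one]
  have hN := contDiffAt_norm ℝ hv (n := ∞)
  exact ((hcs.contDiff_cos.contDiffAt.comp v hN).smul contDiffAt_const).add
    (((hcs.contDiff_sin.contDiffAt.comp v hN).div hN (norm_ne_zero_iff.2 hv)).smul
      (differential n ι p).contDiff.contDiffAt)

namespace IsQuadricModel

/-- The tangent space is contained in the `B`-orthogonal complement of `ι p`, and both have
dimension `n`; here `B (ι p) (ι p) ≠ 0` makes the complement a hyperplane. -/
theorem range_differential (h : IsQuadricModel n B κ ι) [FiniteDimensional ℝ F] {x : F}
    (hx : B x (ι p) = 0) : ∃ w, differential n ι p w = x := by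
  have hB : (B.flip (ι p) : F →ₗ[ℝ] ℝ) ≠ 0 := fun h0 =>
    inv_ne_zero h.ne_zero ((h.form_self p).symm.trans (congrArg (fun L => L (ι p)) h0))
  have h1 := Module.Dual.finrank_ker_add_one_of_ne_zero hB
  have h2 := LinearMap.finrank_range_of_inj (f := (differential n ι p : TangentSpace (𝓡 n) p →ₗ[ℝ] F))
    (h.differential_injective p)
  have h3 : Module.finrank ℝ (TangentSpace (𝓡 n) p) = n :=
    (tangentCoord (n := n) p).toLinearEquiv.finrank_eq.trans finrank_euclideanSpace_fin
  have h4 := Submodule.eq_of_le_of_finrank_eq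
    (S₁ := LinearMap.range (differential n ι p : TangentSpace (𝓡 n) p →ₗ[ℝ] F))
    (S₂ := LinearMap.ker (B.flip (ι p) : F →ₗ[ℝ] ℝ))
    (by
      rintro _ ⟨w, rfl⟩
      exact (h.symm _ _).trans (h.form_differential p w))
    (by
      rw [h.finrank_eq] at h1
      rw [h2, h3]
      omega)
  have h5 : x ∈ LinearMap.ker (B.flip (ι p) : F →ₗ[ℝ] ℝ) := hx
  rwa [← h4] at h5

/-- The product with `ι p` gives `c ‖v‖` and thus `‖v‖`. The tangential part is then `v` times a
known factor, nonzero unless `v = 0`. -/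
theorem quadricRay_injOn (h : IsQuadricModel n B κ ι) {ε : ENNReal}
    (hc : InjOn c {x | 0 ≤ x ∧ ENNReal.ofReal x < ε})
    (hs : ∀ x, 0 < x → ENNReal.ofReal x < ε → s x ≠ 0) :
    InjOn (fun v => quadricRay ι c s p v 1) (tangentBall (n := n) p ε) := by
  intro v hv w hw e
  have hv' := (mem_tangentBall_iff rfl).1 hv
  have hw' := (mem_tangentBall_iff rfl).1 hw
  simp only [quadricRay_one] at e
  have e1 := congrArg (fun x => B x (ι p)) e
  simp only [h.form_combination_center] at e1
  have e2 : ‖v‖ = ‖w‖ := hc ⟨norm_nonneg v, hv'⟩ ⟨norm_nonneg w, hw'⟩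
    (mul_left_cancel₀ (inv_ne_zero h.ne_zero) e1)
  rw [← e2] at e
  have e3 := add_left_cancel e
  rcases (norm_nonneg v).eq_or_lt with h0 | h0
  · rw [norm_eq_zero.1 h0.symm, norm_eq_zero.1 (e2.symm.trans h0.symm)]
  · exact h.differential_injective p
      (smul_right_injective F (div_ne_zero (hs _ h0 hv') h0.ne') e3)

/-- The vector `ι q - c x • ι p` is tangent at `p` and has length `|s x|`; rescaled by `x / s x` it
is the required initial velocity, of length `x`. -/
theorem exists_quadricRay_eq (h : IsQuadricModel n B κ ι) (hcs : IsTrigPair κ c s)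
    [FiniteDimensional ℝ F] {ε : ENNReal}
    (hs : ∀ x, 0 < x → ENNReal.ofReal x < ε → s x ≠ 0) {x : ℝ} (hx : 0 ≤ x)
    (hxε : ENNReal.ofReal x < ε) {q : M} (hq : B (ι q) (ι p) = κ⁻¹ * c x) :
    ∃ v ∈ tangentBall (n := n) p ε, quadricRay ι c s p v 1 = ι q := by
  obtain ⟨w, hw⟩ := h.range_differential (p := p) (x := ι q - c x • ι p) (by
    simp only [map_sub, map_smul, sub_apply, smul_apply, smul_eq_mul, h.form_self, hq]
    ring)
  have hn : ‖w‖ ^ 2 = s x ^ 2 := by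
    have hsq := hcs.sq_add_sq x
    have hκ := h.ne_zero
    rw [← h.norm_sq_eq, hw]
    simp only [map_sub, map_smul, sub_apply, smul_apply, smul_eq_mul, h.form_self, hq,
      h.symm (ι p) (ι q)]
    field_simp
    linarith
  rcases hx.eq_or_lt with rfl | hx0
  · have h0 : w = 0 := by
      rw [hcs.sin_zero] at hn
      exact norm_eq_zero.1 (by simpa using hn)
    refine ⟨0, (mem_tangentBall_iff norm_zero).2 hxε, ?_⟩
    rw [h0, map_zero, hcs.cos_zero, one_smul] at hw
    rw [quadricRay_one, norm_zero, hcs.cos_zero, one_smul, map_zero, smul_zero, add_zero]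
    exact (sub_eq_zero.1 hw.symm).symm
  · have hs0 := hs x hx0 hxε
    have hnv : ‖(x / s x) • w‖ = x := by
      have h1 : ‖w‖ = |s x| := by
        rw [← abs_norm w]
        exact (sq_eq_sq_iff_abs_eq_abs _ _).1 hn
      rw [norm_smul, h1, norm_div, Real.norm_eq_abs, Real.norm_eq_abs,
        div_mul_cancel₀ _ (abs_ne_zero.2 hs0), abs_of_pos hx0]
    refine ⟨(x / s x) • w, (mem_tangentBall_iff hnv).2 hxε, ?_⟩
    rw [quadricRay_one, hnv, map_smul, smul_smul, hw, div_mul_div_cancel₀ hx0.ne', div_self hs0,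
      one_smul, add_sub_cancel]

variable [IsManifold (𝓡 n) ∞ M] [FiniteDimensional ℝ F]

theorem contMDiffAt_expMap (h : IsQuadricModel n B κ ι) (hcs : IsTrigPair κ c s)
    (he : ∀ v : TangentSpace (𝓡 n) p, ι (expMap p v) = quadricRay ι c s p v 1)
    {v : TangentSpace (𝓡 n) p} (hv : v ≠ 0) :
    ContMDiffAt 𝓘(ℝ, TangentSpace (𝓡 n) p) (𝓡 n) ∞ (expMap (n := n) p) v := by
  have e : ι ∘ expMap p = fun v => quadricRay ι c s p v 1 := funext he
  refine contMDiffAt_of_comp_immersion h.contMDiff (h.differential_injective _) ?_ ?_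
  · rw [h.isEmbedding.isInducing.continuousAt_iff, e]
    exact (hcs.contDiffAt_quadricRay_one hv).continuousAt
  · rw [e]
    exact hcs.contDiffAt_quadricRay_one hv

/-- If the differential kills `w`, the component along `ι p` shows that the derivative of the norm
vanishes on `w`. The tangential component then reduces to `(s ‖v‖ / ‖v‖) • w`, so `w = 0`. -/
theorem mfderiv_expMap_injective (h : IsQuadricModel n B κ ι) (hcs : IsTrigPair κ c s)
    (he : ∀ v : TangentSpace (𝓡 n) p, ι (expMap p v) = quadricRay ι c s p v 1)
    {v : TangentSpace (𝓡 n) p} (hv : v ≠ 0) (hs : s ‖v‖ ≠ 0) :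
    Function.Injective (mfderiv 𝓘(ℝ, TangentSpace (𝓡 n) p) (𝓡 n) (expMap (n := n) p) v) := by
  have e : ι ∘ expMap p = fun v => quadricRay ι c s p v 1 := funext he
  obtain ⟨k, hk⟩ := hcs.hasFDerivAt_quadricRay_one (ι := ι) hv
  have hD : ∀ w : TangentSpace (𝓡 n) p, mfderiv 𝓘(ℝ, TangentSpace (𝓡 n) p) (𝓡 n) (expMap (n := n) p) v w = 0 →
      fderiv ℝ (ι ∘ expMap p) v w = 0 := fun w hw => by
    rw [← mfderiv_eq_fderiv, mfderiv_comp v ((h.contMDiff _).mdifferentiableAt (by simp))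
      ((h.contMDiffAt_expMap hcs he hv).mdifferentiableAt (by simp))]
    exact (congrArg (mfderiv (𝓡 n) 𝓘(ℝ, F) ι (expMap p v)) hw).trans (map_zero _)
  suffices hw : ∀ w : TangentSpace (𝓡 n) p,
      mfderiv 𝓘(ℝ, TangentSpace (𝓡 n) p) (𝓡 n) (expMap (n := n) p) v w = 0 → w = 0 from
    (injective_iff_map_eq_zero _).2 hw
  intro w hw
  have h0 := hD w hw
  rw [e, hk.fderiv] at h0
  have h1 : (-(κ * s ‖v‖) * fderiv ℝ norm v w) • ι p + (1 : ℝ) • differential n ι p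
      ((s ‖v‖ / ‖v‖) • w + (k * fderiv ℝ norm v w) • v) = 0 := by
    rw [← h0]
    simp
  have h2 := h.form_combination_center (-(κ * s ‖v‖) * fderiv ℝ norm v w) 1
    ((s ‖v‖ / ‖v‖) • w + (k * fderiv ℝ norm v w) • v)
  rw [h1, map_zero, zero_apply] at h2
  have hκ := h.ne_zero
  have h3 : fderiv ℝ norm v w = 0 := by
    have := h2.symm
    simpa [hκ, hs] using this
  rw [h3, mul_zero, mul_zero, zero_smul, zero_smul, add_zero, zero_add, one_smul, map_smul] at h1
  have h4 := (smul_eq_zero.1 h1).resolve_left (div_ne_zero hs (norm_ne_zero_iff.2 hv))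
  exact h.differential_injective p (h4.trans (map_zero _).symm)

variable [IsContMDiffRiemannianBundle (𝓡 n) ∞ (EuclideanSpace ℝ (Fin n))
    (fun x : M => TangentSpace (𝓡 n) x)] [T2Space M]

theorem isNormalBall (h : IsQuadricModel n B κ ι) (hcs : IsTrigPair κ c s)
    (hr : ∀ (v : TangentSpace (𝓡 n) p) (t : ℝ), quadricRay ι c s p v t ∈ range ι)
    {ε : ENNReal} (hε : 0 < ε) (hc : InjOn c {x | 0 ≤ x ∧ ENNReal.ofReal x < ε})
    (hs : ∀ x, 0 < x → ENNReal.ofReal x < ε → s x ≠ 0) : IsNormalBall n p ε where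
  pos := hε
  subset_expDomain v _ := (h.mem_expDomain_and_expMap_eq hcs hr v).1
  injOn v hv w hw e := h.quadricRay_injOn hc hs hv hw (by
    simp only [← (h.mem_expDomain_and_expMap_eq hcs hr _).2, e])
  isLocalDiffeomorphOn := by
    rintro ⟨v, hv⟩
    have he : ∀ v : TangentSpace (𝓡 n) p, ι (expMap p v) = quadricRay ι c s p v 1 := fun v =>
      (h.mem_expDomain_and_expMap_eq hcs hr v).2
    -- The norm is not smooth at the origin, so the explicit formula is replaced there by the
    -- general result on the exponential map.
    rcases eq_or_ne v 0 with rfl | hv0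
    · obtain ⟨_, _, _, _, h0⟩ := exists_expMap (n := n) p
      exact h0
    · have hs0 := hs ‖v‖ (norm_pos_iff.2 hv0) ((mem_tangentBall_iff rfl).1 hv)
      exact isLocalDiffeomorphAt_of_injective (tangentCoord (n := n) p) isOpen_compl_singleton hv0
        (fun w hw => (h.contMDiffAt_expMap hcs he hw).contMDiffWithinAt)
        (h.mfderiv_expMap_injective hcs he hv0 hs0)

/-- Membership is decided by the product with the center alone, because a point of the quadric with
product `κ⁻¹ * c x` is reached by some vector of length `x`. -/
theorem mem_geodesicBall_iff (h : IsQuadricModel n B κ ι) (hcs : IsTrigPair κ c s)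
    (hr : ∀ (v : TangentSpace (𝓡 n) p) (t : ℝ), quadricRay ι c s p v t ∈ range ι)
    {ε : ENNReal} (hs : ∀ x, 0 < x → ENNReal.ofReal x < ε → s x ≠ 0) (q : M) :
    q ∈ geodesicBall n p ε ↔
      ∃ x, 0 ≤ x ∧ ENNReal.ofReal x < ε ∧ B (ι q) (ι p) = κ⁻¹ * c x := by
  have he : ∀ v : TangentSpace (𝓡 n) p, ι (expMap p v) = quadricRay ι c s p v 1 := fun v =>
    (h.mem_expDomain_and_expMap_eq hcs hr v).2
  constructor
  · rintro ⟨v, hv, rfl⟩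
    refine ⟨‖v‖, norm_nonneg v, (mem_tangentBall_iff rfl).1 hv, ?_⟩
    rw [he, quadricRay_one, h.form_combination_center]
  · rintro ⟨x, hx, hxε, hq⟩
    obtain ⟨v, hv, e⟩ := h.exists_quadricRay_eq hcs hs hx hxε hq
    exact ⟨v, hv, h.isEmbedding.injective ((he v).trans e)⟩

end IsQuadricModel

end QuadricBall

/-! ### Spheres -/

namespace RSphere

variable {m : ℕ} {r : ℝ}

theorem isTrigPair (hr : 0 < r) :
    IsTrigPair (r ^ 2)⁻¹ (fun x => Real.cos (x / r)) (fun x => r * Real.sin (x / r)) where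
  contDiff_cos := Real.contDiff_cos.comp (contDiff_id.div_const r)
  contDiff_sin := contDiff_const.mul (Real.contDiff_sin.comp (contDiff_id.div_const r))
  hasDerivAt_cos x := by
    refine ((hasDerivAt_id x).div_const r).cos.congr_deriv ?_
    field_simp
    rfl
  hasDerivAt_sin x := by
    refine (((hasDerivAt_id x).div_const r).sin.const_mul r).congr_deriv ?_
    field_simp
    rfl
  cos_zero := by simp
  sin_zero := by simp

theorem div_mem_iff (hr : 0 < r) {x : ℝ} :
    0 ≤ x ∧ ENNReal.ofReal x < ENNReal.ofReal (Real.pi * r) ↔ 0 ≤ x / r ∧ x / r < Real.pi := by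
  rw [ENNReal.ofReal_lt_ofReal_iff (mul_pos Real.pi_pos hr), div_lt_iff₀ hr,
    le_div_iff₀ hr, zero_mul]

theorem sin_ne_zero (hr : 0 < r) (x : ℝ) (hx : 0 < x)
    (hx' : ENNReal.ofReal x < ENNReal.ofReal (Real.pi * r)) : r * Real.sin (x / r) ≠ 0 :=
  mul_ne_zero hr.ne' (Real.sin_pos_of_pos_of_lt_pi (div_pos hx hr)
    ((div_mem_iff hr).1 ⟨hx.le, hx'⟩).2).ne'

variable [hr : Fact (0 < r)]

variable (m r) in
theorem isQuadricModel : IsQuadricModel (m + 1) (M := RSphere m r) (innerSL ℝ) (r ^ 2)⁻¹ incl where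
  symm x y := real_inner_comm y x
  ne_zero := inv_ne_zero (pow_ne_zero 2 hr.out.ne')
  finrank_eq := finrank_euclideanSpace_fin
  contMDiff := contMDiff_incl
  isEmbedding := Topology.IsEmbedding.subtypeVal
  inner_eq := inner_eq
  form_self q := by
    rw [inv_inv]
    exact q.2

theorem quadricRay_mem_range (p : RSphere m r) (v : TangentSpace (𝓡 (m + 1)) p) (t : ℝ) :
    quadricRay incl (fun x => Real.cos (x / r)) (fun x => r * Real.sin (x / r)) p v t ∈
      range (incl (m := m) (r := r)) := by
  have h := (isQuadricModel m r).form_quadricRay (isTrigPair hr.out) v t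
  rw [inv_inv] at h
  exact ⟨⟨_, h⟩, rfl⟩

theorem isNormalBall (p : RSphere m r) : IsNormalBall (m + 1) p (ENNReal.ofReal (Real.pi * r)) := by
  refine (isQuadricModel m r).isNormalBall (isTrigPair hr.out) (quadricRay_mem_range p)
    (ENNReal.ofReal_pos.2 (mul_pos Real.pi_pos hr.out)) (fun x hx y hy e => ?_) (sin_ne_zero hr.out)
  obtain ⟨hx1, hx2⟩ := (div_mem_iff hr.out).1 hx
  obtain ⟨hy1, hy2⟩ := (div_mem_iff hr.out).1 hy
  exact (div_left_inj' hr.out.ne').1 (Real.injOn_cos ⟨hx1, hx2.le⟩ ⟨hy1, hy2.le⟩ e)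

/-- The excluded value of the product with `p` is `-r ^ 2`, attained only at the antipode by the
equality case of Cauchy–Schwarz. Otherwise the distance is `r` times an arccosine less than `π`. -/
theorem geodesicBall_eq (p : RSphere m r) :
    geodesicBall (m + 1) p (ENNReal.ofReal (Real.pi * r)) = {q | q.incl ≠ -p.incl} := by
  ext q
  have hr2 : 0 < r ^ 2 := pow_pos hr.out 2
  rw [(isQuadricModel m r).mem_geodesicBall_iff (isTrigPair hr.out) (quadricRay_mem_range p)
    (sin_ne_zero hr.out), inv_inv, Set.mem_ofPred_eq]
  constructor
  · rintro ⟨x, hx, hx', e⟩ h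
    obtain ⟨hx1, hx2⟩ := (div_mem_iff hr.out).1 ⟨hx, hx'⟩
    have hp : (inner ℝ p.incl p.incl : ℝ) = r ^ 2 := p.2
    rw [innerSL_apply_apply, h, inner_neg_left, hp] at e
    have hc : Real.cos (x / r) = Real.cos Real.pi := by
      rw [Real.cos_pi]
      exact mul_left_cancel₀ hr2.ne' (e.symm.trans (by ring))
    exact hx2.ne (Real.injOn_cos ⟨hx1, hx2.le⟩ ⟨Real.pi_pos.le, le_rfl⟩ hc)
  · intro h
    have habs := abs_real_inner_le_norm q.incl p.incl
    rw [q.norm_incl, p.norm_incl, ← sq, abs_le] at habs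
    have h1 : (inner ℝ q.incl p.incl : ℝ) / r ^ 2 ≤ 1 := (div_le_one hr2).2 habs.2
    have h2 : -1 < (inner ℝ q.incl p.incl : ℝ) / r ^ 2 := by
      rw [lt_div_iff₀ hr2]
      refine lt_of_le_of_ne (by linarith) fun e => h ?_
      have hn := norm_add_sq_real q.incl p.incl
      rw [q.norm_incl, p.norm_incl, ← e] at hn
      have : ‖q.incl + p.incl‖ ^ 2 = 0 := by linarith
      exact eq_neg_of_add_eq_zero_left (norm_eq_zero.1 (by simpa using this))
    have h3 : Real.arccos ((inner ℝ q.incl p.incl : ℝ) / r ^ 2) < Real.pi :=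
      lt_of_le_of_ne (Real.arccos_le_pi _) fun e => h2.not_ge (Real.arccos_eq_pi.1 e)
    have h4 : Real.arccos ((inner ℝ q.incl p.incl : ℝ) / r ^ 2) * r / r = _ :=
      mul_div_cancel_right₀ _ hr.out.ne'
    have h5 := (div_mem_iff hr.out).2 (by
      rw [h4]
      exact ⟨Real.arccos_nonneg _, h3⟩)
    refine ⟨_, h5.1, h5.2, ?_⟩
    rw [h4, Real.cos_arccos h2.le h1, mul_div_cancel₀ _ hr2.ne']
    rfl

end RSphere

/-! ### Hyperbolic spaces -/

namespace Hyperboloid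

variable {m : ℕ} {r : ℝ}

theorem isTrigPair (hr : 0 < r) :
    IsTrigPair (-r ^ 2)⁻¹ (fun x => Real.cosh (x / r)) (fun x => r * Real.sinh (x / r)) where
  contDiff_cos := Real.contDiff_cosh.comp (contDiff_id.div_const r)
  contDiff_sin := contDiff_const.mul (Real.contDiff_sinh.comp (contDiff_id.div_const r))
  hasDerivAt_cos x := by
    refine ((hasDerivAt_id x).div_const r).cosh.congr_deriv ?_
    rw [inv_neg]
    field_simp
    rfl
  hasDerivAt_sin x := by
    refine (((hasDerivAt_id x).div_const r).sinh.const_mul r).congr_deriv ?_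
    field_simp
    rfl
  cos_zero := by simp
  sin_zero := by simp

theorem norm_spatial_sq {x : EuclideanSpace ℝ (Fin (m + 2))} (hx : lorentzForm m x x = -r ^ 2) :
    ‖spatial m x‖ ^ 2 = x 0 ^ 2 - r ^ 2 := by
  rw [lorentzForm_eq, real_inner_self_eq_norm_sq] at hx
  linarith

theorem sinh_ne_zero (hr : 0 < r) (x : ℝ) (hx : 0 < x) : r * Real.sinh (x / r) ≠ 0 :=
  mul_ne_zero hr.ne' (Real.sinh_pos_iff.2 (div_pos hx hr)).ne'

variable [hr : Fact (0 < r)]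

variable (m r) in
theorem isQuadricModel :
    IsQuadricModel (m + 1) (M := Hyperboloid m r) (lorentzForm m) (-r ^ 2)⁻¹ incl where
  symm := lorentzForm_comm m
  ne_zero := inv_ne_zero (neg_ne_zero.2 (pow_ne_zero 2 hr.out.ne'))
  finrank_eq := finrank_euclideanSpace_fin
  contMDiff := contMDiff_incl
  isEmbedding := Topology.IsEmbedding.subtypeVal
  inner_eq := inner_eq
  form_self q := by
    rw [inv_inv]
    exact q.2.1

/-- Timelike vectors with negative product lie in the same cone. -/
theorem zero_pos_of_lorentzForm_neg {x : EuclideanSpace ℝ (Fin (m + 2))} {p : Hyperboloid m r}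
    (hx : lorentzForm m x x = -r ^ 2) (hxp : lorentzForm m x p.incl < 0) : 0 < x 0 := by
  have h1 := norm_spatial_sq hx
  have h2 := norm_spatial_sq p.2.1
  have hp : 0 < p.incl 0 := p.2.2
  have hr2 : 0 < r ^ 2 := pow_pos hr.out 2
  -- If `x 0 ≤ 0`, the spatial norms are at most `-x 0` and `p 0`; Cauchy–Schwarz then makes the
  -- Lorentz product nonnegative.
  by_contra! h0
  have h3 : ‖spatial m x‖ ≤ -x 0 := abs_le_of_sq_le_sq' (by nlinarith) (by linarith) |>.2
  have h4 : ‖spatial m p.incl‖ ≤ p.incl 0 :=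
    abs_le_of_sq_le_sq' (by have : ‖spatial m p.incl‖ ^ 2 = p.incl 0 ^ 2 - r ^ 2 := h2
                            linarith) hp.le |>.2
  have h5 := (abs_le.1 (abs_real_inner_le_norm (spatial m x) (spatial m p.incl))).1
  have h6 := mul_le_mul h3 h4 (norm_nonneg _) (by linarith)
  rw [lorentzForm_eq] at hxp
  linarith

/-- The reverse Cauchy–Schwarz inequality for vectors in the same cone, reduced to the ordinary one
for the spatial parts. -/
theorem lorentzForm_le (q p : Hyperboloid m r) : lorentzForm m q.incl p.incl ≤ -r ^ 2 := by
  have h1 : ‖spatial m q.incl‖ ^ 2 = q.incl 0 ^ 2 - r ^ 2 := norm_spatial_sq q.2.1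
  have h2 : ‖spatial m p.incl‖ ^ 2 = p.incl 0 ^ 2 - r ^ 2 := norm_spatial_sq p.2.1
  have hq : 0 < q.incl 0 := q.2.2
  have hp : 0 < p.incl 0 := p.2.2
  have hq' : r ≤ q.incl 0 := abs_le_of_sq_le_sq' (by nlinarith [sq_nonneg ‖spatial m q.incl‖]) hq.le |>.2
  have hp' : r ≤ p.incl 0 := abs_le_of_sq_le_sq' (by nlinarith [sq_nonneg ‖spatial m p.incl‖]) hp.le |>.2
  have h3 : r ^ 2 ≤ q.incl 0 * p.incl 0 := by
    rw [sq]
    exact mul_le_mul hq' hp' hr.out.le hq.le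
  have h4 : ‖spatial m q.incl‖ * ‖spatial m p.incl‖ ≤ q.incl 0 * p.incl 0 - r ^ 2 := by
    refine abs_le_of_sq_le_sq' ?_ (by linarith) |>.2
    rw [mul_pow, h1, h2]
    -- With `a = q 0` and `b = p 0`, `(ab - r²)² - (a² - r²)(b² - r²) = r² (a - b)²`.
    nlinarith [mul_nonneg (sq_nonneg r) (sq_nonneg (q.incl 0 - p.incl 0))]
  have h5 := real_inner_le_norm (spatial m q.incl) (spatial m p.incl)
  rw [lorentzForm_eq]
  linarith

/-- The quadric has two sheets; the curve stays on the sheet of `p` because its product with `p` is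
`-r ^ 2 * cosh`, which is negative. -/
theorem quadricRay_mem_range (p : Hyperboloid m r) (v : TangentSpace (𝓡 (m + 1)) p) (t : ℝ) :
    quadricRay incl (fun x => Real.cosh (x / r)) (fun x => r * Real.sinh (x / r)) p v t ∈
      range (incl (m := m) (r := r)) := by
  have h := (isQuadricModel m r).form_quadricRay (isTrigPair hr.out) v t
  have h' := (isQuadricModel m r).form_combination_center (Real.cosh (t * ‖v‖ / r))
    (r * Real.sinh (t * ‖v‖ / r) / ‖v‖) v
  rw [inv_inv] at h h'
  have hneg : -r ^ 2 * Real.cosh (t * ‖v‖ / r) < 0 :=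
    mul_neg_of_neg_of_pos (neg_lt_zero.2 (pow_pos hr.out 2)) (Real.cosh_pos _)
  exact ⟨⟨_, h, zero_pos_of_lorentzForm_neg h (h'.trans_lt hneg)⟩, rfl⟩

theorem isNormalBall (p : Hyperboloid m r) : IsNormalBall (m + 1) p ⊤ := by
  refine (isQuadricModel m r).isNormalBall (isTrigPair hr.out) (quadricRay_mem_range p)
    ENNReal.zero_lt_top (fun x hx y hy e => ?_) fun x hx _ => sinh_ne_zero hr.out x hx
  exact (div_left_inj' hr.out.ne').1 (Real.cosh_strictMonoOn.injOn
    (div_nonneg hx.1 hr.out.le) (div_nonneg hy.1 hr.out.le) e)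

theorem geodesicBall_eq (p : Hyperboloid m r) : geodesicBall (m + 1) p ⊤ = univ := by
  refine eq_univ_of_forall fun q => ?_
  have hr2 : 0 < r ^ 2 := pow_pos hr.out 2
  rw [(isQuadricModel m r).mem_geodesicBall_iff (isTrigPair hr.out) (quadricRay_mem_range p)
    fun x hx _ => sinh_ne_zero hr.out x hx, inv_inv]
  have h1 : 1 ≤ -lorentzForm m q.incl p.incl / r ^ 2 := by
    rw [one_le_div hr2]
    linarith [lorentzForm_le q p]
  -- The distance from `p` to `q`; the reverse Cauchy–Schwarz inequality puts the argument of
  -- `arcosh` in its domain.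
  refine ⟨Real.arcosh (-lorentzForm m q.incl p.incl / r ^ 2) * r,
    mul_nonneg (Real.arcosh_nonneg h1) hr.out.le, ENNReal.ofReal_lt_top, ?_⟩
  rw [mul_div_cancel_right₀ _ hr.out.ne', Real.cosh_arcosh h1, neg_mul, mul_div_cancel₀ _ hr2.ne',
    neg_neg]

end Hyperboloid

end NormalCurves

end

theorem proposition1 :
    (∀ (m : ℕ) (M : Type*) [TopologicalSpace M] [T2Space M]
      [ChartedSpace (EuclideanSpace ℝ (Fin (m + 1))) M] [IsManifold (𝓡 (m + 1)) ∞ M]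
      [RiemannianBundle (fun x : M => TangentSpace (𝓡 (m + 1)) x)]
      [IsContMDiffRiemannianBundle (𝓡 (m + 1)) ∞ (EuclideanSpace ℝ (Fin (m + 1)))
        (fun x : M => TangentSpace (𝓡 (m + 1)) x)] (p : M),
      (∃ ε : ENNReal, NormalCurves.IsNormalBall (m + 1) p ε ∧
        NormalCurves.geodesicBall (m + 1) p ε ∈ 𝓝 p) ∧
      ∀ ε : ENNReal, NormalCurves.IsNormalBall (m + 1) p ε →
        NormalCurves.NormalIffSpherical (m + 1) p ε) ∧
    (∀ (m : ℕ) (r : ℝ) [Fact (0 < r)] (p : NormalCurves.RSphere m r),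
      NormalCurves.IsNormalBall (m + 1) p (ENNReal.ofReal (Real.pi * r)) ∧
      NormalCurves.geodesicBall (m + 1) p (ENNReal.ofReal (Real.pi * r)) =
        {q | q.incl ≠ -p.incl} ∧
      NormalCurves.NormalIffSpherical (m + 1) p (ENNReal.ofReal (Real.pi * r))) ∧
    (∀ (m : ℕ) (r : ℝ) [Fact (0 < r)] (p : NormalCurves.Hyperboloid m r),
      NormalCurves.IsNormalBall (m + 1) p ⊤ ∧
      NormalCurves.geodesicBall (m + 1) p ⊤ = Set.univ ∧
      NormalCurves.NormalIffSpherical (m + 1) p ⊤) := by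
  exact ⟨fun m M _ _ _ _ _ _ p => ⟨NormalCurves.exists_isNormalBall (m + 1) p,
      fun ε h => h.normalIffSpherical⟩,
    fun m r _ p => ⟨NormalCurves.RSphere.isNormalBall p, NormalCurves.RSphere.geodesicBall_eq p,
      (NormalCurves.RSphere.isNormalBall p).normalIffSpherical⟩,
    fun m r _ p => ⟨NormalCurves.Hyperboloid.isNormalBall p,
      NormalCurves.Hyperboloid.geodesicBall_eq p,
      (NormalCurves.Hyperboloid.isNormalBall p).normalIffSpherical⟩⟩
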